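/- Let $U=[-1,1]^{\mathbb N}$, $\mathbb N=\{1,2,\dots\}$, carry the product $\mu$ of the uniform probability measures on $[-1,1]$; write $x_{[k]}=(x_1,\dots,x_k)$. **Densities.** Let $p\in(0,1)$ and $0<\tilde M\le\tilde L<\infty$. For each $*\in\{\rho,\pi\}$ let $Z_*$ be a complex Banach space, $O_*\subseteq Z_*$ open, $\mathfrak f_*\in C^1(O_*;\mathbb C)$ (complex differentiability, i.e. $\mathfrak f_*$ is holomorphic) with $\tilde M\le|\mathfrak f_*(\psi)|\le\tilde L$ for all $\psi\in O_*$, and let $(\psi_{*,j})_{j\in\mathbb N}\subseteq Z_*\setminus\{0\}$ satisfy $(\|\psi_{*,j}\|_{Z_*})_{j}\in\ell^p(\mathbb N)$ and $\sum_j y_j\psi_{*,j}\in O_*$ for all $y\in U$. Assume that $f_*(y)=\mathfrak f_*\big(\sum_{j\in\mathbb N} y_j\psi_{*,j}\big)$ is a positive probability density on $U$, i.e. $f_*(y)\in(0,\infty)$ for all $y\in U$ and $\int_U f_*\,d\mu=1$. Set $b_j=\max\{\|\psi_{\rho,j}\|_{Z_\rho},\|\psi_{\pi,j}\|_{Z_\pi}\}$.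 **Transport.** For $k\ge0$ and $x\in[-1,1]^k$ let $\hat f_{*,k}(x)=\int_U f_*(x,t)\,\mu(dt)$; for $k\ge1$ and $x\in[-1,1]^{k}$ let $f_{*,k}(x)=\hat f_{*,k}(x)/\hat f_{*,k-1}(x_{[k-1]})$ and $F_{*,k}(x)=\int_{-1}^{x_k}f_{*,k}(x_{[k-1]},t)\,dt$. The Knothe–Rosenblatt transport $T=(T_k)_{k\in\mathbb N}:U\to U$ from $f_\rho$ to $f_\pi$ is defined inductively by $$T_k(x_{[k-1]},\cdot)=F_{\pi,k}\big(T_1(x_{[1]}),\dots,T_{k-1}(x_{[k-1]}),\cdot\big)^{-1}\circ F_{\rho,k}(x_{[k-1]},\cdot).$$ **Claim.** The partial derivatives $\partial_{x_k}T_k$ exist on $[-1,1]^k$, and there exist $\alpha>0$ and $C>0$ such that the following holds. Put $\xi_j=1+\alpha/b_j$ for $j\in\mathbb N$ and, for $k\in\mathbb N$ and $\varepsilon>0$, $$\gamma(\xi_{[k]},\nu)=\xi_k^{-\max\{1,\nu_k\}}\prod_{j=1}^{k-1}\xi_j^{-\nu_j}\quad(\nu\in\mathbb N_0^k),\qquad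 \Lambda_{k,\varepsilon}=\{\nu\in\mathbb N_0^k:\gamma(\xi_{[k]},\nu)\ge\varepsilon\},\qquad N_\varepsilon=\sum_{k\in\mathbb N}|\Lambda_{k,\varepsilon}|.$$ For every $\varepsilon>0$ one has $N_\varepsilon<\infty$, and there are real polynomials $p_k\in\operatorname{span}_{\mathbb R}\{x^\nu:\nu\in\Lambda_{k,\varepsilon}\}$, $k\in\mathbb N$ (with $p_k=0$ if $\Lambda_{k,\varepsilon}=\emptyset$), such that with $$\tilde T_k(x)=-1+\frac{2}{c_k(x_{[k-1]})}\int_{-1}^{x_k}\big(1+p_k(x_{[k-1]},t)\big)^2dt,\qquad c_k(x_{[k-1]})=\int_{-1}^{1}\big(1+p_k(x_{[k-1]},t)\big)^2dt,$$ the map $\tilde T=(\tilde T_k)_{k\in\mathbb N}$ is a monotone triangular bijection of $U$ onto $U$ (that is, bijective, with $\tilde T_k$ depending on $x_{[k]}$ only and strictly increasing in $x_k$), the partial derivatives $\partial_{x_k}\tilde T_k$ exist on $[-1,1]^k$, and, if $N_\varepsilon>0$, $$\sum_{k\in\mathbb N}\|T_k-\tilde T_k\|_{L^\infty([-1,1]^k)}\le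 C\,N_\varepsilon^{-\frac1p+1}\qquad\text{and}\qquad\sum_{k\in\mathbb N}\|\partial_{x_k}T_k-\partial_{x_k}\tilde T_k\|_{L^\infty([-1,1]^k)}\le C\,N_\varepsilon^{-\frac1p+1}.$$ -/

import Mathlib

open MeasureTheory Set
open scoped ENNReal

noncomputable section

/-- The infinite-dimensional cube `U = [-1,1]^ℕ`, as a set of real sequences. Coordinates are
numbered from `0`. -/
def cube : Set (ℕ → ℝ) := Set.pi Set.univ fun _ => Icc (-1 : ℝ) 1

/-- The uniform probability measure on `[-1,1]`, as a measure on `ℝ`. -/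
def uniformMeasure : Measure ℝ := (2 : ℝ≥0∞)⁻¹ • (volume.restrict (Icc (-1 : ℝ) 1))

instance : IsProbabilityMeasure uniformMeasure := by
  constructor
  have h : (1 : ℝ) - (-1) = 2 := by norm_num
  simp only [uniformMeasure, Measure.smul_apply, Measure.restrict_apply_univ, Real.volume_Icc, h,
    smul_eq_mul, ENNReal.ofReal_ofNat]
  exact ENNReal.inv_mul_cancel (by simp) (by simp)

/-- The infinite product of the uniform measures; it is carried by `cube`. -/
def cubeMeasure : Measure (ℕ → ℝ) := Measure.infinitePi fun _ : ℕ => uniformMeasure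

/-- `f` is a positive probability density on the cube. -/
def IsPositiveDensity (f : (ℕ → ℝ) → ℝ) : Prop :=
  (∀ y ∈ cube, 0 < f y) ∧ ∫ y, f y ∂cubeMeasure = 1

/-- The density `f` on the cube is of the form `f(y) = g(∑ⱼ yⱼ ψⱼ)`, where `g` is `C¹` in the
complex sense (holomorphic) on the open set `O`, `M ≤ |g| ≤ L` on `O`, and `(‖ψⱼ‖)ⱼ ∈ ℓ^p`. -/
structure IsHolomorphicDensity {Z : Type*} [NormedAddCommGroup Z] [NormedSpace ℂ Z]
    (O : Set Z) (g : Z → ℂ) (ψ : ℕ → Z) (p M L : ℝ) (f : (ℕ → ℝ) → ℝ) : Prop where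
  isOpen : IsOpen O
  ne_zero : ∀ j, ψ j ≠ 0
  summable : Summable fun j => ‖ψ j‖ ^ p
  mem : ∀ y ∈ cube, (∑' j, (y j : ℂ) • ψ j) ∈ O
  contDiffOn : ContDiffOn ℂ 1 g O
  eq : ∀ y ∈ cube, (f y : ℂ) = g (∑' j, (y j : ℂ) • ψ j)
  density : IsPositiveDensity f
  lower : ∀ z ∈ O, M ≤ ‖g z‖
  upper : ∀ z ∈ O, ‖g z‖ ≤ L

/-- The sequence `(x₀, …, x_{k-1}, t₀, t₁, …)`. -/
def concat (k : ℕ) (x t : ℕ → ℝ) : ℕ → ℝ := fun j => if j < k then x j else t (j - k)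

/-- The density of the marginal in the first `k` variables. -/
def marginal (f : (ℕ → ℝ) → ℝ) (k : ℕ) (x : ℕ → ℝ) : ℝ :=
  ∫ t, f (concat k x t) ∂cubeMeasure

/-- The density of the `k`-th variable conditioned on the previous ones. -/
def condDensity (f : (ℕ → ℝ) → ℝ) (k : ℕ) (x : ℕ → ℝ) : ℝ :=
  marginal f (k + 1) x / marginal f k x

/-- The conditional distribution function
`F_k(x₀, …, x_{k-1}, s) = ∫_{-1}^s f_k(x₀, …, x_{k-1}, t) dt`. -/
def condCDF (f : (ℕ → ℝ) → ℝ) (k : ℕ) (x : ℕ → ℝ) (s : ℝ) : ℝ :=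
  ∫ t in (-1 : ℝ)..s, condDensity f k (Function.update x k t)

/-- The `k`-th component `T_k` of the Knothe–Rosenblatt transport from the density `fρ` to the
density `fπ`:
`T_k(x, ·) = F_{π;k}(T_0(x), …, T_{k-1}(x), ·)⁻¹ ∘ F_{ρ;k}(x₀, …, x_{k-1}, ·)`, where the inverse
is that of a function on `[-1,1]`. (The entries `j ≥ k` of the sequence that is passed to
`F_{π;k}` play no role.) -/
def knothe (fρ fπ : (ℕ → ℝ) → ℝ) (k : ℕ) (x : ℕ → ℝ) : ℝ :=
  Function.invFunOn
    (condCDF fπ k fun j => if _h : j < k then knothe fρ fπ j x else 0)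
    (Icc (-1 : ℝ) 1) (condCDF fρ k x (x k))
termination_by k

/-- `γ(ξ_{[k]}, ν) = ξ_k^{-max{1,ν_k}} ∏_{j<k} ξ_j^{-ν_j}` for a multiindex `ν` with entries
`0, …, k`. -/
def gammaWeight (ξ : ℕ → ℝ) (k : ℕ) (ν : Fin (k + 1) →₀ ℕ) : ℝ :=
  (ξ k ^ max 1 (ν (Fin.last k)))⁻¹ * ∏ j : Fin k, (ξ j ^ ν j.castSucc)⁻¹

/-- The index set `Λ_{k,ε}`. -/
def indexSet (ξ : ℕ → ℝ) (ε : ℝ) (k : ℕ) : Set (Fin (k + 1) →₀ ℕ) :=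
  {ν | ε ≤ gammaWeight ξ k ν}

/-- `N_ε = ∑_k |Λ_{k,ε}|`, with values in `[0,∞]`. -/
def totalCard (ξ : ℕ → ℝ) (ε : ℝ) : ℝ≥0∞ :=
  ∑' k, ((indexSet ξ ε k).encard : ℝ≥0∞)

/-- The value `q(x₀, …, x_{k-1}, t)` of a polynomial `q` in `k + 1` variables. -/
def evalAt {k : ℕ} (q : MvPolynomial (Fin (k + 1)) ℝ) (x : ℕ → ℝ) (t : ℝ) : ℝ :=
  MvPolynomial.eval (fun i : Fin (k + 1) => Function.update x k t i) q

/-- The rational function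
`-1 + (2 / c(x)) ∫_{-1}^{x_k} (1 + q(x₀, …, x_{k-1}, t))² dt` with
`c(x) = ∫_{-1}^1 (1 + q(x₀, …, x_{k-1}, t))² dt`. -/
def rationalComponent {k : ℕ} (q : MvPolynomial (Fin (k + 1)) ℝ) (x : ℕ → ℝ) : ℝ :=
  -1 + 2 / (∫ t in (-1 : ℝ)..1, (1 + evalAt q x t) ^ 2) *
    ∫ t in (-1 : ℝ)..(x k), (1 + evalAt q x t) ^ 2

/-- The map with components `T k` is a monotone triangular bijection of the cube. -/
structure IsMonotoneTriangularBijection (T : ℕ → (ℕ → ℝ) → ℝ) : Prop where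
  triangular : ∀ k, ∀ x ∈ cube, ∀ y ∈ cube, (∀ j ≤ k, x j = y j) → T k x = T k y
  monotone : ∀ k, ∀ x ∈ cube, StrictMonoOn (fun t => T k (Function.update x k t)) (Icc (-1 : ℝ) 1)
  bijOn : BijOn (fun x k => T k x) cube cube

/-- `G` has a partial derivative in the `k`-th variable at each point of the cube (one-sided where
`x_k = ±1`). -/
def HasPartial (k : ℕ) (G : (ℕ → ℝ) → ℝ) : Prop :=
  ∀ x ∈ cube, DifferentiableWithinAt ℝ (fun t => G (Function.update x k t)) (Icc (-1 : ℝ) 1) (x k)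

/-- The partial derivative in the `k`-th variable (one-sided where `x_k = ±1`). -/
def partialDeriv (k : ℕ) (G : (ℕ → ℝ) → ℝ) (x : ℕ → ℝ) : ℝ :=
  derivWithin (fun t => G (Function.update x k t)) (Icc (-1 : ℝ) 1) (x k)

/-- The supremum of `|G|` over the cube, with values in `[0,∞]`. -/
def supNorm (G : (ℕ → ℝ) → ℝ) : ℝ≥0∞ := ⨆ x ∈ cube, ‖G x‖ₑ

end

/-! Differentiating the defining relation of the transport gives `∂_k T_k = f_{ρ,k} / (f_{π,k} ∘ T)
> 0`, and `T_k` runs from `-1` to `1` in its last variable. It is therefore enough to approximate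
the root `u_k = √(∂_k T_k)` by a polynomial `1 + p_k`: squaring keeps monotonicity, dividing by
`c_k` restores the endpoint, and both operations are stable while `1 + p_k` is bounded and bounded
away from zero (`abs_sub_rationalComponent_le`). What remains is a sparse polynomial approximation
of `u_k - 1`, summed over all `k`.

Holomorphy. A density sees its argument only through `∑ y_j ψ_j`, which ranges over a compact convex
subset of `O`. Moving the coordinates into the complex plane with `∑ b_j |z_j - x_j| ≤ r` stays near
that set, with `r` independent of the number of variables
(`IsHolomorphicDensity.exists_isMarginalExtension`). Conditional densities are quotients of
marginals, and for small `r` their values lie in a disc about some `A > 0` that avoids `0`. A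
complex conditional distribution function is thus a perturbation of `s ↦ A s`: it expands distances
and covers discs, so the entries of the image can be solved for one after another. Their errors
enter later equations with weights `b_j`; as `b` is summable, a Grönwall argument bounds them
uniformly in the number of variables (`exists_isComplexTransport`). Hence `u_k - 1` has a
holomorphic extension `G_k` to `∑ b_j |z_j - x_j| ≤ η`, with one `η` for all `k`. A conditional
density has mean one in its last variable and oscillates there by `O(b_k)`, so `G_k` carries a
factor `b_k` (`exists_isRootExtension`).

Coefficients. The Chebyshev expansion of `G_k` is the Fourier series of `G_k ∘ cos`. Shifting the
torus into the complex domain bounds the coefficients by `C b_k ρ_k ∏ ρ_j^{-|n_j|}` for every `ρ`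
with `ρ_j ≥ 1` and `∑ b_j (ρ_j - 1) ≤ η` (`IsRootExtension.norm_coeff_le`). Since `b_j (ξ_j^{1-p} -
1) ≤ α^{1-p} b_j^p` is summable, for small `α` the radii `ξ_j^{1-p}` use only part of the budget
`η`; the rest goes to factors adapted to `n`. This makes the coefficients summable over all `k` and
`n` even against `γ^{-(1-p)}` (`exists_tsum_mul_gammaWeight_rpow_lt_top`).

Counting. The powers `γ^p` are summable over all indices, so `N_ε ε^p ≤ S`
(`exists_totalCard_mul_rpow_le`). Dropping the terms with `γ < ε` costs a multiple of `ε^{1-p}`, and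
`ε^{1-p} ≤ (S / N_ε)^{1/p - 1}` is the claimed rate. -/

open Filter Topology Asymptotics

/-! ### Complex analysis in one variable: integrals, primitives, perturbed linear maps. -/

/-- A parametric integral of uniformly bounded holomorphic functions is holomorphic. -/
theorem differentiableOn_integral_of_bounded {α : Type*} [MeasurableSpace α] {μ : Measure α}
    [IsFiniteMeasure μ] {Ω : Set ℂ} (hΩ : IsOpen Ω) {F : ℂ → α → ℂ} {C : ℝ}
    (hm : ∀ τ ∈ Ω, AEStronglyMeasurable (F τ) μ)
    (hd : ∀ᵐ a ∂μ, DifferentiableOn ℂ (fun τ => F τ a) Ω)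
    (hC : ∀ᵐ a ∂μ, ∀ τ ∈ Ω, ‖F τ a‖ ≤ C) :
    DifferentiableOn ℂ (fun τ => ∫ a, F τ a ∂μ) Ω := by
  intro τ₀ h₀
  obtain ⟨R, hR, hball⟩ := Metric.isOpen_iff.1 hΩ τ₀ h₀
  have hR2 : 0 < R / 2 := by positivity
  have hsub : ∀ τ ∈ Metric.ball τ₀ (R / 2), Metric.closedBall τ (R / 4) ⊆ Ω := by
    intro τ hτ w hw
    apply hball
    rw [Metric.mem_ball] at hτ ⊢
    rw [Metric.mem_closedBall] at hw
    linarith [dist_triangle w τ τ₀]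
  -- Measurability of the derivative in `a` is not assumed; it is inherited from difference
  -- quotients along a sequence in `Ω` that tends to `τ₀`.
  have hmeas' : AEStronglyMeasurable (fun a => deriv (fun τ => F τ a) τ₀) μ := by
    have hseq : Tendsto (fun n : ℕ => τ₀ + ((R / 2 / ((n : ℝ) + 1) : ℝ) : ℂ)) atTop (𝓝[≠] τ₀) := by
      rw [tendsto_nhdsWithin_iff]
      constructor
      · have h1 : Tendsto (fun n : ℕ => (R / 2 / ((n : ℝ) + 1) : ℝ)) atTop (𝓝 0) := by
          have := (tendsto_one_div_add_atTop_nhds_zero_nat (𝕜 := ℝ)).const_mul (R / 2)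
          simpa [div_eq_mul_inv] using this
        have h2 := ((Complex.continuous_ofReal.tendsto 0).comp h1).const_add τ₀
        simpa using h2
      · refine Eventually.of_forall fun n => ?_
        have : (R / 2 / ((n : ℝ) + 1) : ℝ) ≠ 0 := by positivity
        rw [mem_compl_iff, mem_singleton_iff, add_eq_left]
        exact_mod_cast this
    refine aestronglyMeasurable_of_tendsto_ae atTop
      (f := fun (n : ℕ) a => slope (fun τ => F τ a) τ₀ (τ₀ + ((R / 2 / ((n : ℝ) + 1) : ℝ) : ℂ)))
      (fun n => ?_) ?_
    · simp only [slope, vsub_eq_sub]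
      refine AEStronglyMeasurable.fun_const_smul (AEStronglyMeasurable.fun_sub (hm _ ?_) (hm _ h₀)) _
      apply hball
      rw [Metric.mem_ball, dist_eq_norm, add_sub_cancel_left, Complex.norm_real, Real.norm_eq_abs,
        abs_of_pos (by positivity)]
      calc R / 2 / ((n : ℝ) + 1) ≤ R / 2 := div_le_self hR2.le (by linarith [n.cast_nonneg (α := ℝ)])
        _ < R := by linarith
    · filter_upwards [hd] with a ha
      exact (hasDerivAt_iff_tendsto_slope.1
        ((ha τ₀ h₀).differentiableAt (hΩ.mem_nhds h₀)).hasDerivAt).comp hseq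
  refine (hasDerivAt_integral_of_dominated_loc_of_deriv_le (F := F) (x₀ := τ₀)
    (bound := fun _ => C / (R / 4)) (F' := fun τ a => deriv (fun τ => F τ a) τ)
    (Metric.ball_mem_nhds τ₀ hR2) ?_ ?_ hmeas' ?_
    (integrable_const _) ?_).2.differentiableAt.differentiableWithinAt
  · filter_upwards [hΩ.mem_nhds h₀] with τ hτ using hm τ hτ
  · exact Integrable.of_bound (hm _ h₀) C (hC.mono fun a ha => ha _ h₀)
  · filter_upwards [hd, hC] with a ha hCa τ hτ
    refine Complex.norm_deriv_le_of_forall_mem_sphere_norm_le (by positivity)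
      (DifferentiableOn.diffContOnCl_ball (U := Ω) ha (hsub τ hτ)) fun z hz =>
        hCa z (hsub τ hτ (Metric.sphere_subset_closedBall hz))
  · filter_upwards [hd] with a ha τ hτ
    have hτΩ : τ ∈ Ω := hsub τ hτ (Metric.mem_closedBall_self (by positivity))
    exact ((ha τ hτΩ).differentiableAt (hΩ.mem_nhds hτΩ)).hasDerivAt

/-- The integral of a holomorphic function along segments from a fixed base point is a primitive. -/
theorem hasDerivAt_segment_integral {S : Set ℂ} (hS : IsOpen S) (hconv : Convex ℝ S) {h : ℂ → ℂ}
    (hh : DifferentiableOn ℂ h S) {a s : ℂ} (ha : a ∈ S) (hs : s ∈ S) :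
    HasDerivAt (fun s => (s - a) * ∫ u in (0 : ℝ)..1, h (a + u * (s - a))) (h s) s := by
  -- Poincaré lemma for the one-form `h dz`: complex linearity of the derivative of `h` makes its
  -- real derivative symmetric, so the form is closed.
  have key := hconv.hasFDerivWithinAt_curveIntegral_segment_of_hasFDerivWithinAt_symmetric
    (ω := fun z => ContinuousLinearMap.toSpanSingleton ℂ (h z))
    (dω := fun z => ((ContinuousLinearMap.toSpanSingletonCLE (𝕜 := ℂ) (E := ℂ)).toContinuousLinearMap.comp
      (ContinuousLinearMap.toSpanSingleton ℂ (deriv h z))).restrictScalars ℝ)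
    (a := a) (b := s) ?_ ?_ ha hs
  · have h1 := (key.hasFDerivAt (hS.mem_nhds hs)).hasDerivAt
    simp only [ContinuousLinearMap.toSpanSingleton_apply, one_smul] at h1
    refine h1.congr_of_eventuallyEq (Eventually.of_forall fun w => ?_)
    simp only [curveIntegral_segment, AffineMap.lineMap_apply, vsub_eq_sub, vadd_eq_add,
      ContinuousLinearMap.toSpanSingleton_apply, smul_eq_mul, Complex.real_smul]
    rw [intervalIntegral.integral_const_mul]
    congr 1
    refine intervalIntegral.integral_congr fun u _ => ?_
    rw [add_comm]
  · intro z hz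
    have h1 := ((hh z hz).differentiableAt (hS.mem_nhds hz)).hasDerivAt.hasFDerivAt
    have h2 := (ContinuousLinearMap.toSpanSingletonCLE (𝕜 := ℂ) (E := ℂ)).toContinuousLinearMap.hasFDerivAt.comp z h1
    exact (h2.restrictScalars ℝ).hasFDerivWithinAt
  · intro z _ x _ y _
    simp
    ring

/-- Mean value inequality for `φ s - A * s`. Expansion of distances, covering of discs and implicit
differentiation all rest on this control of `φ` by multiplication with `A`. -/
theorem norm_image_sub_sub_le_of_norm_deriv_sub_le {S : Set ℂ} (hconv : Convex ℝ S) {φ h : ℂ → ℂ}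
    (hφ : ∀ s ∈ S, HasDerivAt φ (h s) s) {A : ℂ} {q : ℝ} (hq : ∀ s ∈ S, ‖h s - A‖ ≤ q)
    {s s' : ℂ} (hs : s ∈ S) (hs' : s' ∈ S) :
    ‖φ s - φ s' - A * (s - s')‖ ≤ q * ‖s - s'‖ := by
  have := hconv.norm_image_sub_le_of_norm_hasDerivWithin_le (f := fun s => φ s - A * s)
    (f' := fun s => h s - A) (C := q)
    (fun x hx => ((hφ x hx).sub (by simpa using (hasDerivAt_id x).const_mul A)).hasDerivWithinAt)
    hq hs' hs
  have e : φ s - φ s' - A * (s - s') = φ s - A * s - (φ s' - A * s') := by ring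
  rw [e]
  exact this

/-- A function whose derivative is close to a constant expands distances. -/
theorem le_norm_image_sub_of_norm_deriv_sub_le {S : Set ℂ} (hconv : Convex ℝ S) {φ h : ℂ → ℂ}
    (hφ : ∀ s ∈ S, HasDerivAt φ (h s) s) {A m : ℝ} (hA : 0 ≤ A)
    (hq : ∀ s ∈ S, ‖h s - A‖ ≤ A - m) {s s' : ℂ} (hs : s ∈ S) (hs' : s' ∈ S) :
    m * ‖s - s'‖ ≤ ‖φ s - φ s'‖ := by
  have h1 := norm_image_sub_sub_le_of_norm_deriv_sub_le hconv hφ hq hs hs'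
  have h2 : ‖(A : ℂ) * (s - s')‖ = A * ‖s - s'‖ := by
    rw [norm_mul, Complex.norm_real, Real.norm_of_nonneg hA]
  have h3 := norm_sub_norm_le ((A : ℂ) * (s - s')) (φ s - φ s')
  rw [norm_sub_rev, h2] at h3
  rw [norm_sub_rev] at h3
  have h4 : ‖(A : ℂ) * (s - s') - (φ s - φ s')‖ = ‖φ s - φ s' - A * (s - s')‖ := norm_sub_rev _ _
  nlinarith [norm_sub_norm_le ((A : ℂ) * (s - s')) (φ s - φ s')]

/-- A function whose derivative is close to a constant maps balls onto large sets. -/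
theorem exists_mem_closedBall_image_eq {φ h : ℂ → ℂ} {c : ℂ} {R A m : ℝ} (hR : 0 ≤ R)
    (hφ : ∀ s ∈ Metric.closedBall c R, HasDerivAt φ (h s) s) (hm : 0 < m) (hA : m ≤ A)
    (hq : ∀ s ∈ Metric.closedBall c R, ‖h s - A‖ ≤ A - m) {v : ℂ} (hv : ‖v - φ c‖ ≤ m * R) :
    ∃ s ∈ Metric.closedBall c R, φ s = v := by
  have hA0 : 0 < A := hm.trans_le hA
  have hAc : (A : ℂ) ≠ 0 := by exact_mod_cast hA0.ne'
  let e : ℂ ≃L[ℂ] ℂ := ContinuousLinearEquiv.unitsEquivAut ℂ (Units.mk0 (A : ℂ) hAc)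
  have he : ∀ z, e z = A * z := fun z => by
    simp [e, mul_comm]
  have happ : ApproximatesLinearOn φ (e : ℂ →L[ℂ] ℂ) (Metric.closedBall c R)
      (Real.toNNReal (A - m)) := by
    intro s hs s' hs'
    rw [Real.coe_toNNReal _ (by linarith)]
    have := norm_image_sub_sub_le_of_norm_deriv_sub_le (convex_closedBall c R) hφ hq hs hs'
    simpa [he] using this
  -- Division by `A` is a right inverse of norm `A⁻¹`, so the covered radius is `(A - (A - m)) * R =
  -- m * R`.
  let inv : (e : ℂ →L[ℂ] ℂ).NonlinearRightInverse :=
    { toFun := fun z => e.symm z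
      nnnorm := Real.toNNReal A⁻¹
      bound' := fun y => by
        rw [Real.coe_toNNReal _ (by positivity)]
        obtain ⟨z, rfl⟩ := e.surjective y
        rw [e.symm_apply_apply, he, norm_mul, Complex.norm_real, Real.norm_of_nonneg hA0.le,
          inv_mul_cancel_left₀ hA0.ne']
      right_inv' := fun y => by simp }
  have hsurj := happ.surjOn_closedBall_of_nonlinearRightInverse inv hR subset_rfl
  have hv' : v ∈ Metric.closedBall (φ c) (((inv.nnnorm : ℝ)⁻¹ - Real.toNNReal (A - m)) * R) := by
    rw [Metric.mem_closedBall, dist_eq_norm]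
    have : (inv.nnnorm : ℝ) = A⁻¹ := Real.coe_toNNReal _ (by positivity)
    rw [this, inv_inv, Real.coe_toNNReal _ (by linarith)]
    simpa using hv
  exact hsurj hv'

/-- Implicit differentiation of a relation that is holomorphic in each variable. -/
theorem hasDerivAt_of_implicit {Φ h : ℂ → ℂ → ℂ} {w : ℂ → ℂ} {τ₀ φ' v' : ℂ}
    (hw : ContinuousAt w τ₀)
    (hΦ : ∀ᶠ q : ℂ × ℂ in 𝓝 (τ₀, w τ₀), HasDerivAt (Φ q.1) (h q.1 q.2) q.2)
    (hh : ContinuousAt (fun q : ℂ × ℂ => h q.1 q.2) (τ₀, w τ₀)) (h0 : h τ₀ (w τ₀) ≠ 0)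
    (hφ' : HasDerivAt (fun τ => Φ τ (w τ₀)) φ' τ₀) (hv' : HasDerivAt (fun τ => Φ τ (w τ)) v' τ₀) :
    HasDerivAt w ((v' - φ') / h τ₀ (w τ₀)) τ₀ := by
  set A := h τ₀ (w τ₀) with hA
  set r : ℂ → ℂ := fun τ => Φ τ (w τ) - Φ τ (w τ₀) - A * (w τ - w τ₀) with hr
  have hro : r =o[𝓝 τ₀] fun τ => A * (w τ - w τ₀) := by
    refine IsLittleO.trans_isBigO (g := fun τ => w τ - w τ₀) ?_ ?_
    · rw [isLittleO_iff]
      intro ε hε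
      have h1 : ∀ᶠ q : ℂ × ℂ in 𝓝 (τ₀, w τ₀), ‖h q.1 q.2 - A‖ ≤ ε := by
        have := Metric.tendsto_nhds.1 hh ε hε
        filter_upwards [this] with q hq
        rw [← dist_eq_norm]; exact hq.le
      obtain ⟨δ, hδ, hball⟩ := Metric.eventually_nhds_iff.1 (hΦ.and h1)
      have hwδ : ∀ᶠ τ in 𝓝 τ₀, dist (w τ) (w τ₀) < δ := Metric.tendsto_nhds.1 hw δ hδ
      filter_upwards [hwδ, Metric.ball_mem_nhds τ₀ hδ] with τ hτ hτ2
      refine norm_image_sub_sub_le_of_norm_deriv_sub_le (convex_ball (w τ₀) δ) (h := h τ)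
        (fun s hs => (hball (y := (τ, s)) ?_).1) (fun s hs => (hball (y := (τ, s)) ?_).2)
        hτ (Metric.mem_ball_self hδ)
      all_goals
        rw [Prod.dist_eq]
        exact max_lt hτ2 hs
    · exact (isBigO_refl _ _).const_mul_right' (isUnit_iff_ne_zero.2 h0)
  have hX : (fun τ => Φ τ (w τ) - Φ τ (w τ₀) - (v' - φ') * (τ - τ₀)) =o[𝓝 τ₀] fun τ => τ - τ₀ := by
    have h1 := (hv'.sub hφ').isLittleO
    refine h1.congr_left fun τ => ?_
    simp
    ring
  -- Only continuity of `w` is known. As `r` is negligible against `A * (w τ - w τ₀)`, that term is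
  -- controlled by the sum of the two, which is `O(τ - τ₀)` by `hX`. This Lipschitz bound then
  -- upgrades `hro` to `o(τ - τ₀)`.
  have hO : (fun τ => A * (w τ - w τ₀)) =O[𝓝 τ₀] fun τ => τ - τ₀ := by
    have h1 := hro.right_isBigO_add
    have h2 : (fun τ => r τ + A * (w τ - w τ₀)) =O[𝓝 τ₀] fun τ => τ - τ₀ := by
      have h3 := hX.isBigO.add ((isBigO_refl (fun τ => τ - τ₀) (𝓝 τ₀)).const_mul_left (v' - φ'))
      refine h3.congr_left fun τ => ?_
      simp [hr]
    exact h1.trans h2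
  have hro' := hro.trans_isBigO hO
  rw [hasDerivAt_iff_isLittleO]
  refine ((hX.sub hro').const_mul_left A⁻¹).congr_left fun τ => ?_
  simp only [hr, smul_eq_mul]
  field_simp
  ring

/-! ### The product measure on the cube. -/

theorem measurableSet_cube : MeasurableSet cube :=
  MeasurableSet.univ_pi fun _ => measurableSet_Icc

theorem isCompact_cube : IsCompact cube := isCompact_univ_pi fun _ => isCompact_Icc

theorem abs_le_one_of_mem_cube {x : ℕ → ℝ} (hx : x ∈ cube) (j : ℕ) : |x j| ≤ 1 :=
  abs_le.2 (hx j (mem_univ j))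

instance : IsProbabilityMeasure cubeMeasure := by
  unfold cubeMeasure; infer_instance

theorem uniformMeasure_compl_Icc : uniformMeasure (Icc (-1 : ℝ) 1)ᶜ = 0 := by
  simp [uniformMeasure, Measure.restrict_apply measurableSet_Icc.compl]

theorem ae_mem_cube : ∀ᵐ t ∂cubeMeasure, t ∈ cube := by
  have h : ∀ j : ℕ, ∀ᵐ t ∂cubeMeasure, t j ∈ Icc (-1 : ℝ) 1 := fun j =>
    (measurePreserving_eval_infinitePi (fun _ : ℕ => uniformMeasure) j).quasiMeasurePreserving.ae
      (show ∀ᵐ s ∂uniformMeasure, s ∈ Icc (-1 : ℝ) 1 from uniformMeasure_compl_Icc)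
  filter_upwards [ae_all_iff.2 h] with t ht j _ using ht j

theorem ContinuousOn.aestronglyMeasurable_cubeMeasure {E : Type*} [TopologicalSpace E]
    [TopologicalSpace.PseudoMetrizableSpace E] {F : (ℕ → ℝ) → E} (hF : ContinuousOn F cube) :
    AEStronglyMeasurable F cubeMeasure := by
  have := hF.aestronglyMeasurable (μ := cubeMeasure) measurableSet_cube
  rwa [Measure.restrict_eq_self_of_ae_mem ae_mem_cube] at this

/-- Prepending a coordinate to a sequence. -/
def prepend (a : ℝ) (t : ℕ → ℝ) : ℕ → ℝ := fun j => Nat.casesOn j a t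

theorem measurable_prepend : Measurable fun q : ℝ × (ℕ → ℝ) => prepend q.1 q.2 := by
  rw [measurable_pi_iff]
  rintro (_ | j)
  · exact measurable_fst
  · exact (measurable_pi_apply j).comp measurable_snd

/-- A product measure is determined by finite-dimensional boxes, and on these the prepended
coordinate is an independent factor. Together with Fubini this links each marginal to the next one.
-/
theorem map_prepend_cubeMeasure :
    (uniformMeasure.prod cubeMeasure).map (fun q => prepend q.1 q.2) = cubeMeasure := by
  refine Measure.eq_infinitePi (fun _ : ℕ => uniformMeasure) fun s t ht => ?_
  classical
  rw [Measure.map_apply measurable_prepend (MeasurableSet.pi s.countable_toSet fun i _ => ht i)]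
  -- The box is rewritten over an initial segment of the indices, with the full line as side off
  -- `s`, so that the factor at `0` splits off by an index shift.
  let t' : ℕ → Set ℝ := fun j => if j ∈ s then t j else univ
  let s' : Finset ℕ := Finset.range (s.sup id + 1)
  have hs' : ∀ j ∈ s, j < s.sup id + 1 := fun j hj => Nat.lt_succ_of_le (Finset.le_sup (f := id) hj)
  have hpre : (fun q : ℝ × (ℕ → ℝ) => prepend q.1 q.2) ⁻¹' (Set.pi (s : Set ℕ) t)
      = t' 0 ×ˢ Set.pi (Finset.range (s.sup id) : Set ℕ) fun j => t' (j + 1) := by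
    ext ⟨a, u⟩
    simp only [mem_preimage, Set.mem_pi, mem_prod, Finset.mem_coe, t']
    constructor
    · intro h
      constructor
      · split_ifs with h0
        · exact h 0 h0
        · trivial
      · intro j _
        split_ifs with h1
        · exact h (j + 1) h1
        · trivial
    · rintro ⟨h0, h1⟩ (_ | j) hj
      · simpa [hj, prepend] using h0
      · have := h1 j (Finset.mem_range.2 (by have := hs' _ hj; omega))
        simpa [hj, prepend] using this
  have ht' : ∀ j, MeasurableSet (t' j) := fun j => by
    simp only [t']; split_ifs
    exacts [ht j, MeasurableSet.univ]
  rw [hpre, Measure.prod_prod, cubeMeasure, Measure.infinitePi_pi _ fun j _ => ht' (j + 1),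
    mul_comm, ← Finset.prod_range_succ' (fun j => uniformMeasure (t' j)) (s.sup id)]
  symm
  rw [← Finset.prod_subset (s₁ := s) (f := fun j => uniformMeasure (t' j))
    (fun j hj => Finset.mem_range.2 (hs' j hj))]
  · exact Finset.prod_congr rfl fun j hj => by simp [t', hj]
  · intro j _ hj
    simp [t', hj]

theorem integral_uniformMeasure {E : Type*} [NormedAddCommGroup E] [NormedSpace ℝ E]
    (F : ℝ → E) : ∫ a, F a ∂uniformMeasure = (2 : ℝ)⁻¹ • ∫ a in (-1 : ℝ)..1, F a := by
  rw [uniformMeasure, integral_smul_measure, intervalIntegral.integral_of_le (by norm_num),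
    integral_Icc_eq_integral_Ioc]
  simp

theorem integral_cubeMeasure_prepend {F : (ℕ → ℝ) → ℂ} (hF : Integrable F cubeMeasure) :
    ∫ t, F t ∂cubeMeasure
      = (2 : ℝ)⁻¹ • ∫ a in (-1 : ℝ)..1, ∫ t, F (prepend a t) ∂cubeMeasure := by
  have hmp : MeasurePreserving (fun q : ℝ × (ℕ → ℝ) => prepend q.1 q.2)
      (uniformMeasure.prod cubeMeasure) cubeMeasure := ⟨measurable_prepend, map_prepend_cubeMeasure⟩
  have h1 : ∫ t, F t ∂cubeMeasure
      = ∫ q : ℝ × (ℕ → ℝ), F (prepend q.1 q.2) ∂(uniformMeasure.prod cubeMeasure) := by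
    conv_lhs => rw [← hmp.map_eq]
    exact integral_map hmp.measurable.aemeasurable (by rw [hmp.map_eq]; exact hF.1)
  have h2 : Integrable (fun q : ℝ × (ℕ → ℝ) => F (prepend q.1 q.2))
      (uniformMeasure.prod cubeMeasure) := hmp.integrable_comp_of_integrable hF
  rw [h1, integral_prod _ h2, integral_uniformMeasure]

/-! ### Holomorphic extension of the marginal densities. -/

/-- The complex sequences whose first `k` entries are within weighted distance `r` of the cube. -/
def nearCube (b : ℕ → ℝ) (r : ℝ) (k : ℕ) : Set (ℕ → ℂ) :=
  {z | ∃ x ∈ cube, ∑ j ∈ Finset.range k, b j * ‖z j - (x j : ℂ)‖ ≤ r}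

/-- `H k` is a holomorphic extension of the marginal density of `f` in the first `k` variables to a
complex neighbourhood of the cube, with uniform bounds. -/
structure IsMarginalExtension (f : (ℕ → ℝ) → ℝ) (b : ℕ → ℝ) (r M L Λ : ℝ)
    (H : ℕ → (ℕ → ℂ) → ℂ) : Prop where
  congr : ∀ k z z', (∀ j < k, z j = z' j) → H k z = H k z'
  ofReal : ∀ k, ∀ x ∈ cube, H k (fun j => (x j : ℂ)) = marginal f k x
  lower : ∀ k, ∀ x ∈ cube, M ≤ marginal f k x
  upper : ∀ k, ∀ x ∈ cube, marginal f k x ≤ L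
  lipschitz : ∀ k, ∀ z ∈ nearCube b r k, ∀ z' ∈ nearCube b r k,
    ‖H k z - H k z'‖ ≤ Λ * ∑ j ∈ Finset.range k, b j * ‖z j - z' j‖
  holomorphic : ∀ k (Ω : Set ℂ), IsOpen Ω → ∀ z : ℂ → ℕ → ℂ,
    (∀ j < k, DifferentiableOn ℂ (fun τ => z τ j) Ω) → (∀ τ ∈ Ω, z τ ∈ nearCube b r k) →
    DifferentiableOn ℂ (fun τ => H k (z τ)) Ω
  average : ∀ k, ∀ z ∈ nearCube b r k,
    H k z = (2 : ℝ)⁻¹ • ∫ a in (-1 : ℝ)..1, H (k + 1) (Function.update z k (a : ℂ))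

section Extension

variable {Z : Type*} [NormedAddCommGroup Z] [NormedSpace ℂ Z]

/-- The sum `∑_{j<k} z_j ψ_j + ∑_j t_j ψ_{j+k}`. -/
noncomputable def affineSum (ψ : ℕ → Z) (k : ℕ) (z : ℕ → ℂ) (t : ℕ → ℝ) : Z :=
  ∑ j ∈ Finset.range k, z j • ψ j + ∑' j, (t j : ℂ) • ψ (j + k)

/-- The integral of `g` over the tail variables. -/
noncomputable def tailIntegral (g : Z → ℂ) (ψ : ℕ → Z) (k : ℕ) (z : ℕ → ℂ) : ℂ :=
  ∫ t, g (affineSum ψ k z t) ∂cubeMeasure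

theorem norm_ofReal_smul_le {x : ℕ → ℝ} (hx : x ∈ cube) (j : ℕ) (v : Z) :
    ‖(x j : ℂ) • v‖ ≤ ‖v‖ := by
  rw [norm_smul, Complex.norm_real, Real.norm_eq_abs]
  exact mul_le_of_le_one_left (norm_nonneg _) (abs_le_one_of_mem_cube hx j)

theorem concat_mem_cube {x t : ℕ → ℝ} (hx : x ∈ cube) (ht : t ∈ cube) (k : ℕ) :
    concat k x t ∈ cube := fun j _ => by
  unfold concat
  split_ifs
  exacts [hx j trivial, ht _ trivial]

theorem prepend_mem_cube {a : ℝ} {t : ℕ → ℝ} (ha : a ∈ Icc (-1 : ℝ) 1) (ht : t ∈ cube) :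
    prepend a t ∈ cube := by
  rintro (_ | j) _
  exacts [ha, ht j trivial]

theorem summable_ofReal_smul [CompleteSpace Z] {ψ : ℕ → Z} (hψ : Summable fun j => ‖ψ j‖)
    {x : ℕ → ℝ} (hx : x ∈ cube) (k : ℕ) :
    Summable fun j => (x j : ℂ) • ψ (j + k) :=
  Summable.of_norm_bounded ((summable_nat_add_iff k).2 hψ) fun j => norm_ofReal_smul_le hx j _

theorem continuousOn_affineSum [CompleteSpace Z] {ψ : ℕ → Z} (hψ : Summable fun j => ‖ψ j‖)
    (k : ℕ) (z : ℕ → ℂ) : ContinuousOn (affineSum ψ k z) cube := by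
  refine continuousOn_const.add (continuousOn_tsum (u := fun j => ‖ψ (j + k)‖) (fun j => ?_)
    ((summable_nat_add_iff k).2 hψ) fun j x hx => norm_ofReal_smul_le hx j _)
  fun_prop

theorem affineSum_ofReal [CompleteSpace Z] {ψ : ℕ → Z} (hψ : Summable fun j => ‖ψ j‖)
    {x t : ℕ → ℝ} (hx : x ∈ cube) (ht : t ∈ cube) (k : ℕ) :
    affineSum ψ k (fun j => (x j : ℂ)) t = ∑' j, (concat k x t j : ℂ) • ψ j := by
  have hs : Summable fun j => (concat k x t j : ℂ) • ψ j :=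
    summable_ofReal_smul hψ (concat_mem_cube hx ht k) 0
  rw [← hs.sum_add_tsum_nat_add k, affineSum]
  congr 1
  · refine Finset.sum_congr rfl fun j hj => ?_
    simp [concat, Finset.mem_range.1 hj]
  · simp [concat]

theorem affineSum_sub {ψ : ℕ → Z} (k : ℕ) (z z' : ℕ → ℂ) (t : ℕ → ℝ) :
    affineSum ψ k z t - affineSum ψ k z' t = ∑ j ∈ Finset.range k, (z j - z' j) • ψ j := by
  simp only [affineSum, add_sub_add_right_eq_sub, sub_smul, Finset.sum_sub_distrib]

theorem norm_affineSum_sub_le {ψ : ℕ → Z} {b : ℕ → ℝ} (hb : ∀ j, ‖ψ j‖ ≤ b j) (k : ℕ) (z z' : ℕ → ℂ)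
    (t : ℕ → ℝ) : ‖affineSum ψ k z t - affineSum ψ k z' t‖
      ≤ ∑ j ∈ Finset.range k, b j * ‖z j - z' j‖ := by
  rw [affineSum_sub]
  refine (norm_sum_le _ _).trans (Finset.sum_le_sum fun j _ => ?_)
  rw [norm_smul, mul_comm]
  exact mul_le_mul_of_nonneg_right (hb j) (norm_nonneg _)

theorem affineSum_prepend [CompleteSpace Z] {ψ : ℕ → Z} (hψ : Summable fun j => ‖ψ j‖)
    (k : ℕ) (z : ℕ → ℂ) {a : ℝ} {t : ℕ → ℝ} (ha : a ∈ Icc (-1 : ℝ) 1)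
    (ht : t ∈ cube) : affineSum ψ k z (prepend a t)
      = affineSum ψ (k + 1) (Function.update z k (a : ℂ)) t := by
  have hs := summable_ofReal_smul hψ (prepend_mem_cube ha ht) k
  rw [affineSum, affineSum, hs.tsum_eq_zero_add, Finset.sum_range_succ, Function.update_self,
    ← add_assoc]
  congr 1
  · congr 1
    · refine Finset.sum_congr rfl fun j hj => ?_
      rw [Function.update_of_ne (Finset.mem_range.1 hj).ne]
    · simp [prepend]
  · refine tsum_congr fun j => ?_
    rw [show j + 1 + k = j + (k + 1) by ring]
    rfl

end Extension

theorem mem_nearCube_of_le {b : ℕ → ℝ} (hb : ∀ j, 0 ≤ b j) {r r' : ℝ} (hr : r ≤ r') {k k' : ℕ}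
    (hk : k' ≤ k) {z : ℕ → ℂ} (hz : z ∈ nearCube b r k) : z ∈ nearCube b r' k' := by
  obtain ⟨x, hx, h⟩ := hz
  exact ⟨x, hx, ((Finset.sum_le_sum_of_subset_of_nonneg (Finset.range_mono hk)
    fun j _ _ => mul_nonneg (hb j) (norm_nonneg _)).trans h).trans hr⟩

/-- Holomorphic densities have holomorphic marginals with uniform bounds. -/
theorem IsHolomorphicDensity.exists_isMarginalExtension {Z : Type*} [NormedAddCommGroup Z]
    [NormedSpace ℂ Z] [CompleteSpace Z] {O : Set Z} {g : Z → ℂ} {ψ : ℕ → Z} {p M L : ℝ}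
    {f : (ℕ → ℝ) → ℝ} (hf : IsHolomorphicDensity O g ψ p M L f) {b : ℕ → ℝ}
    (hb : ∀ j, ‖ψ j‖ ≤ b j) (hbs : Summable b) :
    ∃ r Λ : ℝ, 0 < r ∧ 0 < Λ ∧ ∃ H, IsMarginalExtension f b r M L Λ H := by
  have hψ : Summable fun j => ‖ψ j‖ := Summable.of_nonneg_of_le (fun _ => norm_nonneg _) hb hbs
  have hb0 : ∀ j, 0 ≤ b j := fun j => (norm_nonneg _).trans (hb j)
  have hcont0 : ContinuousOn (fun y : ℕ → ℝ => ∑' j, (y j : ℂ) • ψ j) cube :=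
    continuousOn_tsum (u := fun j => ‖ψ j‖) (fun j => by fun_prop) hψ
      fun j x hx => norm_ofReal_smul_le hx j _
  -- Compactness of `K` yields a thickening inside `O` on which the derivative of `g` is bounded;
  -- convexity of `K` makes the thickening convex, so that this bound becomes a Lipschitz bound.
  set K : Set Z := (fun y : ℕ → ℝ => ∑' j, (y j : ℂ) • ψ j) '' cube with hK
  have hKc : IsCompact K := isCompact_cube.image_of_continuousOn hcont0
  have hKO : K ⊆ O := by
    rintro _ ⟨y, hy, rfl⟩
    exact hf.mem y hy
  have hKconv : Convex ℝ K := by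
    rintro _ ⟨x, hx, rfl⟩ _ ⟨y, hy, rfl⟩ a c ha hc hac
    refine ⟨fun j => a * x j + c * y j, fun j _ => ?_, ?_⟩
    · have := (convex_Icc (-1 : ℝ) 1) (hx j trivial) (hy j trivial) ha hc hac
      simpa using this
    · have h1 := summable_ofReal_smul hψ hx 0
      have h2 := summable_ofReal_smul hψ hy 0
      simp only [add_zero] at h1 h2
      simp only
      rw [← h1.tsum_const_smul, ← h2.tsum_const_smul,
        ← (h1.const_smul a).tsum_add (h2.const_smul c)]
      refine tsum_congr fun j => ?_
      simp only [← Complex.coe_smul, smul_smul, ← add_smul]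
      push_cast
      rfl
  have hdiff : DifferentiableOn ℂ g O := hf.contDiffOn.differentiableOn (by norm_num)
  have hfd : ContinuousOn (fderiv ℂ g) O := by
    have := hf.contDiffOn.continuousOn_fderivWithin hf.isOpen.uniqueDiffOn (by norm_num)
    exact this.congr fun x hx => (fderivWithin_of_isOpen hf.isOpen hx).symm
  obtain ⟨Λ₀, hΛ₀⟩ := (hKc.image_of_continuousOn (hfd.mono hKO)).isBounded.exists_norm_le
  set Λ := max Λ₀ 0 + 1 with hΛ
  have hΛ0 : 0 < Λ := by positivity
  have hO'open : IsOpen (O ∩ (fun z => ‖fderiv ℂ g z‖) ⁻¹' Iio Λ) :=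
    hfd.norm.isOpen_inter_preimage hf.isOpen isOpen_Iio
  have hKO' : K ⊆ O ∩ (fun z => ‖fderiv ℂ g z‖) ⁻¹' Iio Λ := fun z hz =>
    ⟨hKO hz, lt_of_le_of_lt ((hΛ₀ _ (mem_image_of_mem _ hz)).trans (le_max_left _ _))
      (lt_add_one _)⟩
  obtain ⟨r₀, hr₀, hV⟩ := hKc.exists_thickening_subset_open hO'open hKO'
  set V := Metric.thickening r₀ K with hVdef
  have hVconv : Convex ℝ V := hKconv.thickening r₀
  have hglip : ∀ u ∈ V, ∀ v ∈ V, ‖g u - g v‖ ≤ Λ * ‖u - v‖ := fun u hu v hv =>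
    hVconv.norm_image_sub_le_of_norm_fderiv_le (𝕜 := ℂ)
      (fun x hx => (hdiff x (hV hx).1).differentiableAt (hf.isOpen.mem_nhds (hV hx).1))
      (fun x hx => (hV hx).2.le) hv hu
  -- Since `b j` dominates `‖ψ j‖`, the weighted distance of coordinates dominates the distance in
  -- `Z`. The admissible radius is therefore the same for every number of variables.
  have hmemV : ∀ k, ∀ z ∈ nearCube b (r₀ / 2) k, ∀ t ∈ cube, affineSum ψ k z t ∈ V := by
    rintro k z ⟨x, hx, hzx⟩ t ht
    rw [Metric.mem_thickening_iff]
    refine ⟨_, ⟨concat k x t, concat_mem_cube hx ht k, rfl⟩, ?_⟩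
    simp only
    rw [← affineSum_ofReal hψ hx ht, dist_eq_norm]
    have := (norm_affineSum_sub_le hb k z (fun j => (x j : ℂ)) t).trans hzx
    linarith
  have hgcont : ∀ k, ∀ z ∈ nearCube b (r₀ / 2) k,
      ContinuousOn (fun t => g (affineSum ψ k z t)) cube := fun k z hz =>
    hdiff.continuousOn.comp (continuousOn_affineSum hψ k z) fun t ht => (hV (hmemV k z hz t ht)).1
  have hgbound : ∀ k, ∀ z ∈ nearCube b (r₀ / 2) k, ∀ t ∈ cube, ‖g (affineSum ψ k z t)‖ ≤ L :=
    fun k z hz t ht => hf.upper _ (hV (hmemV k z hz t ht)).1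
  have hintegrable : ∀ k, ∀ z ∈ nearCube b (r₀ / 2) k,
      Integrable (fun t => g (affineSum ψ k z t)) cubeMeasure := fun k z hz =>
    Integrable.of_bound (hgcont k z hz).aestronglyMeasurable_cubeMeasure L
      (ae_mem_cube.mono fun t ht => hgbound k z hz t ht)
  have hreal : ∀ k, ∀ x ∈ cube, (fun j => (x j : ℂ)) ∈ nearCube b (r₀ / 2) k := fun k x hx =>
    ⟨x, hx, by simp; positivity⟩
  have hfeq : ∀ k, ∀ x ∈ cube, ∀ t ∈ cube,
      (f (concat k x t) : ℂ) = g (affineSum ψ k (fun j => (x j : ℂ)) t) := fun k x hx t ht => by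
    rw [affineSum_ofReal hψ hx ht, hf.eq _ (concat_mem_cube hx ht k)]
  have hfint : ∀ k, ∀ x ∈ cube, Integrable (fun t => f (concat k x t)) cubeMeasure := by
    intro k x hx
    refine (hintegrable k _ (hreal k x hx)).re.congr ?_
    filter_upwards [ae_mem_cube] with t ht
    rw [← hfeq k x hx t ht]
    simp
  have hfbd : ∀ y ∈ cube, M ≤ f y ∧ f y ≤ L := by
    intro y hy
    have h1 : ‖(f y : ℂ)‖ = f y := by
      rw [Complex.norm_real, Real.norm_of_nonneg (hf.density.1 y hy).le]
    rw [hf.eq y hy] at h1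
    exact ⟨h1 ▸ hf.lower _ (hf.mem y hy), h1 ▸ hf.upper _ (hf.mem y hy)⟩
  refine ⟨r₀ / 2, Λ, by positivity, hΛ0, tailIntegral g ψ, ?_⟩
  constructor
  · intro k z z' h
    unfold tailIntegral affineSum
    rw [Finset.sum_congr rfl fun j hj => by rw [h j (Finset.mem_range.1 hj)]]
  · intro k x hx
    rw [tailIntegral, marginal, ← integral_complex_ofReal]
    refine integral_congr_ae ?_
    filter_upwards [ae_mem_cube] with t ht using (hfeq k x hx t ht).symm
  · intro k x hx
    have := integral_mono_ae (integrable_const M) (hfint k x hx)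
      (ae_mem_cube.mono fun t ht => (hfbd _ (concat_mem_cube hx ht k)).1)
    simpa [marginal] using this
  · intro k x hx
    have := integral_mono_ae (hfint k x hx) (integrable_const L)
      (ae_mem_cube.mono fun t ht => (hfbd _ (concat_mem_cube hx ht k)).2)
    simpa [marginal] using this
  · intro k z hz z' hz'
    rw [tailIntegral, tailIntegral, ← integral_sub (hintegrable k z hz) (hintegrable k z' hz')]
    refine (norm_integral_le_of_norm_le_const
      (C := Λ * ∑ j ∈ Finset.range k, b j * ‖z j - z' j‖) ?_).trans (by simp)
    filter_upwards [ae_mem_cube] with t ht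
    exact (hglip _ (hmemV k z hz t ht) _ (hmemV k z' hz' t ht)).trans
      (mul_le_mul_of_nonneg_left (norm_affineSum_sub_le hb k z z' t) hΛ0.le)
  · intro k Ω hΩ z hz hzn
    refine differentiableOn_integral_of_bounded hΩ (C := L)
      (fun τ hτ => (hgcont k _ (hzn τ hτ)).aestronglyMeasurable_cubeMeasure)
      (ae_mem_cube.mono fun t ht => ?_)
      (ae_mem_cube.mono fun t ht τ hτ => hgbound k _ (hzn τ hτ) t ht)
    refine hdiff.comp (DifferentiableOn.add_const _ ?_) fun τ hτ => (hV (hmemV k _ (hzn τ hτ) t ht)).1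
    exact DifferentiableOn.fun_sum fun j hj => (hz j (Finset.mem_range.1 hj)).smul_const _
  · intro k z hz
    rw [tailIntegral, integral_cubeMeasure_prepend (hintegrable k z hz)]
    congr 1
    refine intervalIntegral.integral_congr fun a ha => ?_
    rw [uIcc_of_le (by norm_num)] at ha
    refine integral_congr_ae ?_
    filter_upwards [ae_mem_cube] with t ht
    rw [affineSum_prepend hψ k z ha ht]

theorem IsMarginalExtension.mono {f : (ℕ → ℝ) → ℝ} {b : ℕ → ℝ} {r M L Λ r' Λ' : ℝ}
    {H : ℕ → (ℕ → ℂ) → ℂ} (hH : IsMarginalExtension f b r M L Λ H) (hb : ∀ j, 0 ≤ b j)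
    (hr : r' ≤ r) (hΛ : Λ ≤ Λ') : IsMarginalExtension f b r' M L Λ' H where
  congr := hH.congr
  ofReal := hH.ofReal
  lower := hH.lower
  upper := hH.upper
  lipschitz k z hz z' hz' := (hH.lipschitz k z (mem_nearCube_of_le hb hr le_rfl hz) z'
    (mem_nearCube_of_le hb hr le_rfl hz')).trans (mul_le_mul_of_nonneg_right hΛ
      (Finset.sum_nonneg fun j _ => mul_nonneg (hb j) (norm_nonneg _)))
  holomorphic k Ω hΩ z hz hz' := hH.holomorphic k Ω hΩ z hz fun τ hτ =>
    mem_nearCube_of_le hb hr le_rfl (hz' τ hτ)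
  average k z hz := hH.average k z (mem_nearCube_of_le hb hr le_rfl hz)

theorem sum_range_succ_update_sub (b : ℕ → ℝ) (k : ℕ) (z z' : ℕ → ℂ) (s s' : ℂ) :
    ∑ j ∈ Finset.range (k + 1), b j * ‖Function.update z k s j - Function.update z' k s' j‖
      = ∑ j ∈ Finset.range k, b j * ‖z j - z' j‖ + b k * ‖s - s'‖ := by
  rw [Finset.sum_range_succ, Function.update_self, Function.update_self]
  congr 1
  refine Finset.sum_congr rfl fun j hj => ?_
  have := (Finset.mem_range.1 hj).ne
  rw [Function.update_of_ne this, Function.update_of_ne this]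

theorem update_mem_cube {x : ℕ → ℝ} (hx : x ∈ cube) (k : ℕ) {t : ℝ} (ht : t ∈ Icc (-1 : ℝ) 1) :
    Function.update x k t ∈ cube := by
  intro j _
  rcases eq_or_ne j k with rfl | h
  · simpa using ht
  · rw [Function.update_of_ne h]; exact hx j trivial

theorem ofReal_update (x : ℕ → ℝ) (k : ℕ) (t : ℝ) :
    (fun j => (Function.update x k t j : ℂ)) = Function.update (fun j => (x j : ℂ)) k (t : ℂ) := by
  ext j
  rcases eq_or_ne j k with rfl | h
  · simp
  · simp [h]

theorem update_mem_nearCube {b : ℕ → ℝ} {r₁ r₂ : ℝ} {k : ℕ} {z : ℕ → ℂ}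
    (hz : z ∈ nearCube b r₁ k) {s : ℂ} {t : ℝ} (ht : t ∈ Icc (-1 : ℝ) 1)
    (hs : b k * ‖s - t‖ ≤ r₂) : Function.update z k s ∈ nearCube b (r₁ + r₂) (k + 1) := by
  obtain ⟨x, hx, h⟩ := hz
  refine ⟨Function.update x k t, update_mem_cube hx k ht, ?_⟩
  have := sum_range_succ_update_sub b k z (fun j => (x j : ℂ)) s t
  rw [← ofReal_update] at this
  rw [this]
  exact add_le_add h hs

theorem ofReal_mem_nearCube {b : ℕ → ℝ} {r : ℝ} (hr : 0 ≤ r) (k : ℕ) {x : ℕ → ℝ} (hx : x ∈ cube) :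
    (fun j => (x j : ℂ)) ∈ nearCube b r k := ⟨x, hx, by simpa using hr⟩

/-! ### Holomorphic extension of the conditional densities. -/

/-- `h k` is a holomorphic extension of the conditional density of the `k`-th variable to a complex
neighbourhood of the cube; its values lie in the disc of radius `A - m` about `A`. -/
structure IsCondExtension (f : (ℕ → ℝ) → ℝ) (b : ℕ → ℝ) (r m A Λ : ℝ)
    (h : ℕ → (ℕ → ℂ) → ℂ) : Prop where
  congr : ∀ k z z', (∀ j ≤ k, z j = z' j) → h k z = h k z'
  ofReal : ∀ k, ∀ x ∈ cube, h k (fun j => (x j : ℂ)) = condDensity f k x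
  near : ∀ k, ∀ z ∈ nearCube b r (k + 1), ‖h k z - A‖ ≤ A - m
  lipschitz : ∀ k, ∀ z ∈ nearCube b r (k + 1), ∀ z' ∈ nearCube b r (k + 1),
    ‖h k z - h k z'‖ ≤ Λ * ∑ j ∈ Finset.range (k + 1), b j * ‖z j - z' j‖
  holomorphic : ∀ k (Ω : Set ℂ), IsOpen Ω → ∀ z : ℂ → ℕ → ℂ,
    (∀ j ≤ k, DifferentiableOn ℂ (fun τ => z τ j) Ω) → (∀ τ ∈ Ω, z τ ∈ nearCube b r (k + 1)) →
    DifferentiableOn ℂ (fun τ => h k (z τ)) Ω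
  integral : ∀ k, ∀ z ∈ nearCube b r k,
    ∫ a in (-1 : ℝ)..1, h k (Function.update z k (a : ℂ)) = 2

/-- By `h1` the complex marginals have norm between `M / 2` and `2 * L`, so their quotient is
Lipschitz. On the cube the quotient lies in `[M / L, L / M]`, at distance at most `L / M - M / L`
from `A = L / M`; by `h2` the complex perturbation uses up only half of the gap `M / L`, and the
other half is `m`. -/
theorem IsMarginalExtension.isCondExtension {f : (ℕ → ℝ) → ℝ} {b : ℕ → ℝ} {r M L Λ : ℝ}
    {H : ℕ → (ℕ → ℂ) → ℂ} (hH : IsMarginalExtension f b r M L Λ H) (hb : ∀ j, 0 ≤ b j)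
    (hr : 0 ≤ r) (hM : 0 < M) (hML : M ≤ L) (hΛ : 0 ≤ Λ) (h1 : Λ * r ≤ M / 2)
    (h2 : (2 / M + 8 * L / M ^ 2) * Λ * r ≤ M / L / 2) :
    IsCondExtension f b r (M / L / 2) (L / M) ((2 / M + 8 * L / M ^ 2) * Λ)
      (fun k z => H (k + 1) z / H k z) := by
  have hL : 0 < L := hM.trans_le hML
  have hclose : ∀ k z (x : ℕ → ℝ), x ∈ cube → ∑ j ∈ Finset.range k, b j * ‖z j - (x j : ℂ)‖ ≤ r →
      ‖H k z - marginal f k x‖ ≤ M / 2 := by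
    intro k z x hx hzx
    rw [← hH.ofReal k x hx]
    refine (hH.lipschitz k z ⟨x, hx, hzx⟩ _ (ofReal_mem_nearCube hr k hx)).trans ?_
    exact (mul_le_mul_of_nonneg_left hzx hΛ).trans h1
  have hlow : ∀ k, ∀ z ∈ nearCube b r k, M / 2 ≤ ‖H k z‖ := by
    rintro k z ⟨x, hx, hzx⟩
    have h3 := hclose k z x hx hzx
    have h4 := hH.lower k x hx
    have h5 : ‖(marginal f k x : ℂ)‖ = marginal f k x := by
      rw [Complex.norm_real, Real.norm_of_nonneg (by linarith)]
    have h6 := norm_sub_norm_le (marginal f k x : ℂ) (H k z)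
    rw [norm_sub_rev] at h6
    linarith
  have hup : ∀ k, ∀ z ∈ nearCube b r k, ‖H k z‖ ≤ 2 * L := by
    rintro k z ⟨x, hx, hzx⟩
    have h3 := hclose k z x hx hzx
    have h4 := hH.lower k x hx
    have h4' := hH.upper k x hx
    have h5 : ‖(marginal f k x : ℂ)‖ = marginal f k x := by
      rw [Complex.norm_real, Real.norm_of_nonneg (by linarith)]
    have h6 := norm_sub_norm_le (H k z) (marginal f k x : ℂ)
    linarith
  have hne : ∀ k, ∀ z ∈ nearCube b r k, H k z ≠ 0 := fun k z hz =>
    norm_pos_iff.1 (by linarith [hlow k z hz])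
  have hlip : ∀ k, ∀ z ∈ nearCube b r (k + 1), ∀ z' ∈ nearCube b r (k + 1),
      ‖H (k + 1) z / H k z - H (k + 1) z' / H k z'‖
        ≤ (2 / M + 8 * L / M ^ 2) * Λ * ∑ j ∈ Finset.range (k + 1), b j * ‖z j - z' j‖ := by
    intro k z hz z' hz'
    have hzk := mem_nearCube_of_le hb le_rfl k.le_succ hz
    have hzk' := mem_nearCube_of_le hb le_rfl k.le_succ hz'
    set S := ∑ j ∈ Finset.range (k + 1), b j * ‖z j - z' j‖ with hS
    have hS0 : 0 ≤ S := Finset.sum_nonneg fun j _ => mul_nonneg (hb j) (norm_nonneg _)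
    have e1 := hH.lipschitz _ z hz z' hz'
    have e2 : ‖H k z' - H k z‖ ≤ Λ * S := by
      rw [norm_sub_rev]
      refine (hH.lipschitz _ z hzk z' hzk').trans (mul_le_mul_of_nonneg_left ?_ hΛ)
      exact Finset.sum_le_sum_of_subset_of_nonneg (Finset.range_mono k.le_succ)
        fun j _ _ => mul_nonneg (hb j) (norm_nonneg _)
    have n1 := hne k z hzk
    have n2 := hne k z' hzk'
    have l1 := hlow k z hzk
    have l2 := hlow k z' hzk'
    have e : H (k + 1) z / H k z - H (k + 1) z' / H k z'
        = (H (k + 1) z - H (k + 1) z') / H k z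
          + H (k + 1) z' * (H k z' - H k z) / (H k z * H k z') := by
      field_simp
      ring
    rw [e]
    refine (norm_add_le _ _).trans ?_
    rw [norm_div, norm_div, norm_mul, norm_mul]
    have a1 : ‖H (k + 1) z - H (k + 1) z'‖ / ‖H k z‖ ≤ Λ * S / (M / 2) :=
      div_le_div₀ (by positivity) e1 (by positivity) l1
    have a2 : ‖H (k + 1) z'‖ * ‖H k z' - H k z‖ / (‖H k z‖ * ‖H k z'‖)
        ≤ 2 * L * (Λ * S) / (M / 2 * (M / 2)) := by
      refine div_le_div₀ (by positivity) ?_ (by positivity) ?_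
      · exact mul_le_mul (hup _ _ hz') e2 (norm_nonneg _) (by positivity)
      · exact mul_le_mul l1 l2 (by positivity) (norm_nonneg _)
    refine (add_le_add a1 a2).trans (le_of_eq ?_)
    field_simp
    ring
  have hreal : ∀ k, ∀ x ∈ cube, H (k + 1) (fun j => (x j : ℂ)) / H k (fun j => (x j : ℂ))
      = condDensity f k x := fun k x hx => by
    rw [hH.ofReal _ x hx, hH.ofReal _ x hx, condDensity]
    push_cast
    rfl
  constructor
  · intro k z z' hzz
    rw [hH.congr (k + 1) z z' fun j hj => hzz j (by omega), hH.congr k z z' fun j hj => hzz j hj.le]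
  · exact hreal
  · rintro k z ⟨x, hx, hzx⟩
    have e1 := hlip k z ⟨x, hx, hzx⟩ _ (ofReal_mem_nearCube hr (k + 1) hx)
    rw [hreal k x hx] at e1
    have e2 : ‖(condDensity f k x : ℂ) - (L / M : ℝ)‖ ≤ L / M - M / L := by
      rw [← Complex.ofReal_sub, Complex.norm_real, Real.norm_eq_abs, abs_of_nonpos]
      · have : M / L ≤ condDensity f k x :=
          div_le_div₀ (by linarith [hH.lower (k + 1) x hx]) (hH.lower _ x hx)
            (by linarith [hH.lower k x hx]) (hH.upper _ x hx)
        linarith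
      · have : condDensity f k x ≤ L / M :=
          div_le_div₀ hL.le (hH.upper _ x hx) hM (hH.lower _ x hx)
        linarith
    have e3 : ‖H (k + 1) z / H k z - condDensity f k x‖ ≤ M / L / 2 := by
      refine e1.trans (le_trans (mul_le_mul_of_nonneg_left hzx (by positivity)) h2)
    have e4 := norm_add_le (H (k + 1) z / H k z - condDensity f k x)
      ((condDensity f k x : ℂ) - (L / M : ℝ))
    rw [sub_add_sub_cancel] at e4
    linarith
  · exact hlip
  · intro k Ω hΩ z hz hzn
    have hzn' : ∀ τ ∈ Ω, z τ ∈ nearCube b r k := fun τ hτ =>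
      mem_nearCube_of_le hb le_rfl k.le_succ (hzn τ hτ)
    exact (hH.holomorphic (k + 1) Ω hΩ z (fun j hj => hz j (by omega)) hzn).div
      (hH.holomorphic k Ω hΩ z (fun j hj => hz j hj.le) hzn') fun τ hτ => hne k _ (hzn' τ hτ)
  · intro k z hz
    -- The denominator does not involve the variable `k`, so the normalisation is exactly the
    -- averaging relation between successive marginals.
    have hk : ∀ a : ℝ, H k (Function.update z k (a : ℂ)) = H k z := fun a =>
      hH.congr k _ _ fun j hj => Function.update_of_ne hj.ne _ _
    simp only [hk]
    rw [intervalIntegral.integral_div, div_eq_iff (hne k z hz)]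
    have := hH.average k z hz
    rw [this, ← Complex.coe_smul]
    push_cast
    simp

/-! ### Complex conditional distribution functions. -/

/-- The complex neighbourhood of `[-1,1]` in which the `k`-th variable ranges. -/
def strip (b : ℕ → ℝ) (r : ℝ) (k : ℕ) : Set ℂ := {s | ∃ t ∈ Icc (-1 : ℝ) 1, b k * ‖s - t‖ < r}

theorem isOpen_strip (b : ℕ → ℝ) (r : ℝ) (k : ℕ) : IsOpen (strip b r k) := by
  have : strip b r k = ⋃ t ∈ Icc (-1 : ℝ) 1, {s : ℂ | b k * ‖s - t‖ < r} := by
    ext s; simp [strip]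
  rw [this]
  exact isOpen_biUnion fun t _ => isOpen_lt (by fun_prop) continuous_const

theorem convex_strip {b : ℕ → ℝ} (hb : ∀ j, 0 ≤ b j) (r : ℝ) (k : ℕ) : Convex ℝ (strip b r k) := by
  rintro s ⟨t, ht, hs⟩ s' ⟨t', ht', hs'⟩ c d hc hd hcd
  refine ⟨c * t + d * t', by simpa using (convex_Icc (-1 : ℝ) 1) ht ht' hc hd hcd, ?_⟩
  have e : c • s + d • s' - ((c * t + d * t' : ℝ) : ℂ) = c • (s - t) + d • (s' - t') := by
    simp only [Complex.real_smul]; push_cast; ring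
  rw [e]
  have h1 : ‖c • (s - t) + d • (s' - t')‖ ≤ c * ‖s - t‖ + d * ‖s' - t'‖ := by
    refine (norm_add_le _ _).trans (le_of_eq ?_)
    rw [norm_smul, norm_smul, Real.norm_of_nonneg hc, Real.norm_of_nonneg hd]
  have h2 := mul_le_mul_of_nonneg_left h1 (hb k)
  have h3 : c * (b k * ‖s - t‖) + d * (b k * ‖s' - t'‖) < r := by
    rcases hc.eq_or_lt with rfl | hc'
    · rw [zero_add] at hcd; subst hcd; simpa using hs'
    · calc c * (b k * ‖s - t‖) + d * (b k * ‖s' - t'‖) < c * r + d * r :=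
            add_lt_add_of_lt_of_le (mul_lt_mul_of_pos_left hs hc')
              (mul_le_mul_of_nonneg_left hs'.le hd)
        _ = r := by rw [← add_mul, hcd, one_mul]
  linarith

theorem ofReal_mem_strip (b : ℕ → ℝ) {r : ℝ} (hr : 0 < r) (k : ℕ) {t : ℝ}
    (ht : t ∈ Icc (-1 : ℝ) 1) : (t : ℂ) ∈ strip b r k := ⟨t, ht, by simpa using hr⟩

theorem mem_strip_of_mem_nearCube {b : ℕ → ℝ} (hb : ∀ j, 0 ≤ b j) {r r' : ℝ} (hr : r < r')
    {k K : ℕ} (hk : k < K) {z : ℕ → ℂ} (hz : z ∈ nearCube b r K) : z k ∈ strip b r' k := by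
  obtain ⟨x, hx, h⟩ := hz
  refine ⟨x k, hx k trivial, lt_of_le_of_lt (le_trans ?_ h) hr⟩
  exact Finset.single_le_sum (f := fun j => b j * ‖z j - (x j : ℂ)‖)
    (fun j _ => mul_nonneg (hb j) (norm_nonneg _)) (Finset.mem_range.2 hk)

/-- The complex extension of the conditional distribution function. -/
noncomputable def segmentCDF (h : ℕ → (ℕ → ℂ) → ℂ) (k : ℕ) (z : ℕ → ℂ) (s : ℂ) : ℂ :=
  (s - (-1)) * ∫ u in (0 : ℝ)..1, h k (Function.update z k (-1 + u * (s - (-1))))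

section CondExtension

variable {f : (ℕ → ℝ) → ℝ} {b : ℕ → ℝ} {r m A Λ : ℝ} {h : ℕ → (ℕ → ℂ) → ℂ}

theorem update_mem_nearCube_of_mem_strip {k : ℕ} {z : ℕ → ℂ} {s : ℂ}
    (hz : z ∈ nearCube b (r / 2) k) (hs : s ∈ strip b (r / 2) k) :
    Function.update z k s ∈ nearCube b r (k + 1) := by
  obtain ⟨t, ht, hst⟩ := hs
  have := update_mem_nearCube hz ht hst.le
  rwa [add_halves] at this

theorem segment_mem_strip (hb : ∀ j, 0 ≤ b j) (hr : 0 < r) {k : ℕ} {s : ℂ} (hs : s ∈ strip b r k)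
    {u : ℝ} (hu : u ∈ Icc (0 : ℝ) 1) : -1 + u * (s - (-1)) ∈ strip b r k := by
  have h1 : (-1 : ℂ) ∈ strip b r k := by
    have := ofReal_mem_strip b hr k (left_mem_Icc.2 (by norm_num : (-1 : ℝ) ≤ 1))
    simpa using this
  have := (convex_strip hb r k) h1 hs (sub_nonneg.2 hu.2) hu.1 (by ring)
  convert this using 1
  simp only [Complex.real_smul]; push_cast; ring

theorem IsCondExtension.norm_le (hh : IsCondExtension f b r m A Λ h) (hA : 0 ≤ A) (hm : 0 ≤ m)
    {k : ℕ} {z : ℕ → ℂ} (hz : z ∈ nearCube b r (k + 1)) : ‖h k z‖ ≤ 2 * A := by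
  have h1 := hh.near k z hz
  have h2 := norm_sub_norm_le (h k z) A
  rw [Complex.norm_real, Real.norm_of_nonneg hA] at h2
  linarith

theorem IsCondExtension.le_norm (hh : IsCondExtension f b r m A Λ h) (hA : 0 ≤ A)
    {k : ℕ} {z : ℕ → ℂ} (hz : z ∈ nearCube b r (k + 1)) : m ≤ ‖h k z‖ := by
  have h1 := hh.near k z hz
  have h2 := norm_sub_norm_le (A : ℂ) (h k z)
  rw [norm_sub_rev, Complex.norm_real, Real.norm_of_nonneg hA] at h2
  linarith

theorem IsCondExtension.le_condDensity (hh : IsCondExtension f b r m A Λ h) (hr : 0 ≤ r)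
    (k : ℕ) {x : ℕ → ℝ} (hx : x ∈ cube) : m ≤ condDensity f k x ∧ condDensity f k x ≤ 2 * A - m := by
  have h1 := hh.near k _ (ofReal_mem_nearCube hr (k + 1) hx)
  rw [hh.ofReal k x hx, ← Complex.ofReal_sub, Complex.norm_real, Real.norm_eq_abs, abs_le] at h1
  constructor <;> linarith [h1.1, h1.2]

theorem IsCondExtension.differentiableOn_update (hh : IsCondExtension f b r m A Λ h) {k : ℕ}
    {z : ℕ → ℂ} (hz : z ∈ nearCube b (r / 2) k) :
    DifferentiableOn ℂ (fun s => h k (Function.update z k s)) (strip b (r / 2) k) := by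
  refine hh.holomorphic k _ (isOpen_strip b _ k) (fun s => Function.update z k s) (fun j hj => ?_)
    fun s hs => update_mem_nearCube_of_mem_strip hz hs
  rcases eq_or_ne j k with rfl | hne
  · simp only [Function.update_self]
    exact differentiableOn_id
  · simp [Function.update_of_ne hne]

theorem IsCondExtension.hasDerivAt_segmentCDF (hh : IsCondExtension f b r m A Λ h)
    (hb : ∀ j, 0 ≤ b j) (hr : 0 < r) {k : ℕ} {z : ℕ → ℂ} (hz : z ∈ nearCube b (r / 2) k) {s : ℂ}
    (hs : s ∈ strip b (r / 2) k) :
    HasDerivAt (segmentCDF h k z) (h k (Function.update z k s)) s := by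
  have h1 : (-1 : ℂ) ∈ strip b (r / 2) k := by
    have := ofReal_mem_strip b (half_pos hr) k (left_mem_Icc.2 (by norm_num : (-1 : ℝ) ≤ 1))
    simpa using this
  exact hasDerivAt_segment_integral (isOpen_strip b _ k) (convex_strip hb _ k)
    (hh.differentiableOn_update hz) h1 hs

theorem IsCondExtension.continuousOn_segment (hh : IsCondExtension f b r m A Λ h)
    (hb : ∀ j, 0 ≤ b j) (hr : 0 < r) {k : ℕ} {z : ℕ → ℂ} (hz : z ∈ nearCube b (r / 2) k) {s : ℂ}
    (hs : s ∈ strip b (r / 2) k) :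
    ContinuousOn (fun u : ℝ => h k (Function.update z k (-1 + u * (s - (-1))))) (Icc 0 1) :=
  (hh.differentiableOn_update hz).continuousOn.comp (f := fun u : ℝ => -1 + (u : ℂ) * (s - (-1)))
    (by fun_prop) fun u hu => segment_mem_strip hb (half_pos hr) hs hu

/-- The Lipschitz bound for `h k` is integrated over the segment from `-1` to `s`. The last entry is
the same on both sides, so only the earlier ones contribute. -/
theorem IsCondExtension.norm_segmentCDF_sub_le (hh : IsCondExtension f b r m A Λ h)
    (hb : ∀ j, 0 ≤ b j) (hr : 0 < r) {k : ℕ} {z z' : ℕ → ℂ}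
    (hz : z ∈ nearCube b (r / 2) k) (hz' : z' ∈ nearCube b (r / 2) k) {s : ℂ}
    (hs : s ∈ strip b (r / 2) k) :
    ‖segmentCDF h k z s - segmentCDF h k z' s‖
      ≤ ‖s + 1‖ * (Λ * ∑ j ∈ Finset.range k, b j * ‖z j - z' j‖) := by
  have i1 := (hh.continuousOn_segment hb hr hz hs).intervalIntegrable_of_Icc (μ := volume) zero_le_one
  have i2 := (hh.continuousOn_segment hb hr hz' hs).intervalIntegrable_of_Icc (μ := volume) zero_le_one
  rw [segmentCDF, segmentCDF, ← mul_sub, ← intervalIntegral.integral_sub i1 i2, norm_mul,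
    sub_neg_eq_add]
  refine mul_le_mul_of_nonneg_left ?_ (norm_nonneg _)
  have := intervalIntegral.norm_integral_le_of_norm_le_const (a := (0 : ℝ)) (b := 1)
    (f := fun u : ℝ => h k (Function.update z k (-1 + u * (s + 1)))
      - h k (Function.update z' k (-1 + u * (s + 1))))
    (C := Λ * ∑ j ∈ Finset.range k, b j * ‖z j - z' j‖) ?_
  · simpa using this
  · intro u hu
    rw [uIoc_of_le zero_le_one] at hu
    have hmem : -1 + (u : ℂ) * (s + 1) ∈ strip b (r / 2) k := by
      simpa using segment_mem_strip hb (half_pos hr) hs (Ioc_subset_Icc_self hu)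
    refine (hh.lipschitz k _ (update_mem_nearCube_of_mem_strip hz hmem) _
      (update_mem_nearCube_of_mem_strip hz' hmem)).trans (le_of_eq ?_)
    rw [sum_range_succ_update_sub]
    simp

theorem IsCondExtension.norm_segmentCDF_sub_le' (hh : IsCondExtension f b r m A Λ h)
    (hb : ∀ j, 0 ≤ b j) (hr : 0 < r) (hA : 0 ≤ A) (hm : 0 ≤ m) {k : ℕ} {z : ℕ → ℂ}
    (hz : z ∈ nearCube b (r / 2) k) {s s' : ℂ}
    (hs : s ∈ strip b (r / 2) k) (hs' : s' ∈ strip b (r / 2) k) :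
    ‖segmentCDF h k z s - segmentCDF h k z s'‖ ≤ 2 * A * ‖s - s'‖ :=
  (convex_strip hb (r / 2) k).norm_image_sub_le_of_norm_hasDerivWithin_le
    (fun _ ht => (hh.hasDerivAt_segmentCDF hb hr hz ht).hasDerivWithinAt)
    (fun _ ht => hh.norm_le hA hm (update_mem_nearCube_of_mem_strip hz ht)) hs' hs

/-- The derivative in `s` stays within `A - m` of `A`, which gives expansion and not mere
injectivity. Uniqueness and continuity of the complex transport come from here. -/
theorem IsCondExtension.le_norm_segmentCDF_sub (hh : IsCondExtension f b r m A Λ h)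
    (hb : ∀ j, 0 ≤ b j) (hr : 0 < r) (hA : 0 ≤ A) {k : ℕ} {z : ℕ → ℂ}
    (hz : z ∈ nearCube b (r / 2) k) {s s' : ℂ}
    (hs : s ∈ strip b (r / 2) k) (hs' : s' ∈ strip b (r / 2) k) :
    m * ‖s - s'‖ ≤ ‖segmentCDF h k z s - segmentCDF h k z s'‖ :=
  le_norm_image_sub_of_norm_deriv_sub_le (convex_strip hb (r / 2) k)
    (fun _ ht => hh.hasDerivAt_segmentCDF hb hr hz ht) hA
    (fun _ ht => hh.near k _ (update_mem_nearCube_of_mem_strip hz ht)) hs hs'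

theorem IsCondExtension.segmentCDF_congr (hh : IsCondExtension f b r m A Λ h) {k : ℕ}
    {z z' : ℕ → ℂ} (hzz : ∀ j < k, z j = z' j) (s : ℂ) :
    segmentCDF h k z s = segmentCDF h k z' s := by
  unfold segmentCDF
  congr 1
  refine intervalIntegral.integral_congr fun u _ => hh.congr k _ _ fun j hj => ?_
  rcases hj.eq_or_lt with rfl | hj
  · simp
  · rw [Function.update_of_ne hj.ne, Function.update_of_ne hj.ne, hzz j hj]

theorem IsCondExtension.differentiableOn_segmentCDF (hh : IsCondExtension f b r m A Λ h)
    (hb : ∀ j, 0 ≤ b j) (hr : 0 < r) (hA : 0 ≤ A) (hm : 0 ≤ m) {k : ℕ} {Ω : Set ℂ} (hΩ : IsOpen Ω)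
    {z : ℂ → ℕ → ℂ} (hz : ∀ j < k, DifferentiableOn ℂ (fun τ => z τ j) Ω)
    (hzn : ∀ τ ∈ Ω, z τ ∈ nearCube b (r / 2) k) {s : ℂ → ℂ} (hs : DifferentiableOn ℂ s Ω)
    (hsn : ∀ τ ∈ Ω, s τ ∈ strip b (r / 2) k) :
    DifferentiableOn ℂ (fun τ => segmentCDF h k (z τ) (s τ)) Ω := by
  refine DifferentiableOn.mul (hs.sub_const _) ?_
  simp only [intervalIntegral.integral_of_le (zero_le_one (α := ℝ))]
  have hmem : ∀ τ ∈ Ω, ∀ u ∈ Icc (0 : ℝ) 1, Function.update (z τ) k (-1 + u * (s τ - (-1)))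
      ∈ nearCube b r (k + 1) := fun τ hτ u hu =>
    update_mem_nearCube_of_mem_strip (hzn τ hτ) (segment_mem_strip hb (half_pos hr) (hsn τ hτ) hu)
  refine differentiableOn_integral_of_bounded hΩ (C := 2 * A) (fun τ hτ => ?_) ?_ ?_
  · exact ((hh.continuousOn_segment hb hr (hzn τ hτ) (hsn τ hτ)).mono
      Ioc_subset_Icc_self).aestronglyMeasurable measurableSet_Ioc
  · filter_upwards [ae_restrict_mem measurableSet_Ioc] with u hu
    refine hh.holomorphic k Ω hΩ _ (fun j hj => ?_) fun τ hτ =>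
      hmem τ hτ u (Ioc_subset_Icc_self hu)
    rcases hj.eq_or_lt with rfl | hj
    · simp only [Function.update_self]
      exact ((hs.sub_const _).const_mul _).const_add _
    · simp only [Function.update_of_ne hj.ne]
      exact hz j hj
  · filter_upwards [ae_restrict_mem measurableSet_Ioc] with u hu τ hτ
    exact hh.norm_le hA hm (hmem τ hτ u (Ioc_subset_Icc_self hu))

theorem IsCondExtension.ofReal_update (hh : IsCondExtension f b r m A Λ h) (k : ℕ) {x : ℕ → ℝ}
    (hx : x ∈ cube) {t : ℝ} (ht : t ∈ Icc (-1 : ℝ) 1) :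
    h k (Function.update (fun j => (x j : ℂ)) k (t : ℂ)) = condDensity f k (Function.update x k t) := by
  rw [← hh.ofReal k _ (update_mem_cube hx k ht), _root_.ofReal_update]

theorem IsCondExtension.segmentCDF_ofReal (hh : IsCondExtension f b r m A Λ h) (k : ℕ)
    {x : ℕ → ℝ} (hx : x ∈ cube) {s : ℝ} (hs : s ∈ Icc (-1 : ℝ) 1) :
    segmentCDF h k (fun j => (x j : ℂ)) s = condCDF f k x s := by
  have e1 : ∫ u in (0 : ℝ)..1, h k (Function.update (fun j => (x j : ℂ)) k
        (-1 + u * ((s : ℂ) - (-1))))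
      = ((∫ u in (0 : ℝ)..1, condDensity f k (Function.update x k (-1 + (s + 1) * u)) : ℝ) : ℂ) := by
    rw [← intervalIntegral.integral_ofReal]
    refine intervalIntegral.integral_congr fun u hu => ?_
    rw [uIcc_of_le zero_le_one] at hu
    have ht : -1 + (s + 1) * u ∈ Icc (-1 : ℝ) 1 := by
      constructor
      · nlinarith [hu.1, hs.1]
      · nlinarith [hu.1, hu.2, hs.1, hs.2]
    rw [← hh.ofReal_update k hx ht]
    push_cast
    ring_nf
  rw [segmentCDF, e1, condCDF]
  have e2 := intervalIntegral.mul_integral_comp_add_mul (a := (0 : ℝ)) (b := 1)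
    (f := fun t => condDensity f k (Function.update x k t)) (s + 1) (-1)
  rw [show -1 + (s + 1) * 0 = (-1 : ℝ) by ring, show -1 + (s + 1) * 1 = s by ring] at e2
  rw [← e2]
  push_cast
  ring

/-- A conditional density has mean one in its last variable, so its deviation from one is at most
its oscillation there, and its Lipschitz constant in that variable is `Λ * b k`. The resulting
factor `b k` is what lets the errors of all components be summed. -/
theorem IsCondExtension.norm_sub_one_le (hh : IsCondExtension f b r m A Λ h) (hb : ∀ j, 0 ≤ b j)
    (hr : 0 < r) (hΛ : 0 ≤ Λ)
    {k : ℕ} {z : ℕ → ℂ} (hz : z ∈ nearCube b (r / 2) (k + 1)) {t : ℝ} (ht : t ∈ Icc (-1 : ℝ) 1) :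
    ‖h k z - 1‖ ≤ Λ * (b k * (‖z k - t‖ + 2)) := by
  have hzk : z ∈ nearCube b (r / 2) k := mem_nearCube_of_le hb le_rfl k.le_succ hz
  have hz' : z ∈ nearCube b r (k + 1) := mem_nearCube_of_le hb (half_le_self hr.le) le_rfl hz
  have hI := hh.integral k z (mem_nearCube_of_le hb (half_le_self hr.le) le_rfl hzk)
  have hcont : ContinuousOn (fun a : ℝ => h k (Function.update z k (a : ℂ))) (Icc (-1) 1) :=
    (hh.differentiableOn_update hzk).continuousOn.comp (f := fun a : ℝ => (a : ℂ))
      (by fun_prop) fun a ha => ofReal_mem_strip b (half_pos hr) k ha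
  have hii := hcont.intervalIntegrable_of_Icc (μ := volume) (by norm_num)
  have e : (2 : ℂ) * (h k z - 1)
      = ∫ a in (-1 : ℝ)..1, (h k z - h k (Function.update z k (a : ℂ))) := by
    rw [intervalIntegral.integral_sub (by simp) hii, hI, intervalIntegral.integral_const]
    rw [Complex.real_smul]; push_cast; ring
  have h2 := intervalIntegral.norm_integral_le_of_norm_le_const (a := (-1 : ℝ)) (b := 1)
    (f := fun a : ℝ => h k z - h k (Function.update z k (a : ℂ)))
    (C := Λ * (b k * (‖z k - t‖ + 2))) ?_
  · rw [← e, norm_mul] at h2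
    norm_num at h2
    linarith
  · intro a ha
    rw [uIoc_of_le (by norm_num)] at ha
    have hmem := update_mem_nearCube_of_mem_strip hzk
      (ofReal_mem_strip b (half_pos hr) k (Ioc_subset_Icc_self ha))
    refine (hh.lipschitz k z hz' _ hmem).trans (mul_le_mul_of_nonneg_left ?_ hΛ)
    have e2 := sum_range_succ_update_sub b k z z (z k) a
    rw [Function.update_eq_self] at e2
    rw [e2]
    simp only [sub_self, norm_zero, mul_zero, Finset.sum_const_zero, zero_add]
    refine mul_le_mul_of_nonneg_left ?_ (hb k)
    calc ‖z k - a‖ = ‖(z k - t) + ((t - a : ℝ) : ℂ)‖ := by push_cast; ring_nf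
      _ ≤ ‖z k - t‖ + |t - a| := by
        refine (norm_add_le _ _).trans (le_of_eq ?_)
        rw [Complex.norm_real, Real.norm_eq_abs]
      _ ≤ ‖z k - t‖ + 2 := by
        have : |t - a| ≤ 2 := abs_le.2 ⟨by linarith [ht.1, ha.2], by linarith [ht.2, ha.1]⟩
        linarith

end CondExtension

/-! ### Real conditional distribution functions. -/

section CondCDF

variable {f : (ℕ → ℝ) → ℝ} {b : ℕ → ℝ} {r m A Λ : ℝ} {h : ℕ → (ℕ → ℂ) → ℂ}

theorem IsCondExtension.continuousOn_condDensity (hh : IsCondExtension f b r m A Λ h)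
    (hr : 0 < r) (k : ℕ) {x : ℕ → ℝ} (hx : x ∈ cube) :
    ContinuousOn (fun t => condDensity f k (Function.update x k t)) (Icc (-1) 1) := by
  have h1 : ContinuousOn (fun a : ℝ => h k (Function.update (fun j => (x j : ℂ)) k (a : ℂ)))
      (Icc (-1) 1) :=
    (hh.differentiableOn_update (ofReal_mem_nearCube (half_pos hr).le k hx)).continuousOn.comp
      (f := fun a : ℝ => (a : ℂ)) (by fun_prop) fun a ha => ofReal_mem_strip b (half_pos hr) k ha
  refine (Complex.continuous_re.comp_continuousOn h1).congr fun t ht => ?_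
  simp [hh.ofReal_update k hx ht]

theorem IsCondExtension.intervalIntegrable_condDensity (hh : IsCondExtension f b r m A Λ h)
    (hr : 0 < r) (k : ℕ) {x : ℕ → ℝ} (hx : x ∈ cube) {s s' : ℝ} (hs : s ∈ Icc (-1 : ℝ) 1)
    (hs' : s' ∈ Icc (-1 : ℝ) 1) :
    IntervalIntegrable (fun t => condDensity f k (Function.update x k t)) volume s s' :=
  ((hh.continuousOn_condDensity hr k hx).mono (ordConnected_Icc.uIcc_subset hs hs')).intervalIntegrable

theorem condCDF_neg_one (f : (ℕ → ℝ) → ℝ) (k : ℕ) (x : ℕ → ℝ) : condCDF f k x (-1) = 0 := by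
  simp [condCDF]

theorem IsCondExtension.condCDF_one (hh : IsCondExtension f b r m A Λ h) (hr : 0 < r) (k : ℕ)
    {x : ℕ → ℝ} (hx : x ∈ cube) : condCDF f k x 1 = 2 := by
  have h1 := hh.integral k _ (ofReal_mem_nearCube hr.le k hx)
  have h2 : ((condCDF f k x 1 : ℝ) : ℂ) = 2 := by
    rw [← h1, condCDF, ← intervalIntegral.integral_ofReal]
    refine intervalIntegral.integral_congr fun t ht => ?_
    rw [uIcc_of_le (by norm_num)] at ht
    exact (hh.ofReal_update k hx ht).symm
  exact_mod_cast h2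

theorem IsCondExtension.continuousOn_condCDF (hh : IsCondExtension f b r m A Λ h) (hr : 0 < r)
    (k : ℕ) {x : ℕ → ℝ} (hx : x ∈ cube) : ContinuousOn (condCDF f k x) (Icc (-1) 1) := by
  have := intervalIntegral.continuousOn_primitive_interval (μ := volume) (a := (-1 : ℝ)) (b := 1)
    (f := fun t => condDensity f k (Function.update x k t))
    (by
      rw [uIcc_of_le (by norm_num)]
      exact (hh.continuousOn_condDensity hr k hx).integrableOn_compact isCompact_Icc)
  rwa [uIcc_of_le (by norm_num)] at this

theorem IsCondExtension.condCDF_mono (hh : IsCondExtension f b r m A Λ h) (hr : 0 < r)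
    (hm : 0 ≤ m) (k : ℕ) {x : ℕ → ℝ} (hx : x ∈ cube) {s s' : ℝ} (hs : s ∈ Icc (-1 : ℝ) 1)
    (hs' : s' ∈ Icc (-1 : ℝ) 1) (hss : s ≤ s') : condCDF f k x s ≤ condCDF f k x s' := by
  have h1 : (-1 : ℝ) ∈ Icc (-1 : ℝ) 1 := by norm_num
  rw [← sub_nonneg, condCDF, condCDF, intervalIntegral.integral_interval_sub_left
    (hh.intervalIntegrable_condDensity hr k hx h1 hs')
    (hh.intervalIntegrable_condDensity hr k hx h1 hs)]
  refine intervalIntegral.integral_nonneg hss fun t ht => hm.trans (hh.le_condDensity hr.le k ?_).1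
  exact update_mem_cube hx k ⟨hs.1.trans ht.1, ht.2.trans hs'.2⟩

theorem IsCondExtension.condCDF_mem_Icc (hh : IsCondExtension f b r m A Λ h) (hr : 0 < r)
    (hm : 0 ≤ m) (k : ℕ) {x : ℕ → ℝ} (hx : x ∈ cube) {s : ℝ} (hs : s ∈ Icc (-1 : ℝ) 1) :
    condCDF f k x s ∈ Icc (0 : ℝ) 2 := by
  have h1 : (-1 : ℝ) ∈ Icc (-1 : ℝ) 1 := by norm_num
  have h2 : (1 : ℝ) ∈ Icc (-1 : ℝ) 1 := by norm_num
  have e1 := hh.condCDF_mono hr hm k hx h1 hs hs.1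
  have e2 := hh.condCDF_mono hr hm k hx hs h2 hs.2
  rw [condCDF_neg_one] at e1
  rw [hh.condCDF_one hr k hx] at e2
  exact ⟨e1, e2⟩

theorem IsCondExtension.exists_condCDF_eq (hh : IsCondExtension f b r m A Λ h) (hr : 0 < r)
    (k : ℕ) {x : ℕ → ℝ} (hx : x ∈ cube) {v : ℝ} (hv : v ∈ Icc (0 : ℝ) 2) :
    ∃ s ∈ Icc (-1 : ℝ) 1, condCDF f k x s = v := by
  have := intermediate_value_Icc (by norm_num : (-1 : ℝ) ≤ 1) (hh.continuousOn_condCDF hr k hx)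
  rw [condCDF_neg_one, hh.condCDF_one hr k hx] at this
  exact this hv

end CondCDF

/-! ### Existence of the complex transport. -/

/-- A discrete Grönwall inequality. -/
theorem sum_le_of_le_add_sum {b e d : ℕ → ℝ} {C B : ℝ} {K : ℕ} (hb : ∀ j, 0 ≤ b j)
    (hd : ∀ j, 0 ≤ d j) (hC : 0 ≤ C) (hB : ∀ n, ∑ j ∈ Finset.range n, b j ≤ B)
    (h : ∀ k < K, e k ≤ C * (d k + ∑ j ∈ Finset.range k, b j * (e j + d j))) :
    ∑ j ∈ Finset.range K, b j * e j
      ≤ C * Real.exp (C * B) * (1 + B) * ∑ j ∈ Finset.range K, b j * d j := by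
  set V := ∑ j ∈ Finset.range K, b j * d j with hV
  have hV0 : 0 ≤ V := Finset.sum_nonneg fun j _ => mul_nonneg (hb j) (hd j)
  have hS0 : ∀ n, 0 ≤ ∑ j ∈ Finset.range n, (b j * d j + b j * V) := fun n =>
    Finset.sum_nonneg fun j _ => add_nonneg (mul_nonneg (hb j) (hd j)) (mul_nonneg (hb j) hV0)
  -- The partial sums of `b j * d j` in the hypothesis are enlarged to the full sum `V`, so each
  -- step multiplies by `1 + C * b n`, which the exponential absorbs, and adds a multiple of `b n *
  -- d n + b n * V`.
  have key : ∀ n ≤ K, ∑ j ∈ Finset.range n, b j * e j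
      ≤ Real.exp (C * ∑ j ∈ Finset.range n, b j)
        * (C * ∑ j ∈ Finset.range n, (b j * d j + b j * V)) := by
    intro n
    induction n with
    | zero => intro _; simp
    | succ n ih =>
      intro hn
      have ih := ih (by omega)
      set W := ∑ j ∈ Finset.range n, b j * e j with hW
      set S := ∑ j ∈ Finset.range n, (b j * d j + b j * V) with hS
      set E := Real.exp (C * ∑ j ∈ Finset.range n, b j) with hE
      have hVn : ∑ j ∈ Finset.range n, b j * d j ≤ V :=
        Finset.sum_le_sum_of_subset_of_nonneg (Finset.range_mono (by omega))
          fun j _ _ => mul_nonneg (hb j) (hd j)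
      have h1 : e n ≤ C * (d n + (W + V)) := by
        refine (h n (by omega)).trans (mul_le_mul_of_nonneg_left ?_ hC)
        simp only [mul_add, Finset.sum_add_distrib]
        linarith
      have h2 : b n * e n ≤ b n * (C * (d n + (W + V))) := mul_le_mul_of_nonneg_left h1 (hb n)
      rw [Finset.sum_range_succ, Finset.sum_range_succ, Finset.sum_range_succ, mul_add, Real.exp_add]
      have hexp : 1 + C * b n ≤ Real.exp (C * b n) := by
        rw [add_comm]; exact Real.add_one_le_exp _
      have hE1 : 1 ≤ E := Real.one_le_exp
        (mul_nonneg hC (Finset.sum_nonneg fun j _ => hb j))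
      have hX1 : 1 ≤ Real.exp (C * b n) := Real.one_le_exp (mul_nonneg hC (hb n))
      have hq : 0 ≤ C * (b n * d n + b n * V) :=
        mul_nonneg hC (add_nonneg (mul_nonneg (hb n) (hd n)) (mul_nonneg (hb n) hV0))
      have hES : 0 ≤ E * (C * S) := mul_nonneg (Real.exp_nonneg _) (mul_nonneg hC (hS0 n))
      calc W + b n * e n ≤ (1 + C * b n) * W + C * (b n * d n + b n * V) := by linarith
        _ ≤ (1 + C * b n) * (E * (C * S)) + C * (b n * d n + b n * V) := by
          gcongr
          have := mul_nonneg hC (hb n)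
          linarith
        _ ≤ Real.exp (C * b n) * (E * (C * S))
            + E * Real.exp (C * b n) * (C * (b n * d n + b n * V)) := by
          refine add_le_add (mul_le_mul_of_nonneg_right hexp hES) ?_
          exact le_mul_of_one_le_left hq (one_le_mul_of_one_le_of_one_le hE1 hX1)
        _ = _ := by ring
  have hB0 : 0 ≤ B := (Finset.sum_nonneg fun j _ => hb j).trans (hB 0)
  refine (key K le_rfl).trans ?_
  rw [Finset.sum_add_distrib, ← Finset.sum_mul]
  have h1 : Real.exp (C * ∑ j ∈ Finset.range K, b j) ≤ Real.exp (C * B) :=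
    Real.exp_le_exp.2 (mul_le_mul_of_nonneg_left (hB K) hC)
  have h2 : C * (V + (∑ j ∈ Finset.range K, b j) * V) ≤ C * (V + B * V) :=
    mul_le_mul_of_nonneg_left (add_le_add_right (mul_le_mul_of_nonneg_right (hB K) hV0) V) hC
  refine (mul_le_mul h1 h2 ?_ (Real.exp_nonneg _)).trans (le_of_eq ?_)
  · exact mul_nonneg hC (add_nonneg hV0 (mul_nonneg (Finset.sum_nonneg fun j _ => hb j) hV0))
  · ring

/-- The sequences `z` and `w` are near the cube, and `w` is the image of `z` under the complex
extension of the transport, as far as the first `K` entries are concerned. -/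
structure IsComplexTransport (hρ hπ : ℕ → (ℕ → ℂ) → ℂ) (b : ℕ → ℝ) (r : ℝ) (K : ℕ)
    (z w : ℕ → ℂ) : Prop where
  source : z ∈ nearCube b (r / 3) K
  target : w ∈ nearCube b (r / 3) K
  eq : ∀ k < K, segmentCDF hπ k w (w k) = segmentCDF hρ k z (z k)

section Transport

variable {fρ fπ : (ℕ → ℝ) → ℝ} {b : ℕ → ℝ} {r m A Λ : ℝ} {hρ hπ : ℕ → (ℕ → ℂ) → ℂ}

/-- `Function.invFunOn` returns a true preimage because the target distribution function runs
continuously from `0` to `2`. The zero padding in the definition of `knothe` can be replaced by the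
whole image, since the `k`-th conditional density reads no entry beyond `k`. -/
theorem knothe_spec (Hρ : IsCondExtension fρ b r m A Λ hρ) (Hπ : IsCondExtension fπ b r m A Λ hπ)
    (hr : 0 < r) (hm : 0 ≤ m) {x : ℕ → ℝ} (hx : x ∈ cube) (k : ℕ) :
    knothe fρ fπ k x ∈ Icc (-1 : ℝ) 1 ∧
      condCDF fπ k (fun j => knothe fρ fπ j x) (knothe fρ fπ k x) = condCDF fρ k x (x k) := by
  induction k using Nat.strong_induction_on with
  | _ k ih =>
    set y : ℕ → ℝ := fun j => if _h : j < k then knothe fρ fπ j x else 0 with hy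
    have hyc : y ∈ cube := by
      intro j _
      simp only [hy]
      split_ifs with hj
      · exact (ih j hj).1
      · norm_num
    have hex := Hπ.exists_condCDF_eq hr k hyc (Hρ.condCDF_mem_Icc hr hm k hx (hx k trivial))
    have hk : knothe fρ fπ k x
        = Function.invFunOn (condCDF fπ k y) (Icc (-1 : ℝ) 1) (condCDF fρ k x (x k)) := by
      rw [knothe]
    have hmem := Function.invFunOn_mem hex
    have heq := Function.invFunOn_eq hex
    rw [← hk] at hmem heq
    refine ⟨hmem, ?_⟩
    rw [← heq]
    unfold condCDF
    refine intervalIntegral.integral_congr fun t _ => ?_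
    have : ∀ n ≤ k + 1, ∀ u, concat n (Function.update (fun j => knothe fρ fπ j x) k t) u
        = concat n (Function.update y k t) u := by
      intro n hn u
      ext j
      unfold concat
      split_ifs with hj
      · rcases eq_or_ne j k with rfl | hne
        · simp
        · rw [Function.update_of_ne hne, Function.update_of_ne hne]
          simp only [hy]
          rw [dif_pos (by omega)]
      · rfl
    simp only [condDensity, marginal]
    rw [funext (this (k + 1) le_rfl), funext (this k (by omega))]

theorem knothe_mem_cube (Hρ : IsCondExtension fρ b r m A Λ hρ)
    (Hπ : IsCondExtension fπ b r m A Λ hπ)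
    (hr : 0 < r) (hm : 0 ≤ m) {x : ℕ → ℝ} (hx : x ∈ cube) : (fun j => knothe fρ fπ j x) ∈ cube :=
  fun k _ => (knothe_spec Hρ Hπ hr hm hx k).1

theorem isComplexTransport_ofReal (Hρ : IsCondExtension fρ b r m A Λ hρ)
    (Hπ : IsCondExtension fπ b r m A Λ hπ)
    (hr : 0 < r) (hm : 0 ≤ m) {x : ℕ → ℝ} (hx : x ∈ cube) (K : ℕ) :
    IsComplexTransport hρ hπ b r K (fun j => (x j : ℂ)) (fun j => (knothe fρ fπ j x : ℂ)) where
  source := ofReal_mem_nearCube (by positivity) K hx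
  target := ofReal_mem_nearCube (by positivity) K (knothe_mem_cube Hρ Hπ hr hm hx)
  eq k _ := by
    rw [Hρ.segmentCDF_ofReal k hx (hx k trivial),
      Hπ.segmentCDF_ofReal k (knothe_mem_cube Hρ Hπ hr hm hx) (knothe_spec Hρ Hπ hr hm hx k).1,
      (knothe_spec Hρ Hπ hr hm hx k).2]

theorem norm_add_one_le {t : ℝ} (ht : t ∈ Icc (-1 : ℝ) 1) : ‖(t : ℂ) + 1‖ ≤ 2 := by
  rw [← Complex.ofReal_one, ← Complex.ofReal_add, Complex.norm_real, Real.norm_eq_abs, abs_le]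
  constructor <;> linarith [ht.1, ht.2]

/-- Near the cube the transport has a complex extension, whose distance to the transport of a real
point is controlled. -/
theorem exists_isComplexTransport (Hρ : IsCondExtension fρ b r m A Λ hρ)
    (Hπ : IsCondExtension fπ b r m A Λ hπ) (hb : ∀ j, 0 ≤ b j) (hbs : Summable b)
    (hr : 0 < r) (hm : 0 < m) (hmA : m ≤ A) (hΛ : 0 ≤ Λ) :
    ∃ η C : ℝ, 0 < η ∧ 0 < C ∧ ∀ K z, ∀ x ∈ cube, ∑ j ∈ Finset.range K, b j * ‖z j - (x j : ℂ)‖ ≤ η →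
      ∃ w, IsComplexTransport hρ hπ b r K z w ∧
        ∀ k < K, ‖w k - knothe fρ fπ k x‖ ≤ C * (1 + ‖z k - x k‖) := by
  have hA : 0 < A := hm.trans_le hmA
  set B := ∑' j, b j with hB
  have hBn : ∀ n, ∑ j ∈ Finset.range n, b j ≤ B := fun n => hbs.sum_le_tsum _ fun j _ => hb j
  have hB0 : 0 ≤ B := tsum_nonneg hb
  set C₁ := (2 * A + 2 * Λ) / m with hC₁
  have hC₁0 : 0 < C₁ := by positivity
  set G := C₁ * Real.exp (C₁ * B) * (1 + B) with hG
  have hG0 : 0 < G := by positivity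
  -- the constant controlling the weighted distance of the next entry
  set D := C₁ * (1 + B * (G + 1)) with hD
  have hD0 : 0 < D := by positivity
  -- The three bounds keep the source point, its image (through the Grönwall constant `G`) and the
  -- disc in which the next entry is sought within weighted distance `r / 3`, for every number of
  -- variables.
  obtain ⟨η, hη, hη1, hη2, hη3⟩ : ∃ η : ℝ, 0 < η ∧ η ≤ r / 3 ∧ G * η ≤ r / 3 ∧ D * η ≤ r / 3 := by
    refine ⟨min (r / 3) (min (r / 3 / G) (r / 3 / D)), by positivity, min_le_left _ _, ?_, ?_⟩
    · rw [mul_comm, ← le_div_iff₀ hG0]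
      exact (min_le_right _ _).trans (min_le_left _ _)
    · rw [mul_comm, ← le_div_iff₀ hD0]
      exact (min_le_right _ _).trans (min_le_right _ _)
  have key : ∀ K z, ∀ x ∈ cube, ∑ j ∈ Finset.range K, b j * ‖z j - (x j : ℂ)‖ ≤ η →
      ∃ w, IsComplexTransport hρ hπ b r K z w ∧ ∀ k < K, ‖w k - knothe fρ fπ k x‖
        ≤ C₁ * (‖z k - x k‖ + ∑ j ∈ Finset.range k,
            b j * (‖w j - knothe fρ fπ j x‖ + ‖z j - x j‖)) := by
    intro K z x hx
    have hTx := knothe_mem_cube Hρ Hπ hr hm.le hx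
    induction K with
    | zero =>
      intro _
      exact ⟨fun _ => 0, ⟨⟨x, hx, by simp; positivity⟩, ⟨x, hx, by simp; positivity⟩, by simp⟩,
        by simp⟩
    | succ K ih =>
      intro hz
      have hzK : ∑ j ∈ Finset.range K, b j * ‖z j - (x j : ℂ)‖ ≤ η := by
        rw [Finset.sum_range_succ] at hz
        have := mul_nonneg (hb K) (norm_nonneg (z K - x K))
        linarith
      have hzKη : b K * ‖z K - x K‖ ≤ η := by
        rw [Finset.sum_range_succ] at hz
        have := Finset.sum_nonneg (s := Finset.range K) (f := fun j => b j * ‖z j - (x j : ℂ)‖)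
          fun j _ => mul_nonneg (hb j) (norm_nonneg _)
        linarith
      obtain ⟨w, hw, hwe⟩ := ih hzK
      set V := ∑ j ∈ Finset.range K, b j * ‖z j - (x j : ℂ)‖ with hV
      set W := ∑ j ∈ Finset.range K, b j * ‖w j - (knothe fρ fπ j x : ℂ)‖ with hW
      have hV0 : 0 ≤ V := Finset.sum_nonneg fun j _ => mul_nonneg (hb j) (norm_nonneg _)
      have hW0 : 0 ≤ W := Finset.sum_nonneg fun j _ => mul_nonneg (hb j) (norm_nonneg _)
      have hWV : W ≤ G * V := sum_le_of_le_add_sum (e := fun j => ‖w j - (knothe fρ fπ j x : ℂ)‖)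
        (d := fun j => ‖z j - (x j : ℂ)‖) hb (fun j => norm_nonneg _) hC₁0.le hBn hwe
      have hWη : W ≤ G * η := hWV.trans (mul_le_mul_of_nonneg_left hzK hG0.le)
      have hzmem : z ∈ nearCube b (r / 2) K := ⟨x, hx, by linarith⟩
      have hwmem : w ∈ nearCube b (r / 2) K := ⟨_, hTx, by linarith⟩
      have hxmem : (fun j => (x j : ℂ)) ∈ nearCube b (r / 2) K := ofReal_mem_nearCube (by positivity) K hx
      have hTmem : (fun j => (knothe fρ fπ j x : ℂ)) ∈ nearCube b (r / 2) K :=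
        ofReal_mem_nearCube (by positivity) K hTx
      have hxK : (x K : ℂ) ∈ strip b (r / 2) K := ofReal_mem_strip b (half_pos hr) K (hx K trivial)
      have hzKs : z K ∈ strip b (r / 2) K := ⟨x K, hx K trivial, by linarith⟩
      have hTK : (knothe fρ fπ K x : ℂ) ∈ strip b (r / 2) K :=
        ofReal_mem_strip b (half_pos hr) K (hTx K trivial)
      set t := knothe fρ fπ K x with ht
      set v := segmentCDF hρ K z (z K) with hv
      set R := C₁ * (‖z K - x K‖ + (W + V)) with hR
      have hR0 : 0 ≤ R := by positivity
      have hbR : b K * R ≤ r / 3 := by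
        have hbK : b K ≤ B := hbs.le_tsum K fun j _ => hb j
        have e1 : b K * (W + V) ≤ B * ((G + 1) * η) :=
          mul_le_mul hbK (by linarith) (by positivity) hB0
        calc b K * R = C₁ * (b K * ‖z K - x K‖ + b K * (W + V)) := by rw [hR]; ring
          _ ≤ C₁ * (η + B * ((G + 1) * η)) := by gcongr
          _ = D * η := by rw [hD]; ring
          _ ≤ r / 3 := hη3
      have hball : ∀ s ∈ Metric.closedBall (t : ℂ) R, s ∈ strip b (r / 2) K := by
        intro s hs
        refine ⟨t, hTx K trivial, ?_⟩
        rw [Metric.mem_closedBall, dist_eq_norm] at hs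
        have := (mul_le_mul_of_nonneg_left hs (hb K)).trans hbR
        linarith
      -- The real transport solves the equation exactly, so the residual at the centre `t` is a sum
      -- of three increments: in the last entry of `z`, in its earlier entries, and in the earlier
      -- entries of `w`.
      have hbase : segmentCDF hπ K (fun j => (knothe fρ fπ j x : ℂ)) t
          = segmentCDF hρ K (fun j => (x j : ℂ)) (x K) :=
        (isComplexTransport_ofReal Hρ Hπ hr hm.le hx (K + 1)).eq K K.lt_succ_self
      have hdist : ‖v - segmentCDF hπ K w t‖ ≤ m * R := by
        have e1 := Hρ.norm_segmentCDF_sub_le' hb hr hA.le hm.le hzmem hzKs hxK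
        have e2 := Hρ.norm_segmentCDF_sub_le hb hr hzmem hxmem hxK
        have e3 := Hπ.norm_segmentCDF_sub_le hb hr hTmem hwmem hTK
        have n2 := norm_add_one_le (hx K trivial)
        have n3 := norm_add_one_le (hTx K trivial)
        have e2' : ‖segmentCDF hρ K z (x K) - segmentCDF hρ K (fun j => (x j : ℂ)) (x K)‖
            ≤ 2 * (Λ * V) := e2.trans (mul_le_mul_of_nonneg_right n2 (mul_nonneg hΛ hV0))
        have e3' : ‖segmentCDF hπ K (fun j => (knothe fρ fπ j x : ℂ)) t - segmentCDF hπ K w t‖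
            ≤ 2 * (Λ * W) := by
          refine e3.trans ?_
          rw [Finset.sum_congr rfl fun j _ => by rw [norm_sub_rev]]
          exact mul_le_mul_of_nonneg_right n3 (mul_nonneg hΛ hW0)
        have e4 : v - segmentCDF hπ K w t
            = (v - segmentCDF hρ K z (x K))
              + (segmentCDF hρ K z (x K) - segmentCDF hρ K (fun j => (x j : ℂ)) (x K))
              + (segmentCDF hπ K (fun j => (knothe fρ fπ j x : ℂ)) t - segmentCDF hπ K w t) := by
          rw [hbase]; ring
        rw [e4]
        refine (norm_add₃_le).trans ?_
        have e5 : m * R = (2 * A + 2 * Λ) * (‖z K - x K‖ + (W + V)) := by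
          rw [hR, hC₁]; field_simp
        rw [e5]
        nlinarith [norm_nonneg (z K - x K)]
      obtain ⟨s, hs, hsv⟩ := exists_mem_closedBall_image_eq (φ := segmentCDF hπ K w)
        (h := fun s => hπ K (Function.update w K s)) hR0
        (fun s hs => Hπ.hasDerivAt_segmentCDF hb hr hwmem (hball s hs)) hm hmA
        (fun s hs => Hπ.near K _ (update_mem_nearCube_of_mem_strip hwmem (hball s hs))) hdist
      rw [Metric.mem_closedBall, dist_eq_norm] at hs
      have hold : ∀ j < K, Function.update w K s j = w j := fun j hj => Function.update_of_ne hj.ne _ _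
      have hest : ∀ k < K + 1, ‖Function.update w K s k - knothe fρ fπ k x‖
          ≤ C₁ * (‖z k - x k‖ + ∑ j ∈ Finset.range k,
            b j * (‖Function.update w K s j - knothe fρ fπ j x‖ + ‖z j - x j‖)) := by
        intro k hk
        rw [Finset.sum_congr rfl fun j hj => by
          rw [hold j (by have := Finset.mem_range.1 hj; omega)]]
        rcases (Nat.lt_succ_iff.1 hk).eq_or_lt with rfl | hk'
        · rw [Function.update_self]
          refine hs.trans (le_of_eq ?_)
          simp only [mul_add, Finset.sum_add_distrib, hR]
          rfl
        · rw [hold k hk']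
          exact hwe k hk'
      refine ⟨Function.update w K s, ⟨⟨x, hx, by linarith⟩, ⟨_, hTx, ?_⟩, fun k hk => ?_⟩, hest⟩
      · refine (sum_le_of_le_add_sum (e := fun j => ‖Function.update w K s j
          - (knothe fρ fπ j x : ℂ)‖) (d := fun j => ‖z j - (x j : ℂ)‖) hb
          (fun j => norm_nonneg _) hC₁0.le hBn hest).trans ?_
        exact (mul_le_mul_of_nonneg_left hz hG0.le).trans hη2
      · rw [Hπ.segmentCDF_congr (z' := w) fun j hj => hold j (by omega)]
        rcases (Nat.lt_succ_iff.1 hk).eq_or_lt with rfl | hk'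
        · rw [Function.update_self, hsv]
        · rw [hold k hk']
          exact hw.eq k hk'
  refine ⟨η, C₁ * (1 + (G + 1) * η), hη, by positivity, fun K z x hx hz => ?_⟩
  obtain ⟨w, hw, hwe⟩ := key K z x hx hz
  refine ⟨w, hw, fun k hk => (hwe k hk).trans ?_⟩
  have hVk : ∑ j ∈ Finset.range k, b j * ‖z j - (x j : ℂ)‖ ≤ η :=
    (Finset.sum_le_sum_of_subset_of_nonneg (Finset.range_mono hk.le)
      fun j _ _ => mul_nonneg (hb j) (norm_nonneg _)).trans hz
  have hWk : ∑ j ∈ Finset.range k, b j * ‖w j - (knothe fρ fπ j x : ℂ)‖ ≤ G * η :=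
    (sum_le_of_le_add_sum (e := fun j => ‖w j - (knothe fρ fπ j x : ℂ)‖)
        (d := fun j => ‖z j - (x j : ℂ)‖) hb (fun j => norm_nonneg _) hC₁0.le hBn
        fun i hi => hwe i (hi.trans hk)).trans (mul_le_mul_of_nonneg_left hVk hG0.le)
  rw [mul_assoc]
  refine mul_le_mul_of_nonneg_left ?_ hC₁0.le
  simp only [mul_add, Finset.sum_add_distrib]
  have : 0 ≤ G * η := by positivity
  nlinarith [norm_nonneg (z k - x k)]

end Transport

/-! ### Uniqueness and holomorphy of the complex transport. -/

section Transport

variable {fρ fπ : (ℕ → ℝ) → ℝ} {b : ℕ → ℝ} {r m A Λ : ℝ} {hρ hπ : ℕ → (ℕ → ℂ) → ℂ}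

theorem norm_add_one_le_of_mem_strip {k : ℕ} (hb : 0 < b k) {s : ℂ} (hs : s ∈ strip b r k) :
    ‖s + 1‖ ≤ r / b k + 2 := by
  obtain ⟨t, ht, hst⟩ := hs
  rw [← lt_div_iff₀' hb] at hst
  have := norm_add_le (s - t) (t + 1)
  rw [show s - t + (t + 1) = s + 1 by ring] at this
  linarith [norm_add_one_le ht]

/-- The complex transport depends on its argument in a Lipschitz way. -/
theorem exists_norm_sub_le_of_isComplexTransport (Hρ : IsCondExtension fρ b r m A Λ hρ)
    (Hπ : IsCondExtension fπ b r m A Λ hπ) (hb : ∀ j, 0 < b j)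
    (hr : 0 < r) (hm : 0 < m) (hmA : m ≤ A) (hΛ : 0 ≤ Λ) (k : ℕ) :
    ∃ C : ℝ, 0 ≤ C ∧ ∀ K z w z' w', k < K → IsComplexTransport hρ hπ b r K z w →
      IsComplexTransport hρ hπ b r K z' w' →
      ‖w k - w' k‖ ≤ C * ∑ j ∈ Finset.range (k + 1), ‖z j - z' j‖ := by
  have hb' : ∀ j, 0 ≤ b j := fun j => (hb j).le
  have hA : 0 < A := hm.trans_le hmA
  induction k using Nat.strong_induction_on with
  | _ k ih =>
    choose! C hC0 hC using ih
    set Q := r / 2 / b k + 2 with hQ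
    have hQ0 : 0 ≤ Q := by have := hb k; positivity
    -- This constant depends on `k` through `1 / b k` and the constants of the earlier entries. That
    -- is harmless: it serves only for uniqueness and continuity, never for a uniform bound.
    refine ⟨(2 * A + Q * (Λ * ∑ j ∈ Finset.range k, b j)
      + Q * (Λ * ∑ j ∈ Finset.range k, b j * C j)) / m, ?_, ?_⟩
    · refine div_nonneg ?_ hm.le
      have h1 : 0 ≤ ∑ j ∈ Finset.range k, b j := Finset.sum_nonneg fun j _ => hb' j
      have h2 : 0 ≤ ∑ j ∈ Finset.range k, b j * C j :=
        Finset.sum_nonneg fun j hj => mul_nonneg (hb' j) (hC0 j (Finset.mem_range.1 hj))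
      positivity
    intro K z w z' w' hk hw hw'
    have hr3 : r / 3 ≤ r / 2 := by linarith
    have hr3' : r / 3 < r / 2 := by linarith
    have mz := mem_nearCube_of_le hb' hr3 hk.le hw.source
    have mz' := mem_nearCube_of_le hb' hr3 hk.le hw'.source
    have mw := mem_nearCube_of_le hb' hr3 hk.le hw.target
    have mw' := mem_nearCube_of_le hb' hr3 hk.le hw'.target
    have sz := mem_strip_of_mem_nearCube hb' hr3' hk hw.source
    have sz' := mem_strip_of_mem_nearCube hb' hr3' hk hw'.source
    have sw := mem_strip_of_mem_nearCube hb' hr3' hk hw.target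
    have sw' := mem_strip_of_mem_nearCube hb' hr3' hk hw'.target
    set S := ∑ j ∈ Finset.range (k + 1), ‖z j - z' j‖ with hS
    have hS0 : 0 ≤ S := Finset.sum_nonneg fun j _ => norm_nonneg _
    have hjS : ∀ j < k + 1, ‖z j - z' j‖ ≤ S := fun j hj =>
      Finset.single_le_sum (f := fun j => ‖z j - z' j‖) (fun j _ => norm_nonneg _)
        (Finset.mem_range.2 hj)
    have e1 := Hπ.le_norm_segmentCDF_sub hb' hr hA.le mw sw sw'
    have e2 := Hρ.norm_segmentCDF_sub_le' hb' hr hA.le hm.le mz sz sz'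
    have e3 := Hρ.norm_segmentCDF_sub_le hb' hr mz mz' sz'
    have e4 := Hπ.norm_segmentCDF_sub_le hb' hr mw' mw sw'
    have q3 := norm_add_one_le_of_mem_strip (hb k) sz'
    have q4 := norm_add_one_le_of_mem_strip (hb k) sw'
    have e2' : ‖segmentCDF hρ k z (z k) - segmentCDF hρ k z (z' k)‖ ≤ 2 * A * S :=
      e2.trans (mul_le_mul_of_nonneg_left (hjS k k.lt_succ_self) (by positivity))
    have e3' : ‖segmentCDF hρ k z (z' k) - segmentCDF hρ k z' (z' k)‖
        ≤ Q * (Λ * ((∑ j ∈ Finset.range k, b j) * S)) := by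
      refine e3.trans (mul_le_mul q3 (mul_le_mul_of_nonneg_left ?_ hΛ) ?_ hQ0)
      · rw [Finset.sum_mul]
        exact Finset.sum_le_sum fun j hj => mul_le_mul_of_nonneg_left
          (hjS j (by have := Finset.mem_range.1 hj; omega)) (hb' j)
      · exact mul_nonneg hΛ (Finset.sum_nonneg fun j _ => mul_nonneg (hb' j) (norm_nonneg _))
    have e4' : ‖segmentCDF hπ k w' (w' k) - segmentCDF hπ k w (w' k)‖
        ≤ Q * (Λ * ((∑ j ∈ Finset.range k, b j * C j) * S)) := by
      refine e4.trans (mul_le_mul q4 (mul_le_mul_of_nonneg_left ?_ hΛ) ?_ hQ0)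
      · rw [Finset.sum_mul]
        refine Finset.sum_le_sum fun j hj => ?_
        have hj := Finset.mem_range.1 hj
        rw [mul_assoc, norm_sub_rev]
        refine mul_le_mul_of_nonneg_left ((hC j hj K z w z' w' (hj.trans hk) hw hw').trans ?_) (hb' j)
        refine mul_le_mul_of_nonneg_left ?_ (hC0 j hj)
        exact Finset.sum_le_sum_of_subset_of_nonneg (Finset.range_mono (by omega))
          fun j _ _ => norm_nonneg _
      · exact mul_nonneg hΛ (Finset.sum_nonneg fun j _ => mul_nonneg (hb' j) (norm_nonneg _))
    have e5 : segmentCDF hπ k w (w k) - segmentCDF hπ k w (w' k)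
        = (segmentCDF hρ k z (z k) - segmentCDF hρ k z (z' k))
          + (segmentCDF hρ k z (z' k) - segmentCDF hρ k z' (z' k))
          + (segmentCDF hπ k w' (w' k) - segmentCDF hπ k w (w' k)) := by
      rw [hw.eq k hk, hw'.eq k hk]; ring
    rw [e5] at e1
    have e6 := e1.trans norm_add₃_le
    rw [div_mul_eq_mul_div, le_div_iff₀ hm]
    nlinarith

/-- Lipschitz dependence applied to coinciding arguments. It turns an arbitrary choice of solutions
into a function of the first `K` entries and identifies it with the real transport at real points.
-/
theorem IsComplexTransport.eq_of_eq (Hρ : IsCondExtension fρ b r m A Λ hρ)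
    (Hπ : IsCondExtension fπ b r m A Λ hπ) (hb : ∀ j, 0 < b j)
    (hr : 0 < r) (hm : 0 < m) (hmA : m ≤ A) (hΛ : 0 ≤ Λ) {K : ℕ} {z w z' w' : ℕ → ℂ}
    (hw : IsComplexTransport hρ hπ b r K z w) (hw' : IsComplexTransport hρ hπ b r K z' w')
    (h : ∀ j < K, z j = z' j) {k : ℕ} (hk : k < K) : w k = w' k := by
  obtain ⟨C, _, hC⟩ := exists_norm_sub_le_of_isComplexTransport Hρ Hπ hb hr hm hmA hΛ k
  have := hC K z w z' w' hk hw hw'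
  rw [Finset.sum_eq_zero fun j hj => by
    rw [h j (by have := Finset.mem_range.1 hj; omega), sub_self, norm_zero], mul_zero] at this
  exact sub_eq_zero.1 (norm_le_zero_iff.1 this)

theorem IsComplexTransport.mono (hb : ∀ j, 0 ≤ b j) {K K' : ℕ} (hK : K' ≤ K) {z w : ℕ → ℂ}
    (hw : IsComplexTransport hρ hπ b r K z w) : IsComplexTransport hρ hπ b r K' z w where
  source := mem_nearCube_of_le hb le_rfl hK hw.source
  target := mem_nearCube_of_le hb le_rfl hK hw.target
  eq k hk := hw.eq k (hk.trans_le hK)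

theorem tendsto_of_isComplexTransport (Hρ : IsCondExtension fρ b r m A Λ hρ)
    (Hπ : IsCondExtension fπ b r m A Λ hπ) (hb : ∀ j, 0 < b j)
    (hr : 0 < r) (hm : 0 < m) (hmA : m ≤ A) (hΛ : 0 ≤ Λ) {K : ℕ} {α : Type*} {l : Filter α}
    {z w : α → ℕ → ℂ} {z₀ w₀ : ℕ → ℂ}
    (hw : ∀ᶠ a in l, IsComplexTransport hρ hπ b r K (z a) (w a))
    (hw₀ : IsComplexTransport hρ hπ b r K z₀ w₀)
    (hz : ∀ j < K, Tendsto (fun a => z a j) l (𝓝 (z₀ j))) {k : ℕ} (hk : k < K) :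
    Tendsto (fun a => w a k) l (𝓝 (w₀ k)) := by
  obtain ⟨C, _, hC⟩ := exists_norm_sub_le_of_isComplexTransport Hρ Hπ hb hr hm hmA hΛ k
  rw [tendsto_iff_norm_sub_tendsto_zero]
  refine squeeze_zero' (Eventually.of_forall fun a => norm_nonneg _)
    (hw.mono fun a ha => hC K _ _ _ _ hk ha hw₀) ?_
  have : Tendsto (fun a => C * ∑ j ∈ Finset.range (k + 1), ‖z a j - z₀ j‖) l
      (𝓝 (C * ∑ j ∈ Finset.range (k + 1), (0 : ℝ))) := by
    refine Tendsto.const_mul _ (tendsto_finsetSum _ fun j hj => ?_)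
    rw [← tendsto_iff_norm_sub_tendsto_zero]
    exact hz j (by have := Finset.mem_range.1 hj; omega)
  simpa using this

theorem IsCondExtension.tendsto {f : (ℕ → ℝ) → ℝ} {h : ℕ → (ℕ → ℂ) → ℂ}
    (hh : IsCondExtension f b r m A Λ h) {k : ℕ} {α : Type*} {l : Filter α} {z : α → ℕ → ℂ}
    {z₀ : ℕ → ℂ} (hz : ∀ᶠ a in l, z a ∈ nearCube b r (k + 1)) (hz₀ : z₀ ∈ nearCube b r (k + 1))
    (ht : ∀ j ≤ k, Tendsto (fun a => z a j) l (𝓝 (z₀ j))) :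
    Tendsto (fun a => h k (z a)) l (𝓝 (h k z₀)) := by
  rw [tendsto_iff_norm_sub_tendsto_zero]
  refine squeeze_zero' (Eventually.of_forall fun a => norm_nonneg _)
    (hz.mono fun a ha => hh.lipschitz k _ ha _ hz₀) ?_
  have : Tendsto (fun a => Λ * ∑ j ∈ Finset.range (k + 1), b j * ‖z a j - z₀ j‖) l
      (𝓝 (Λ * ∑ j ∈ Finset.range (k + 1), b j * (0 : ℝ))) := by
    refine Tendsto.const_mul _ (tendsto_finsetSum _ fun j hj => Tendsto.const_mul _ ?_)
    rw [← tendsto_iff_norm_sub_tendsto_zero]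
    exact ht j (by have := Finset.mem_range.1 hj; omega)
  simpa using this

/-- The derivative of the complex transport along a holomorphic curve. -/
theorem hasDerivAt_isComplexTransport (Hρ : IsCondExtension fρ b r m A Λ hρ)
    (Hπ : IsCondExtension fπ b r m A Λ hπ) (hb : ∀ j, 0 < b j)
    (hr : 0 < r) (hm : 0 < m) (hmA : m ≤ A) (hΛ : 0 ≤ Λ) {K k : ℕ} (hk : k < K) {Ω : Set ℂ}
    (hΩ : IsOpen Ω) {z w : ℂ → ℕ → ℂ}
    (hw : ∀ τ ∈ Ω, IsComplexTransport hρ hπ b r K (z τ) (w τ))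
    (hz : ∀ j < K, DifferentiableOn ℂ (fun τ => z τ j) Ω)
    {τ₀ φ' v' : ℂ} (hτ₀ : τ₀ ∈ Ω)
    (hφ' : HasDerivAt (fun τ => segmentCDF hπ k (w τ) (w τ₀ k)) φ' τ₀)
    (hv' : HasDerivAt (fun τ => segmentCDF hρ k (z τ) (z τ k)) v' τ₀) :
    HasDerivAt (fun τ => w τ k) ((v' - φ') / hπ k (w τ₀)) τ₀ := by
  have hb' : ∀ j, 0 ≤ b j := fun j => (hb j).le
  have hA : 0 < A := hm.trans_le hmA
  have hr3 : r / 3 ≤ r / 2 := by linarith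
  have hr3' : r / 3 < r / 2 := by linarith
  have mw : ∀ τ ∈ Ω, w τ ∈ nearCube b (r / 2) k := fun τ hτ =>
    mem_nearCube_of_le hb' hr3 hk.le (hw τ hτ).target
  have sw : ∀ τ ∈ Ω, w τ k ∈ strip b (r / 2) k := fun τ hτ =>
    mem_strip_of_mem_nearCube hb' hr3' hk (hw τ hτ).target
  have hlim : ∀ j < K, Tendsto (fun τ => w τ j) (𝓝 τ₀) (𝓝 (w τ₀ j)) := fun j hj =>
    tendsto_of_isComplexTransport Hρ Hπ hb hr hm hmA hΛ
      (eventually_of_mem (hΩ.mem_nhds hτ₀) hw) (hw τ₀ hτ₀)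
      (fun j hj => ((hz j hj).continuousOn.continuousAt (hΩ.mem_nhds hτ₀)).tendsto) hj
  have hself : Function.update (w τ₀) k (w τ₀ k) = w τ₀ := Function.update_eq_self _ _
  have hnear : ∀ᶠ q : ℂ × ℂ in 𝓝 (τ₀, w τ₀ k), q.1 ∈ Ω ∧ q.2 ∈ strip b (r / 2) k :=
    (hΩ.prod (isOpen_strip b (r / 2) k)).mem_nhds ⟨hτ₀, sw τ₀ hτ₀⟩
  have hmem₀ : w τ₀ ∈ nearCube b r (k + 1) := by
    rw [← hself]; exact update_mem_nearCube_of_mem_strip (mw τ₀ hτ₀) (sw τ₀ hτ₀)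
  have key := hasDerivAt_of_implicit (Φ := fun τ s => segmentCDF hπ k (w τ) s)
    (h := fun τ s => hπ k (Function.update (w τ) k s)) (w := fun τ => w τ k) (τ₀ := τ₀)
    (hlim k hk) ?_ ?_ ?_ hφ' (hv'.congr_of_eventuallyEq ?_)
  · simpa only [hself] using key
  · filter_upwards [hnear] with q hq using Hπ.hasDerivAt_segmentCDF hb' hr (mw q.1 hq.1) hq.2
  · refine Hπ.tendsto (hnear.mono fun q hq =>
      update_mem_nearCube_of_mem_strip (mw q.1 hq.1) hq.2) (by simpa only [hself] using hmem₀) ?_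
    intro j hj
    rcases hj.eq_or_lt with rfl | hj
    · simp only [Function.update_self]
      exact continuousAt_snd
    · simp only [Function.update_of_ne hj.ne]
      exact (hlim j (hj.trans hk)).comp continuousAt_fst
  · simp only [hself]
    exact norm_pos_iff.1 (hm.trans_le (Hπ.le_norm hA.le hmem₀))
  · filter_upwards [hΩ.mem_nhds hτ₀] with τ hτ using (hw τ hτ).eq k hk

/-- The complex transport is holomorphic along holomorphic curves. -/
theorem differentiableOn_isComplexTransport (Hρ : IsCondExtension fρ b r m A Λ hρ)
    (Hπ : IsCondExtension fπ b r m A Λ hπ) (hb : ∀ j, 0 < b j)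
    (hr : 0 < r) (hm : 0 < m) (hmA : m ≤ A) (hΛ : 0 ≤ Λ) {K : ℕ} {Ω : Set ℂ}
    (hΩ : IsOpen Ω) {z w : ℂ → ℕ → ℂ}
    (hw : ∀ τ ∈ Ω, IsComplexTransport hρ hπ b r K (z τ) (w τ))
    (hz : ∀ j < K, DifferentiableOn ℂ (fun τ => z τ j) Ω) (k : ℕ) (hk : k < K) :
    DifferentiableOn ℂ (fun τ => w τ k) Ω := by
  have hb' : ∀ j, 0 ≤ b j := fun j => (hb j).le
  have hA : 0 < A := hm.trans_le hmA
  have hr3 : r / 3 ≤ r / 2 := by linarith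
  have hr3' : r / 3 < r / 2 := by linarith
  induction k using Nat.strong_induction_on with
  | _ k ih =>
    intro τ₀ hτ₀
    -- The last entry of `w` is frozen at `τ₀`, so only entries already known to be holomorphic
    -- vary.
    have d1 := Hπ.differentiableOn_segmentCDF hb' hr hA.le hm.le hΩ
      (fun j hj => ih j hj (hj.trans hk))
      (fun τ hτ => mem_nearCube_of_le hb' hr3 hk.le (hw τ hτ).target)
      (differentiableOn_const (c := w τ₀ k))
      (fun τ hτ => mem_strip_of_mem_nearCube hb' hr3' hk (hw τ₀ hτ₀).target)
    have d2 := Hρ.differentiableOn_segmentCDF hb' hr hA.le hm.le hΩ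
      (fun j hj => hz j (hj.trans hk))
      (fun τ hτ => mem_nearCube_of_le hb' hr3 hk.le (hw τ hτ).source) (hz k hk)
      (fun τ hτ => mem_strip_of_mem_nearCube hb' hr3' hk (hw τ hτ).source)
    exact (hasDerivAt_isComplexTransport Hρ Hπ hb hr hm hmA hΛ hk hΩ hw hz hτ₀
      (d1.differentiableAt (hΩ.mem_nhds hτ₀)).hasDerivAt
      (d2.differentiableAt (hΩ.mem_nhds hτ₀)).hasDerivAt).differentiableAt.differentiableWithinAt

/-! ### The square root of the derivative of the transport. -/

theorem norm_cpow_inv_two_sub_one_le (z : ℂ) : ‖z ^ (2⁻¹ : ℂ) - 1‖ ≤ ‖z - 1‖ := by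
  have h2 : (z ^ (2⁻¹ : ℂ)) ^ 2 = z := by
    exact_mod_cast Complex.cpow_nat_inv_pow z two_ne_zero
  have h0 : 0 ≤ (z ^ (2⁻¹ : ℂ)).re := by
    rw [Complex.cpow_inv_two_re]; exact Real.sqrt_nonneg _
  -- The principal root has nonnegative real part, so adding `1` gives norm at least one; this
  -- factor of `z - 1` can be dropped.
  have h1 : 1 ≤ ‖z ^ (2⁻¹ : ℂ) + 1‖ := by
    refine le_trans ?_ (Complex.re_le_norm _)
    simpa using h0
  have e : z - 1 = (z ^ (2⁻¹ : ℂ) - 1) * (z ^ (2⁻¹ : ℂ) + 1) := by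
    rw [show (z ^ (2⁻¹ : ℂ) - 1) * (z ^ (2⁻¹ : ℂ) + 1) = (z ^ (2⁻¹ : ℂ)) ^ 2 - 1 by ring, h2]
  calc ‖z ^ (2⁻¹ : ℂ) - 1‖ ≤ ‖z ^ (2⁻¹ : ℂ) - 1‖ * ‖z ^ (2⁻¹ : ℂ) + 1‖ :=
        le_mul_of_one_le_right (norm_nonneg _) h1
    _ = ‖z - 1‖ := by rw [← norm_mul, ← e]

theorem mem_slitPlane_of_norm_sub_le {z : ℂ} {A m : ℝ} (hm : 0 < m) (h : ‖z - A‖ ≤ A - m) :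
    z ∈ Complex.slitPlane := by
  left
  have := (abs_le.1 ((Complex.abs_re_le_norm (z - A)).trans h)).1
  simp at this
  linarith

end Transport

/-- The functions `G k` are bounded holomorphic extensions to a neighbourhood of the cube of
`√(∂_k T_k) - 1`, where `T` is the Knothe–Rosenblatt transport. -/
structure IsRootExtension (fρ fπ : (ℕ → ℝ) → ℝ) (b : ℕ → ℝ) (η C c₀ : ℝ)
    (G : ℕ → (ℕ → ℂ) → ℂ) : Prop where
  congr : ∀ k, ∀ z ∈ nearCube b η (k + 1), ∀ z' ∈ nearCube b η (k + 1), (∀ j ≤ k, z j = z' j) →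
    G k z = G k z'
  continuousOn : ∀ k, ContinuousOn (G k) (nearCube b η (k + 1))
  holomorphic : ∀ k (Ω : Set ℂ), IsOpen Ω → ∀ z : ℂ → ℕ → ℂ,
    (∀ j ≤ k, DifferentiableOn ℂ (fun τ => z τ j) Ω) → (∀ τ ∈ Ω, z τ ∈ nearCube b η (k + 1)) →
    DifferentiableOn ℂ (fun τ => G k (z τ)) Ω
  bound : ∀ k z, ∀ x ∈ cube, ∑ j ∈ Finset.range (k + 1), b j * ‖z j - (x j : ℂ)‖ ≤ η →
    ‖G k z‖ ≤ C * (b k * (1 + ‖z k - x k‖))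
  ofReal : ∀ k, ∀ x ∈ cube, ∃ u : ℝ, c₀ ≤ u ∧ G k (fun j => (x j : ℂ)) = (u - 1 : ℝ) ∧
    HasDerivWithinAt (fun t => knothe fρ fπ k (Function.update x k t)) (u ^ 2) (Icc (-1) 1) (x k)
  knothe_neg_one : ∀ k, ∀ x ∈ cube, knothe fρ fπ k (Function.update x k (-1)) = -1
  knothe_one : ∀ k, ∀ x ∈ cube, knothe fρ fπ k (Function.update x k 1) = 1

/-- The extension is the quotient of the principal roots of `hρ` at `z` and of `hπ` at the complex
image of `z`. Both values lie in a disc inside the right half-plane, so the roots are holomorphic.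
Both conditional densities differ from one by `O(b k)`, and so do their roots; this gives the size
of the extension. -/
theorem exists_isRootExtension {fρ fπ : (ℕ → ℝ) → ℝ} {b : ℕ → ℝ} {r m A Λ : ℝ}
    {hρ hπ : ℕ → (ℕ → ℂ) → ℂ} (Hρ : IsCondExtension fρ b r m A Λ hρ)
    (Hπ : IsCondExtension fπ b r m A Λ hπ) (hb : ∀ j, 0 < b j) (hbs : Summable b)
    (hr : 0 < r) (hm : 0 < m) (hmA : m ≤ A) (hΛ : 0 ≤ Λ) :
    ∃ η C c₀ : ℝ, 0 < η ∧ 0 < C ∧ 0 < c₀ ∧ ∃ G, IsRootExtension fρ fπ b η C c₀ G := by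
  have hb' : ∀ j, 0 ≤ b j := fun j => (hb j).le
  have hA : 0 < A := hm.trans_le hmA
  obtain ⟨η, C₁, hη, hC₁, hex⟩ := exists_isComplexTransport Hρ Hπ hb' hbs hr hm hmA hΛ
  have hex' : ∀ K, ∀ z ∈ nearCube b η K, ∃ w, IsComplexTransport hρ hπ b r K z w := by
    rintro K z ⟨x, hx, hz⟩
    obtain ⟨w, hw, _⟩ := hex K z x hx hz
    exact ⟨w, hw⟩
  -- An arbitrary solution is picked for each `z` and each `K`. Uniqueness makes its first `K`
  -- entries well behaved: they depend only on the first `K` entries of `z` and are holomorphic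
  -- along curves.
  choose! W hW using hex'
  have hWclose : ∀ k z, ∀ x ∈ cube, ∑ j ∈ Finset.range (k + 1), b j * ‖z j - (x j : ℂ)‖ ≤ η →
      ‖W (k + 1) z k - knothe fρ fπ k x‖ ≤ C₁ * (1 + ‖z k - x k‖) := by
    intro k z x hx hz
    obtain ⟨w, hw, hwe⟩ := hex (k + 1) z x hx hz
    rw [(hW (k + 1) z ⟨x, hx, hz⟩).eq_of_eq Hρ Hπ hb hr hm hmA hΛ hw (fun _ _ => rfl) k.lt_succ_self]
    exact hwe k k.lt_succ_self
  have hr3 : r / 3 ≤ r := by linarith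
  have hr32 : r / 3 ≤ r / 2 := by linarith
  have hsrc : ∀ k, ∀ z ∈ nearCube b η (k + 1), z ∈ nearCube b r (k + 1) := fun k z hz =>
    mem_nearCube_of_le hb' hr3 le_rfl (hW _ z hz).source
  have htgt : ∀ k, ∀ z ∈ nearCube b η (k + 1), W (k + 1) z ∈ nearCube b r (k + 1) := fun k z hz =>
    mem_nearCube_of_le hb' hr3 le_rfl (hW _ z hz).target
  have hslρ : ∀ k, ∀ z ∈ nearCube b η (k + 1), hρ k z ∈ Complex.slitPlane := fun k z hz =>
    mem_slitPlane_of_norm_sub_le hm (Hρ.near k z (hsrc k z hz))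
  have hslπ : ∀ k, ∀ z ∈ nearCube b η (k + 1), hπ k (W (k + 1) z) ∈ Complex.slitPlane :=
    fun k z hz => mem_slitPlane_of_norm_sub_le hm (Hπ.near k _ (htgt k z hz))
  have hne : ∀ k, ∀ z ∈ nearCube b η (k + 1), hπ k (W (k + 1) z) ^ (2⁻¹ : ℂ) ≠ 0 := by
    intro k z hz h0
    have : (hπ k (W (k + 1) z) ^ (2⁻¹ : ℂ)) ^ 2 = hπ k (W (k + 1) z) := by
      exact_mod_cast Complex.cpow_nat_inv_pow _ two_ne_zero
    rw [h0] at this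
    exact Complex.slitPlane_ne_zero (hslπ k z hz) (by rw [← this]; simp)
  have hWreal : ∀ k, ∀ x ∈ cube, ∀ j ≤ k, W (k + 1) (fun j => (x j : ℂ)) j = knothe fρ fπ j x := by
    intro k x hx j hj
    exact (hW (k + 1) _ (ofReal_mem_nearCube hη.le _ hx)).eq_of_eq Hρ Hπ hb hr hm hmA hΛ
      (isComplexTransport_ofReal Hρ Hπ hr hm.le hx (k + 1)) (fun _ _ => rfl) (by omega)
  have hcdf_inj : ∀ k, ∀ y ∈ cube, ∀ s ∈ Icc (-1 : ℝ) 1, ∀ s' ∈ Icc (-1 : ℝ) 1,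
      condCDF fπ k y s = condCDF fπ k y s' → s = s' := by
    intro k y hy s hs s' hs' h
    have h1 := Hπ.le_norm_segmentCDF_sub hb' hr hA.le
      (ofReal_mem_nearCube (half_pos hr).le k hy) (ofReal_mem_strip b (half_pos hr) k hs)
      (ofReal_mem_strip b (half_pos hr) k hs')
    rw [Hπ.segmentCDF_ofReal k hy hs, Hπ.segmentCDF_ofReal k hy hs', h, sub_self, norm_zero] at h1
    have h2 : ‖(s : ℂ) - s'‖ ≤ 0 := by
      by_contra hc
      push Not at hc
      nlinarith
    exact_mod_cast sub_eq_zero.1 (norm_le_zero_iff.1 h2)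
  -- `Λ * 2` and `Λ * (C₁ + 2)` come from the deviations of `hρ` and `hπ` from one, the summand `1`
  -- only secures positivity, and `√m` bounds the denominator from below. The third constant bounds
  -- `√p / √q` from below, as the conditional densities lie in `[m, 2 * A]`.
  refine ⟨η, (Λ * 2 + Λ * (C₁ + 2) + 1) / Real.sqrt m, Real.sqrt m / Real.sqrt (2 * A), hη,
    by positivity, by positivity,
    fun k z => hρ k z ^ (2⁻¹ : ℂ) / hπ k (W (k + 1) z) ^ (2⁻¹ : ℂ) - 1, ?_⟩
  constructor
  · intro k z hz z' hz' hzz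
    have h1 : hπ k (W (k + 1) z) = hπ k (W (k + 1) z') := Hπ.congr k _ _ fun j hj =>
      (hW _ z hz).eq_of_eq Hρ Hπ hb hr hm hmA hΛ (hW _ z' hz') (fun i hi => hzz i (by omega))
        (by omega)
    rw [h1, Hρ.congr k z z' hzz]
  · intro k z₀ hz₀
    have hcoord : ∀ j, Tendsto (fun z : ℕ → ℂ => z j) (𝓝[nearCube b η (k + 1)] z₀) (𝓝 (z₀ j)) :=
      fun j => ((continuous_apply j).tendsto z₀).mono_left nhdsWithin_le_nhds
    have hev : ∀ᶠ z in 𝓝[nearCube b η (k + 1)] z₀, z ∈ nearCube b η (k + 1) :=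
      eventually_mem_nhdsWithin
    have t1 : Tendsto (fun z => hρ k z) (𝓝[nearCube b η (k + 1)] z₀) (𝓝 (hρ k z₀)) :=
      Hρ.tendsto (hev.mono fun z hz => hsrc k z hz) (hsrc k z₀ hz₀) fun j _ => hcoord j
    have t2 : Tendsto (fun z => hπ k (W (k + 1) z)) (𝓝[nearCube b η (k + 1)] z₀)
        (𝓝 (hπ k (W (k + 1) z₀))) :=
      Hπ.tendsto (hev.mono fun z hz => htgt k z hz) (htgt k z₀ hz₀) fun j hj =>
        tendsto_of_isComplexTransport Hρ Hπ hb hr hm hmA hΛ (hev.mono fun z hz => hW _ z hz)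
          (hW _ z₀ hz₀) (fun j _ => hcoord j) (by omega)
    exact ((t1.cpow tendsto_const_nhds (hslρ k z₀ hz₀)).div
      (t2.cpow tendsto_const_nhds (hslπ k z₀ hz₀)) (hne k z₀ hz₀)).sub_const 1
  · intro k Ω hΩ z hz hzn
    have d1 := Hρ.holomorphic k Ω hΩ z hz fun τ hτ => hsrc k _ (hzn τ hτ)
    have d2 := Hπ.holomorphic k Ω hΩ (fun τ => W (k + 1) (z τ))
      (fun j hj => differentiableOn_isComplexTransport Hρ Hπ hb hr hm hmA hΛ hΩ
        (fun τ hτ => hW (k + 1) _ (hzn τ hτ)) (fun j hj => hz j (by omega)) j (by omega))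
      fun τ hτ => htgt k _ (hzn τ hτ)
    exact ((d1.cpow (differentiableOn_const _) fun τ hτ => hslρ k _ (hzn τ hτ)).div
      (d2.cpow (differentiableOn_const _) fun τ hτ => hslπ k _ (hzn τ hτ))
      fun τ hτ => hne k _ (hzn τ hτ)).sub_const 1
  · intro k z x hx hz
    have hzn : z ∈ nearCube b η (k + 1) := ⟨x, hx, hz⟩
    have e1 := Hρ.norm_sub_one_le hb' hr hΛ
      (mem_nearCube_of_le hb' hr32 le_rfl (hW _ z hzn).source) (hx k trivial)
    have e2 := Hπ.norm_sub_one_le hb' hr hΛ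
      (mem_nearCube_of_le hb' hr32 le_rfl (hW _ z hzn).target)
      (knothe_spec Hρ Hπ hr hm.le hx k).1
    have e3 := hWclose k z x hx hz
    set d := ‖z k - x k‖ with hd
    have hd0 : 0 ≤ d := norm_nonneg _
    have e1' : ‖hρ k z - 1‖ ≤ Λ * 2 * (b k * (1 + d)) := by
      refine e1.trans ?_
      rw [mul_assoc]
      refine mul_le_mul_of_nonneg_left ?_ hΛ
      rw [mul_left_comm]
      exact mul_le_mul_of_nonneg_left (by linarith) (hb' k)
    have e2' : ‖hπ k (W (k + 1) z) - 1‖ ≤ Λ * (C₁ + 2) * (b k * (1 + d)) := by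
      refine e2.trans ?_
      rw [mul_assoc]
      refine mul_le_mul_of_nonneg_left ?_ hΛ
      rw [mul_left_comm]
      exact mul_le_mul_of_nonneg_left (by linarith) (hb' k)
    have hlow : Real.sqrt m ≤ ‖hπ k (W (k + 1) z) ^ (2⁻¹ : ℂ)‖ := by
      have h1 : ‖hπ k (W (k + 1) z) ^ (2⁻¹ : ℂ)‖ ^ 2 = ‖hπ k (W (k + 1) z)‖ := by
        rw [← norm_pow]
        congr 1
        exact_mod_cast Complex.cpow_nat_inv_pow _ two_ne_zero
      rw [Real.sqrt_le_left (norm_nonneg _), h1]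
      exact Hπ.le_norm hA.le (htgt k z hzn)
    have e4 : hρ k z ^ (2⁻¹ : ℂ) / hπ k (W (k + 1) z) ^ (2⁻¹ : ℂ) - 1
        = ((hρ k z ^ (2⁻¹ : ℂ) - 1) - (hπ k (W (k + 1) z) ^ (2⁻¹ : ℂ) - 1))
          / hπ k (W (k + 1) z) ^ (2⁻¹ : ℂ) := by
      rw [sub_sub_sub_cancel_right, sub_div, div_self (hne k z hzn)]
    rw [e4, norm_div, div_mul_eq_mul_div]
    have hbd : 0 ≤ b k * (1 + d) := mul_nonneg (hb' k) (by linarith)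
    refine div_le_div₀ (by positivity) ?_ (by positivity) hlow
    refine (norm_sub_le _ _).trans ?_
    have := norm_cpow_inv_two_sub_one_le (hρ k z)
    have := norm_cpow_inv_two_sub_one_le (hπ k (W (k + 1) z))
    linarith
  · intro k x hx
    have hTx := knothe_mem_cube Hρ Hπ hr hm.le hx
    have hxn : (fun j => (x j : ℂ)) ∈ nearCube b η (k + 1) := ofReal_mem_nearCube hη.le _ hx
    have hπx : hπ k (W (k + 1) fun j => (x j : ℂ)) = condDensity fπ k fun j => knothe fρ fπ j x := by
      rw [← Hπ.ofReal k _ hTx]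
      exact Hπ.congr k _ _ fun j hj => hWreal k x hx j hj
    have hρx := Hρ.ofReal k x hx
    set p := condDensity fρ k x with hp
    set q := condDensity fπ k (fun j => knothe fρ fπ j x) with hq
    have hpm := Hρ.le_condDensity hr.le k hx
    have hqm := Hπ.le_condDensity hr.le k hTx
    have hsqrt : ∀ y : ℝ, 0 ≤ y → (y : ℂ) ^ (2⁻¹ : ℂ) = (Real.sqrt y : ℝ) := by
      intro y hy
      rw [Real.sqrt_eq_rpow, Complex.ofReal_cpow hy]
      norm_num
    have hq0 : 0 < q := hm.trans_le hqm.1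
    have hp0 : 0 < p := hm.trans_le hpm.1
    refine ⟨Real.sqrt p / Real.sqrt q, ?_, ?_, ?_⟩
    · exact div_le_div₀ (Real.sqrt_nonneg _) (Real.sqrt_le_sqrt hpm.1) (Real.sqrt_pos.2 hq0)
        (Real.sqrt_le_sqrt (by linarith [hqm.2]))
    · rw [hπx, hρx, hsqrt p hp0.le, hsqrt q hq0.le]
      push_cast
      rfl
    · rw [div_pow, Real.sq_sqrt hp0.le, Real.sq_sqrt hq0.le]
      -- Only the `k`-th variable moves, by less than `η / b k`, which keeps the point within
      -- weighted distance `η`. The disc surrounds `x k` even at an endpoint of `[-1,1]`, so the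
      -- one-sided derivatives are restrictions of a complex one.
      set Ω := Metric.ball (x k : ℂ) (η / b k) with hΩ
      set z : ℂ → ℕ → ℂ := fun τ => Function.update (fun j => (x j : ℂ)) k τ with hz
      have hx0 : (fun j => (x j : ℂ)) ∈ nearCube b 0 k := ofReal_mem_nearCube le_rfl k hx
      have hzn : ∀ τ ∈ Ω, z τ ∈ nearCube b η (k + 1) := by
        intro τ hτ
        rw [hΩ, Metric.mem_ball, dist_eq_norm, lt_div_iff₀' (hb k)] at hτ
        have := update_mem_nearCube hx0 (hx k trivial) hτ.le
        rwa [zero_add] at this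
      have hx_mem : (x k : ℂ) ∈ Ω := Metric.mem_ball_self (div_pos hη (hb k))
      have hzx : z (x k) = fun j => (x j : ℂ) := Function.update_eq_self _ _
      have hWz : ∀ τ ∈ Ω, IsComplexTransport hρ hπ b r (k + 1) (z τ) (W (k + 1) (z τ)) :=
        fun τ hτ => hW _ _ (hzn τ hτ)
      have hz_old : ∀ τ, ∀ j < k, z τ j = x j := fun τ j hj => Function.update_of_ne hj.ne _ _
      have hnhds : Ω ∈ 𝓝 (x k : ℂ) := Metric.isOpen_ball.mem_nhds hx_mem
      -- The first `k` entries of the image do not depend on the `k`-th variable, so they contribute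
      -- nothing to the implicit derivative.
      have hφ' : HasDerivAt (fun τ => segmentCDF hπ k (W (k + 1) (z τ)) (W (k + 1) (z (x k)) k)) 0
          (x k : ℂ) := by
        refine (hasDerivAt_const (x k : ℂ) (segmentCDF hπ k (W (k + 1) (z (x k)))
          (W (k + 1) (z (x k)) k))).congr_of_eventuallyEq ?_
        filter_upwards [hnhds] with τ hτ
        refine Hπ.segmentCDF_congr (fun j hj => ?_) _
        exact ((hWz τ hτ).mono hb' k.le_succ).eq_of_eq Hρ Hπ hb hr hm hmA hΛ
          ((hWz _ hx_mem).mono hb' k.le_succ) (fun i hi => by rw [hz_old τ i hi, hz_old _ i hi]) hj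
      have hv' : HasDerivAt (fun τ => segmentCDF hρ k (z τ) (z τ k)) p (x k : ℂ) := by
        have := Hρ.hasDerivAt_segmentCDF hb' hr (ofReal_mem_nearCube (half_pos hr).le k hx)
          (ofReal_mem_strip b (half_pos hr) k (hx k trivial))
        rw [Function.update_eq_self, hρx] at this
        refine this.congr_of_eventuallyEq (Eventually.of_forall fun τ => ?_)
        simp only [hz, Function.update_self]
        exact Hρ.segmentCDF_congr (fun j hj => hz_old τ j hj) _
      have hder := hasDerivAt_isComplexTransport Hρ Hπ hb hr hm hmA hΛ k.lt_succ_self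
        Metric.isOpen_ball hWz (fun j hj => ?_) hx_mem hφ' hv'
      · rw [hzx, hπx, sub_zero, ← Complex.ofReal_div] at hder
        have h2 := hder.real_of_complex
        rw [Complex.ofReal_re] at h2
        refine h2.hasDerivWithinAt.congr (fun t ht => ?_) ?_
        · have := hWreal k _ (update_mem_cube hx k ht) k le_rfl
          rw [ofReal_update] at this
          simp [hz, this]
        · have := hWreal k _ hx k le_rfl
          rw [← hzx] at this
          rw [Function.update_eq_self, this, Complex.ofReal_re]
      · rcases (Nat.lt_succ_iff.1 hj).eq_or_lt with rfl | hj
        · simp only [hz, Function.update_self]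
          exact differentiableOn_id
        · simp only [hz_old _ j hj]
          exact differentiableOn_const _
  · intro k x hx
    have hx' := update_mem_cube hx k (left_mem_Icc.2 (by norm_num : (-1 : ℝ) ≤ 1))
    have hs := knothe_spec Hρ Hπ hr hm.le hx' k
    refine hcdf_inj k _ (knothe_mem_cube Hρ Hπ hr hm.le hx') _ hs.1 _ (by norm_num) ?_
    rw [hs.2, Function.update_self, condCDF_neg_one, condCDF_neg_one]
  · intro k x hx
    have hx' := update_mem_cube hx k (right_mem_Icc.2 (by norm_num : (-1 : ℝ) ≤ 1))
    have hs := knothe_spec Hρ Hπ hr hm.le hx' k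
    refine hcdf_inj k _ (knothe_mem_cube Hρ Hπ hr hm.le hx') _ hs.1 _ (by norm_num) ?_
    rw [hs.2, Function.update_self, Hρ.condCDF_one hr k hx',
      Hπ.condCDF_one hr k (knothe_mem_cube Hρ Hπ hr hm.le hx')]

/-! ### Chebyshev expansions as Fourier series on the torus. -/

open UnitAddTorus

theorem fourier_add_coe (n : ℤ) (θ : UnitAddCircle) (s : ℝ) :
    fourier n (θ + (s : UnitAddCircle))
      = fourier n θ * Complex.exp (2 * Real.pi * Complex.I * n * s) := by
  induction θ using QuotientAddGroup.induction_on with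
  | H y =>
    have e : ((y : UnitAddCircle) + (s : UnitAddCircle)) = ((y + s : ℝ) : UnitAddCircle) := rfl
    rw [e, fourier_coe_apply]
    have e' : fourier n ((QuotientAddGroup.mk y : UnitAddCircle))
      = Complex.exp (2 * Real.pi * Complex.I * n * y / (1 : ℝ)) := fourier_coe_apply
    rw [e', ← Complex.exp_add]
    congr 1
    push_cast
    ring

theorem norm_fourier_apply (n : ℤ) (θ : UnitAddCircle) : ‖fourier n θ‖ = 1 := by
  rw [fourier_apply]; exact Circle.norm_coe _

theorem mFourier_add_coe {ι : Type*} [Fintype ι] (n : ι → ℤ) (θ : UnitAddTorus ι) (s : ι → ℝ) :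
    mFourier n (θ + fun j => (s j : UnitAddCircle))
      = mFourier n θ * Complex.exp (2 * Real.pi * Complex.I * ∑ j, (n j : ℂ) * (s j : ℂ)) := by
  simp only [mFourier, ContinuousMap.coe_mk, Pi.add_apply, fourier_add_coe, Finset.prod_mul_distrib,
    ← Complex.exp_sum]
  rw [Finset.mul_sum]
  congr 2
  refine Finset.sum_congr rfl fun j _ => ?_
  ring

/-- The Joukowski map sends an annulus to a neighbourhood of `[-1,1]`. -/
theorem exists_norm_joukowski_sub_le {w : ℂ} {ρ : ℝ} (hρ : 1 ≤ ρ) (h1 : ρ⁻¹ ≤ ‖w‖) (h2 : ‖w‖ ≤ ρ) :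
    ∃ x ∈ Icc (-1 : ℝ) 1, ‖(w + w⁻¹) / 2 - x‖ ≤ ρ - 1 := by
  have hρ0 : 0 < ρ := by linarith
  have hs : 0 < ‖w‖ := lt_of_lt_of_le (by positivity) h1
  have hw : w ≠ 0 := norm_pos_iff.1 hs
  set s := ‖w‖ with hsdef
  have hsc : (s : ℂ) ≠ 0 := by exact_mod_cast hs.ne'
  -- The unit vector `v` is mapped to the real number `v.re`; passing from `v` to `w = s * v`
  -- changes the two summands by factors `s` and `s⁻¹`, each within `ρ - 1` of one.
  set v := w / s with hv
  have hvn : ‖v‖ = 1 := by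
    rw [hv, norm_div, Complex.norm_real, Real.norm_of_nonneg hs.le, ← hsdef, div_self hs.ne']
  have hv0 : v ≠ 0 := norm_pos_iff.1 (by rw [hvn]; norm_num)
  have hwv : w = s * v := by rw [hv]; field_simp
  have hvinv : v⁻¹ = (starRingEnd ℂ) v := by
    rw [Complex.inv_def, Complex.normSq_eq_norm_sq, hvn]; simp
  have hre : (v + v⁻¹) / 2 = (v.re : ℂ) := by
    rw [hvinv, Complex.add_conj]; push_cast; ring
  refine ⟨v.re, abs_le.1 ((Complex.abs_re_le_norm v).trans hvn.le), ?_⟩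
  have e : (w + w⁻¹) / 2 - (v.re : ℂ) = (((s - 1 : ℝ) : ℂ) * v + ((s⁻¹ - 1 : ℝ) : ℂ) * v⁻¹) / 2 := by
    rw [← hre, hwv, mul_inv]; push_cast; ring
  have hinv : ρ⁻¹ * ρ = 1 := inv_mul_cancel₀ hρ0.ne'
  have hi1 : 1 - ρ⁻¹ ≤ ρ - 1 := by
    have : 0 < ρ⁻¹ := by positivity
    nlinarith
  have a1 : |s - 1| ≤ ρ - 1 := abs_le.2 ⟨by linarith, by linarith⟩
  have a2 : |s⁻¹ - 1| ≤ ρ - 1 := by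
    have b1 : s⁻¹ ≤ ρ := by
      rw [← inv_inv ρ]; exact inv_anti₀ (by positivity) h1
    have b2 : ρ⁻¹ ≤ s⁻¹ := inv_anti₀ hs h2
    exact abs_le.2 ⟨by linarith, by linarith⟩
  rw [e, norm_div]
  have := norm_add_le (((s - 1 : ℝ) : ℂ) * v) (((s⁻¹ - 1 : ℝ) : ℂ) * v⁻¹)
  rw [norm_mul, norm_mul, norm_inv, hvn, Complex.norm_real, Complex.norm_real, Real.norm_eq_abs,
    Real.norm_eq_abs] at this
  rw [Complex.norm_ofNat, div_le_iff₀ (by norm_num)]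
  linarith

/-- The product of neighbourhoods of `[-1,1]` of radii `ρ j - 1`. -/
def polyNbhd {ι : Type*} (ρ : ι → ℝ) : Set (ι → ℂ) :=
  {z | ∀ j, ∃ x ∈ Icc (-1 : ℝ) 1, ‖z j - x‖ ≤ ρ j - 1}

/-- The cosine of `2πθ`. -/
noncomputable def torusCos {ι : Type*} (θ : UnitAddTorus ι) : ι → ℂ :=
  fun j => (fourier 1 (θ j) + (fourier 1 (θ j))⁻¹) / 2

/-- The cosine of `2πθ + τ a`. -/
noncomputable def torusCurve {ι : Type*} (a : ι → ℝ) (θ : UnitAddTorus ι) (τ : ℂ) : ι → ℂ :=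
  fun j => (fourier 1 (θ j) * Complex.exp (Complex.I * τ * a j)
    + (fourier 1 (θ j) * Complex.exp (Complex.I * τ * a j))⁻¹) / 2

theorem fourier_apply_ne_zero (n : ℤ) (θ : UnitAddCircle) : fourier n θ ≠ 0 :=
  norm_pos_iff.1 (by rw [norm_fourier_apply]; norm_num)

theorem torusCurve_mem_polyNbhd {ι : Type*} {a ρ : ι → ℝ} (hρ : ∀ j, 1 ≤ ρ j)
    (ha : ∀ j, |a j| ≤ Real.log (ρ j)) (θ : UnitAddTorus ι) {τ : ℂ} (hτ : |τ.im| ≤ 1) :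
    torusCurve a θ τ ∈ polyNbhd ρ := by
  intro j
  have hρ0 : 0 < ρ j := by linarith [hρ j]
  have hn : ‖fourier 1 (θ j) * Complex.exp (Complex.I * τ * a j)‖ = Real.exp (-(τ.im * a j)) := by
    rw [norm_mul, norm_fourier_apply, one_mul, Complex.norm_exp]
    simp
  have hle : |τ.im * a j| ≤ Real.log (ρ j) := by
    rw [abs_mul]
    exact (mul_le_of_le_one_left (abs_nonneg _) hτ).trans (ha j)
  refine exists_norm_joukowski_sub_le (hρ j) ?_ ?_
  · rw [hn, ← Real.exp_log (inv_pos.2 hρ0), Real.exp_le_exp, Real.log_inv]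
    linarith [(abs_le.1 hle).2]
  · rw [hn]
    conv_rhs => rw [← Real.exp_log hρ0]
    rw [Real.exp_le_exp]
    linarith [(abs_le.1 hle).1]

theorem torusCurve_zero {ι : Type*} (a : ι → ℝ) (θ : UnitAddTorus ι) :
    torusCurve a θ 0 = torusCos θ := by
  ext j; simp [torusCurve, torusCos]

/-- At real times the curve is a translation of the torus and so leaves Haar integrals unchanged.
This replaces a separate contour shift in each variable. -/
theorem torusCurve_ofReal {ι : Type*} (a : ι → ℝ) (θ : UnitAddTorus ι) (t : ℝ) :
    torusCurve a θ t = torusCos (θ + fun j => ((t * a j / (2 * Real.pi) : ℝ) : UnitAddCircle)) := by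
  ext j
  have : Complex.exp (2 * Real.pi * Complex.I * (1 : ℤ) * ((t * a j / (2 * Real.pi) : ℝ) : ℂ))
      = Complex.exp (Complex.I * t * a j) := by
    congr 1
    have : (Real.pi : ℂ) ≠ 0 := by exact_mod_cast Real.pi_ne_zero
    push_cast
    field_simp
  rw [torusCurve, torusCos, Pi.add_apply, fourier_add_coe, this]

theorem continuous_torusCurve {ι : Type*} (a : ι → ℝ) (τ : ℂ) :
    Continuous fun θ : UnitAddTorus ι => torusCurve a θ τ := by
  refine continuous_pi fun j => ?_
  have h1 : Continuous fun θ : UnitAddTorus ι =>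
      fourier 1 (θ j) * Complex.exp (Complex.I * τ * a j) :=
    ((fourier 1).continuous.comp (continuous_apply j)).mul continuous_const
  exact (h1.add (h1.inv₀ fun θ => mul_ne_zero (fourier_apply_ne_zero _ _) (Complex.exp_ne_zero _))).div_const 2

theorem differentiable_torusCurve {ι : Type*} (a : ι → ℝ) (θ : UnitAddTorus ι) (j : ι) :
    Differentiable ℂ fun τ => torusCurve a θ τ j := by
  have h1 : Differentiable ℂ fun τ : ℂ => fourier 1 (θ j) * Complex.exp (Complex.I * τ * a j) := by
    fun_prop
  exact (h1.add (h1.inv fun θ => mul_ne_zero (fourier_apply_ne_zero _ _) (Complex.exp_ne_zero _))).div_const 2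

/-- The Fourier coefficients of `θ ↦ g (cos 2πθ)` decay geometrically if `g` is holomorphic and
bounded in a neighbourhood of `[-1,1]^ι`. -/
theorem norm_mFourierCoeff_le {ι : Type*} [Fintype ι] {g : (ι → ℂ) → ℂ} {ρ : ι → ℝ}
    (hρ : ∀ j, 1 ≤ ρ j) (hc : ContinuousOn g (polyNbhd ρ))
    (hol : ∀ (Ω : Set ℂ), IsOpen Ω → ∀ z : ℂ → ι → ℂ, (∀ j, DifferentiableOn ℂ (fun τ => z τ j) Ω) →
      (∀ τ ∈ Ω, z τ ∈ polyNbhd ρ) → DifferentiableOn ℂ (fun τ => g (z τ)) Ω)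
    {C : ℝ} (hC : ∀ z ∈ polyNbhd ρ, ‖g z‖ ≤ C) (n : ι → ℤ) :
    ‖mFourierCoeff (fun θ => g (torusCos θ)) n‖ ≤ C * ∏ j, (ρ j ^ (n j).natAbs)⁻¹ := by
  -- The direction of the shift follows the sign of `n j`, so that `n j * a j = |n j| * log (ρ j)`
  -- and every variable gains decay.
  set a : ι → ℝ := fun j => if 0 ≤ n j then Real.log (ρ j) else -Real.log (ρ j) with ha
  have hlog : ∀ j, 0 ≤ Real.log (ρ j) := fun j => Real.log_nonneg (hρ j)
  have ha' : ∀ j, |a j| ≤ Real.log (ρ j) := by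
    intro j
    simp only [ha]
    split_ifs
    · rw [abs_of_nonneg (hlog j)]
    · rw [abs_neg, abs_of_nonneg (hlog j)]
  have hna : ∀ j, (n j : ℝ) * a j = (n j).natAbs * Real.log (ρ j) := by
    intro j
    simp only [ha]
    split_ifs with h
    · rw [Nat.cast_natAbs, abs_of_nonneg h]
    · rw [Nat.cast_natAbs, abs_of_neg (not_le.1 h)]; push_cast; ring
  set N : ℝ := ∑ j, (n j : ℝ) * a j with hN
  set μ : Measure (UnitAddTorus ι) :=
    Measure.pi fun _ : ι => (AddCircle.haarAddCircle : Measure UnitAddCircle) with hμ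
  -- All variables are shifted together by one complex parameter, so holomorphy along curves
  -- suffices. `I` is constant on the real line by translation invariance, hence on the strip by the
  -- identity theorem; at `τ = -iσ` its prefactor is `exp (-σ N)`, and `σ → 1` gives the bound.
  set I : ℂ → ℂ := fun τ => Complex.exp (-(Complex.I * τ * N))
    * ∫ θ, mFourier (-n) θ * g (torusCurve a θ τ) ∂μ with hI
  set Ω : Set ℂ := Complex.im ⁻¹' Ioo (-1 : ℝ) 1 with hΩ
  have hΩo : IsOpen Ω := isOpen_Ioo.preimage Complex.continuous_im
  have hΩ1 : ∀ τ ∈ Ω, |τ.im| ≤ 1 := fun τ hτ => abs_le.2 ⟨hτ.1.le, hτ.2.le⟩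
  have hΩc : IsPreconnected Ω :=
    ((convex_Ioo (-1 : ℝ) 1).linear_preimage Complex.imLm).isPreconnected
  have hmem : ∀ θ, ∀ τ ∈ Ω, torusCurve a θ τ ∈ polyNbhd ρ := fun θ τ hτ =>
    torusCurve_mem_polyNbhd hρ ha' θ (hΩ1 τ hτ)
  have hnF : ∀ θ : UnitAddTorus ι, ‖mFourier (-n) θ‖ = 1 := fun θ => by
    simp only [mFourier, ContinuousMap.coe_mk, norm_prod, norm_fourier_apply, Finset.prod_const_one]
  have hdiff : DifferentiableOn ℂ I Ω := by
    refine DifferentiableOn.mul (by fun_prop) ?_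
    refine differentiableOn_integral_of_bounded hΩo (C := C) (fun τ hτ => ?_)
      (ae_of_all _ fun θ => ?_) (ae_of_all _ fun θ τ hτ => ?_)
    · refine Continuous.aestronglyMeasurable ?_
      exact (mFourier (-n)).continuous.mul
        (hc.comp_continuous (continuous_torusCurve a τ) fun θ => hmem θ τ hτ)
    · refine DifferentiableOn.const_mul (hol Ω hΩo _ (fun j => ?_) fun τ hτ => hmem θ τ hτ) _
      exact (differentiable_torusCurve a θ j).differentiableOn
    · rw [norm_mul, hnF, one_mul]
      exact hC _ (hmem θ τ hτ)
  have hreal : ∀ t : ℝ, I t = I 0 := by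
    intro t
    have e1 : I t = ∫ θ, mFourier (-n) (θ + fun j => ((t * a j / (2 * Real.pi) : ℝ) : UnitAddCircle))
        * g (torusCos (θ + fun j => ((t * a j / (2 * Real.pi) : ℝ) : UnitAddCircle))) ∂μ := by
      simp only [hI]
      rw [← integral_const_mul]
      refine integral_congr_ae (ae_of_all _ fun θ => ?_)
      simp only [torusCurve_ofReal, mFourier_add_coe]
      have : Complex.exp (2 * Real.pi * Complex.I
            * ∑ j, (((-n) j : ℤ) : ℂ) * ((t * a j / (2 * Real.pi) : ℝ) : ℂ))
          = Complex.exp (-(Complex.I * t * N)) := by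
        congr 1
        rw [hN]
        push_cast
        rw [Finset.mul_sum, Finset.mul_sum, ← Finset.sum_neg_distrib]
        refine Finset.sum_congr rfl fun j _ => ?_
        have : (Real.pi : ℂ) ≠ 0 := by exact_mod_cast Real.pi_ne_zero
        simp only [Pi.neg_apply]
        push_cast
        field_simp
      rw [this]
      ring
    rw [e1, integral_add_right_eq_self (μ := μ) (fun θ => mFourier (-n) θ * g (torusCos θ))]
    simp [hI, torusCurve_zero]
  have h0Ω : (0 : ℂ) ∈ Ω := by simp [hΩ]
  have hconst : EqOn I (fun _ => I 0) Ω := by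
    refine (hdiff.analyticOnNhd hΩo).eqOn_of_preconnected_of_frequently_eq analyticOnNhd_const hΩc
      h0Ω ?_
    have hseq : Tendsto (fun m : ℕ => ((1 / ((m : ℝ) + 1) : ℝ) : ℂ)) atTop (𝓝[≠] 0) := by
      rw [tendsto_nhdsWithin_iff]
      constructor
      · have := (Complex.continuous_ofReal.tendsto 0).comp
          (tendsto_one_div_add_atTop_nhds_zero_nat (𝕜 := ℝ))
        rwa [Complex.ofReal_zero] at this
      · refine Eventually.of_forall fun m => ?_
        have : (1 / ((m : ℝ) + 1) : ℝ) ≠ 0 := by positivity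
        rw [mem_compl_iff, mem_singleton_iff]
        exact_mod_cast this
    exact hseq.frequently (Frequently.of_forall fun m => hreal _)
  have hcoef : mFourierCoeff (fun θ => g (torusCos θ)) n = I 0 := by
    simp only [hI, torusCurve_zero]
    simp
    rfl
  have hbound : ∀ σ ∈ Ioo (0 : ℝ) 1, ‖I 0‖ ≤ Real.exp (-(σ * N)) * C := by
    intro σ hσ
    have hmemσ : (-(Complex.I * σ) : ℂ) ∈ Ω := by
      simp only [hΩ, mem_preimage]
      have : (-(Complex.I * σ) : ℂ).im = -σ := by simp
      rw [this]
      exact ⟨by linarith [hσ.2], by linarith [hσ.1]⟩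
    have e := hconst hmemσ
    simp only at e
    rw [← e, hI, norm_mul]
    refine mul_le_mul ?_ ?_ (norm_nonneg _) (Real.exp_nonneg _)
    · rw [Complex.norm_exp, Real.exp_le_exp]
      have : (-(Complex.I * -(Complex.I * σ) * N) : ℂ) = ((-(σ * N) : ℝ) : ℂ) := by
        push_cast
        linear_combination (σ * N : ℂ) * Complex.I_sq
      rw [this, Complex.ofReal_re]
    · refine (norm_integral_le_of_norm_le_const (C := C) (ae_of_all _ fun θ => ?_)).trans (by simp)
      rw [norm_mul, hnF, one_mul]
      exact hC _ (hmem θ _ hmemσ)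
  have hlim : Tendsto (fun σ : ℝ => Real.exp (-(σ * N)) * C) (𝓝[<] 1) (𝓝 (Real.exp (-(1 * N)) * C)) := by
    refine Tendsto.mono_left (Continuous.tendsto ?_ 1) nhdsWithin_le_nhds
    fun_prop
  have hfin := ge_of_tendsto hlim (by
    filter_upwards [Ioo_mem_nhdsLT (zero_lt_one (α := ℝ))] with σ hσ using hbound σ hσ)
  rw [hcoef]
  refine hfin.trans (le_of_eq ?_)
  rw [mul_comm, one_mul, hN, ← Finset.sum_neg_distrib, Real.exp_sum]
  congr 1
  refine Finset.prod_congr rfl fun j _ => ?_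
  have hρ0 : 0 < ρ j := by linarith [hρ j]
  rw [hna, Real.exp_neg, Real.exp_nat_mul, Real.exp_log hρ0]

/-- The multivariate Chebyshev expansion. -/
theorem hasSum_mFourierCoeff_mul_prod_cos {ι : Type*} [Fintype ι] {g : (ι → ℂ) → ℂ}
    (hc : Continuous fun θ : UnitAddTorus ι => g (torusCos θ))
    (hs : Summable (mFourierCoeff fun θ : UnitAddTorus ι => g (torusCos θ))) (φ : ι → ℝ) :
    HasSum (fun n : ι → ℤ => mFourierCoeff (fun θ : UnitAddTorus ι => g (torusCos θ)) n
      * ∏ j, (Real.cos (n j * φ j) : ℂ)) (g fun j => (Real.cos (φ j) : ℂ)) := by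
  classical
  -- The angles `±φ j` have the same cosine. Averaging the Fourier series over all sign patterns
  -- keeps its value and turns each exponential into a cosine.
  set ε : Bool → ℝ := fun s => if s then 1 else -1 with hε
  set Θ : (ι → Bool) → UnitAddTorus ι := fun s j =>
    ((ε (s j) * φ j / (2 * Real.pi) : ℝ) : UnitAddCircle) with hΘ
  have hπ : (Real.pi : ℂ) ≠ 0 := by exact_mod_cast Real.pi_ne_zero
  have hF : ∀ s (n : ℤ) j, fourier n (Θ s j) = Complex.exp (n * (ε (s j) * φ j) * Complex.I) := by
    intro s n j
    rw [hΘ, fourier_coe_apply]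
    congr 1
    push_cast
    field_simp
  have hcos : ∀ s, torusCos (Θ s) = fun j => (Real.cos (φ j) : ℂ) := by
    intro s
    ext j
    rw [torusCos, hF, ← Complex.exp_neg, Complex.ofReal_cos, Complex.cos]
    rcases s j with _ | _
    · simp [hε]; ring
    · simp [hε]
  let F : C(UnitAddTorus ι, ℂ) := ⟨fun θ => g (torusCos θ), hc⟩
  have h1 : ∀ s : ι → Bool, HasSum (fun n : ι → ℤ => mFourierCoeff (fun θ : UnitAddTorus ι => g (torusCos θ)) n
      * ∏ j, Complex.exp (n j * (ε (s j) * φ j) * Complex.I)) (g fun j => (Real.cos (φ j) : ℂ)) := by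
    intro s
    have := hasSum_mFourier_series_apply_of_summable (f := F) hs (Θ s)
    have e : F (Θ s) = g fun j => (Real.cos (φ j) : ℂ) := by
      change g (torusCos (Θ s)) = _
      rw [hcos]
    rw [e] at this
    refine this.congr_fun ?_
    intro n
    simp only [mFourier, ContinuousMap.coe_mk, smul_eq_mul, hF]
    rfl
  have h2 := hasSum_sum (s := Finset.univ) fun (s : ι → Bool) _ => h1 s
  have h3 := h2.mul_left ((2 : ℂ) ^ Fintype.card ι)⁻¹
  have e1 : ((2 : ℂ) ^ Fintype.card ι)⁻¹
      * ∑ _s : ι → Bool, g (fun j => (Real.cos (φ j) : ℂ)) = g fun j => (Real.cos (φ j) : ℂ) := by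
    simp
  rw [e1] at h3
  refine h3.congr_fun fun n => ?_
  rw [← Finset.mul_sum, mul_left_comm]
  congr 1
  rw [← Fintype.prod_sum (f := fun j (s : Bool) => Complex.exp (n j * (ε s * φ j) * Complex.I))]
  rw [← Finset.card_univ, ← Finset.prod_const, ← Finset.prod_inv_distrib, ← Finset.prod_mul_distrib]
  refine Finset.prod_congr rfl fun j _ => ?_
  rw [Complex.ofReal_cos, Complex.cos]
  simp [hε]
  ring_nf

/-! ### Sums over multiindices and the choice of radii. -/

section Sums

theorem ENNReal.tsum_fin_prod {κ : Type*} (n : ℕ) (F : Fin n → κ → ℝ≥0∞) :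
    ∑' ν : Fin n → κ, ∏ i, F i (ν i) = ∏ i, ∑' x, F i x := by
  induction n with
  | zero => simp
  | succ n ih =>
    rw [← (Fin.consEquiv fun _ : Fin (n + 1) => κ).tsum_eq, ENNReal.tsum_prod', Fin.prod_univ_succ,
      ← ih fun i => F i.succ, ← ENNReal.tsum_mul_right]
    refine tsum_congr fun x => ?_
    rw [← ENNReal.tsum_mul_left]
    refine tsum_congr fun ν => ?_
    simp [Fin.consEquiv, Fin.prod_univ_succ]

/-- A sum over functions of a product of terms is a product of sums. -/
theorem ENNReal.tsum_pi_prod {ι κ : Type*} [Fintype ι] (F : ι → κ → ℝ≥0∞) :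
    ∑' ν : ι → κ, ∏ i, F i (ν i) = ∏ i, ∑' x, F i x := by
  classical
  let e := Fintype.equivFin ι
  have h := ENNReal.tsum_fin_prod _ fun i => F (e.symm i)
  rw [← (e.symm.prod_comp fun i => ∑' x, F i x), ← h,
    ← (Equiv.arrowCongr e (Equiv.refl κ)).symm.tsum_eq]
  refine tsum_congr fun ν => ?_
  rw [← e.symm.prod_comp]
  simp

/-- The sum of the terms of all multinomial expansions is a geometric series. -/
theorem ENNReal.tsum_multinomial_mul_prod {ι : Type*} [Fintype ι] (β : ι → ℝ≥0∞) :
    ∑' ν : ι → ℕ, (Nat.multinomial Finset.univ ν : ℝ≥0∞) * ∏ i, β i ^ ν i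
      = (1 - ∑ i, β i)⁻¹ := by
  classical
  rw [← ENNReal.tsum_geometric, ← (Equiv.sigmaFiberEquiv fun ν : ι → ℕ => ∑ i, ν i).tsum_eq,
    ENNReal.tsum_sigma']
  refine tsum_congr fun m => ?_
  rw [Finset.sum_pow_eq_sum_piAntidiag, ← Finset.tsum_subtype]
  let e : {ν : ι → ℕ // ∑ i, ν i = m} ≃ {ν : ι → ℕ // ν ∈ Finset.piAntidiag Finset.univ m} :=
    Equiv.subtypeEquivRight fun ν => by simp
  rw [← e.tsum_eq]
  rfl

/-- A multiindex has one preimage for each choice of signs of its nonzero entries. The cruder count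
`∏ 2 ^ ν i` is multiplicative and can later be absorbed into the bases of the powers. -/
theorem ENNReal.tsum_comp_natAbs_le {ι : Type*} [Fintype ι] (F : (ι → ℕ) → ℝ≥0∞) :
    ∑' n : ι → ℤ, F (fun i => (n i).natAbs) ≤ ∑' ν : ι → ℕ, (∏ i, 2 ^ ν i) * F ν := by
  classical
  rw [← (Equiv.sigmaFiberEquiv fun (n : ι → ℤ) (i : ι) => (n i).natAbs).tsum_eq, ENNReal.tsum_sigma']
  refine ENNReal.tsum_le_tsum fun ν => ?_
  have h1 : ∑' n : {n : ι → ℤ // (fun i => (n i).natAbs) = ν}, F ν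
      = ({n : ι → ℤ | (fun i => (n i).natAbs) = ν}.encard : ℝ≥0∞) * F ν :=
    ENNReal.tsum_set_const (s := {n : ι → ℤ | (fun i => (n i).natAbs) = ν}) (F ν)
  have h2 : ∀ n : {n : ι → ℤ // (fun i => (n i).natAbs) = ν},
      F (fun i => ((Equiv.sigmaFiberEquiv fun (n : ι → ℤ) (i : ι) => (n i).natAbs) ⟨ν, n⟩ i).natAbs)
        = F ν := by
    rintro ⟨n, rfl⟩
    rfl
  rw [tsum_congr h2, h1]
  refine mul_le_mul_left ?_ _
  have hsub : {n : ι → ℤ | (fun i => (n i).natAbs) = ν}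
      ⊆ (Fintype.piFinset fun i => ({(ν i : ℤ), -(ν i : ℤ)} : Finset ℤ) : Finset (ι → ℤ)) := by
    intro n hn
    rw [Finset.mem_coe, Fintype.mem_piFinset]
    intro i
    have : (n i).natAbs = ν i := congrFun hn i
    rw [Finset.mem_insert, Finset.mem_singleton]
    omega
  have hcard : ((Fintype.piFinset fun i => ({(ν i : ℤ), -(ν i : ℤ)} : Finset ℤ)).card : ℕ)
      ≤ ∏ i, 2 ^ ν i := by
    rw [Fintype.card_piFinset]
    refine Finset.prod_le_prod' fun i _ => ?_
    rcases Nat.eq_zero_or_pos (ν i) with h | h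
    · simp [h]
    · exact Finset.card_le_two.trans (le_self_pow (by norm_num) h.ne')
  have h3 := Set.encard_le_encard hsub
  rw [Set.encard_coe_eq_coe_finsetCard] at h3
  calc (({n : ι → ℤ | (fun i => (n i).natAbs) = ν}.encard : ℕ∞) : ℝ≥0∞)
      ≤ ((((Fintype.piFinset fun i => ({(ν i : ℤ), -(ν i : ℤ)} : Finset ℤ)).card : ℕ) : ℕ∞) : ℝ≥0∞) := by
        exact_mod_cast h3
    _ ≤ ((∏ i, 2 ^ ν i : ℕ) : ℝ≥0∞) := by
        rw [ENat.toENNReal_coe]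
        exact_mod_cast hcard
    _ = ∏ i, 2 ^ ν i := by push_cast; rfl

/-- Weights adapted to a multiindex `ν`, in the unit ball of a weighted `ℓ¹` norm. -/
theorem exists_weights {ι : Type*} [Fintype ι] {β : ι → ℝ} (hβ : ∀ i, 0 < β i) (ν : ι → ℕ) :
    ∃ t : ι → ℝ, (∀ i, 1 ≤ t i) ∧ ∑ i, β i * (t i - 1) ≤ 1 ∧
      ∏ i, (t i ^ ν i)⁻¹ ≤ Nat.multinomial Finset.univ ν * ∏ i, (Real.exp 1 * β i) ^ ν i := by
  set m := ∑ i, ν i with hm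
  rcases Nat.eq_zero_or_pos m with h0 | hpos
  · refine ⟨fun _ => 1, fun _ => le_rfl, by simp, ?_⟩
    have hν : ∀ i, ν i = 0 := fun i => (Finset.sum_eq_zero_iff.1 h0) i (Finset.mem_univ i)
    have : ν = fun _ => 0 := funext hν
    simp [this, Nat.multinomial]
  have hmR : (0 : ℝ) < m := by exact_mod_cast hpos
  -- The budget is split in proportion to `ν i`, which uses it up exactly. The estimates `ν! ≤ ν ^
  -- ν` and `m ^ m ≤ e ^ m * m!` then produce the multinomial coefficient.
  refine ⟨fun i => 1 + ν i / (m * β i), fun i => ?_, ?_, ?_⟩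
  · have := hβ i
    have : (0 : ℝ) ≤ ν i / (m * β i) := by positivity
    linarith
  · have : ∀ i, β i * (1 + ν i / (m * β i) - 1) = ν i / m := by
      intro i
      have := (hβ i).ne'
      field_simp
      ring
    rw [Finset.sum_congr rfl fun i _ => this i, ← Finset.sum_div, ← Nat.cast_sum, ← hm,
      div_self hmR.ne']
  · have hterm : ∀ i, ((1 + ν i / (m * β i)) ^ ν i)⁻¹ ≤ (m * β i) ^ ν i / (Nat.factorial (ν i)) := by
      intro i
      have hb := hβ i
      rcases Nat.eq_zero_or_pos (ν i) with h | h
      · simp [h]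
      have hνR : (0 : ℝ) < ν i := by exact_mod_cast h
      have h1 : (ν i / (m * β i)) ^ ν i ≤ (1 + ν i / (m * β i)) ^ ν i := by
        gcongr
        linarith
      have h2 : (0 : ℝ) < (ν i / (m * β i)) ^ ν i := by positivity
      refine (inv_anti₀ h2 h1).trans ?_
      rw [div_pow, inv_div]
      refine div_le_div_of_nonneg_left (by positivity) (by positivity) ?_
      exact_mod_cast (ν i).factorial_le_pow
    have hpos' : ∀ i, 0 ≤ ((1 + ν i / (m * β i)) ^ ν i)⁻¹ := fun i => by
      have := hβ i
      positivity
    refine (Finset.prod_le_prod (fun i _ => hpos' i) fun i _ => hterm i).trans ?_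
    have hspec : (∏ i, (Nat.factorial (ν i) : ℝ)) * Nat.multinomial Finset.univ ν
        = (Nat.factorial m : ℝ) := by
      have := Nat.multinomial_spec Finset.univ ν
      rw [hm]
      exact_mod_cast this
    have hfp : 0 < ∏ i, (Nat.factorial (ν i) : ℝ) :=
      Finset.prod_pos fun i _ => by exact_mod_cast Nat.factorial_pos _
    have hmm : (m : ℝ) ^ m ≤ Real.exp 1 ^ m * Nat.factorial m := by
      have h := Real.pow_div_factorial_le_exp (x := (m : ℝ)) hmR.le m
      have hf : (0 : ℝ) < Nat.factorial m := by exact_mod_cast Nat.factorial_pos m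
      rw [div_le_iff₀ hf] at h
      rwa [← Real.exp_nat_mul, mul_one]
    rw [Finset.prod_div_distrib, div_le_iff₀ hfp]
    simp only [mul_pow, Finset.prod_mul_distrib, Finset.prod_pow_eq_pow_sum]
    rw [← hm]
    have hB : 0 ≤ ∏ i, β i ^ ν i := Finset.prod_nonneg fun i _ => pow_nonneg (hβ i).le _
    calc (m : ℝ) ^ m * ∏ i, β i ^ ν i ≤ Real.exp 1 ^ m * Nat.factorial m * ∏ i, β i ^ ν i :=
          mul_le_mul_of_nonneg_right hmm hB
      _ = _ := by rw [← hspec]; ring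

theorem ENNReal.tsum_pow_natAbs_lt_top {q : ℝ≥0∞} (hq : q < 1) : ∑' n : ℤ, q ^ n.natAbs < ∞ := by
  have hle : ∑' n : ℤ, q ^ n.natAbs ≤ ∑' s : Bool × ℕ, q ^ s.2 := by
    have := ENNReal.tsum_comp_le_tsum_of_injective
      (f := fun n : ℤ => ((decide (0 ≤ n), n.natAbs) : Bool × ℕ)) (fun a b hab => ?_)
      (fun s : Bool × ℕ => q ^ s.2)
    · exact this
    · simp only [Prod.mk.injEq, decide_eq_decide] at hab
      omega
  refine hle.trans_lt ?_
  rw [ENNReal.tsum_prod', tsum_bool, ENNReal.tsum_geometric]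
  have : (1 - q)⁻¹ < ∞ := ENNReal.inv_lt_top.2 (tsub_pos_of_lt hq)
  exact ENNReal.add_lt_top.2 ⟨this, this⟩

/-- For every multiindex there are radii in a weighted `ℓ¹` ball for which the associated monomial
bounds are summable, uniformly in the number of variables. -/
theorem exists_summable_radii {b σ : ℕ → ℝ} (hb : ∀ j, 0 < b j) (hσ : ∀ j, 1 ≤ σ j)
    (hs : Summable fun j => b j * σ j) {η : ℝ} (hη : 0 < η)
    (hsum : ∀ d, ∑ j ∈ Finset.range d, b j * (σ j - 1) ≤ η / 3) :
    ∃ A : ℝ≥0∞, A < ∞ ∧ ∃ W : ∀ d, (Fin d → ℕ) → ℝ,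
      (∀ d, ∑' n : Fin d → ℤ, ENNReal.ofReal (W d fun i => (n i).natAbs) ≤ A) ∧
      ∀ d ν, ∃ ρ : Fin d → ℝ, (∀ j, 1 ≤ ρ j) ∧ ∑ j : Fin d, b j * (ρ j - 1) ≤ η ∧
        ∏ j : Fin d, (σ j / ρ j) ^ ν j ≤ W d ν := by
  classical
  have hσ0 : ∀ j, 0 < σ j := fun j => by linarith [hσ j]
  -- With `ρ = σ u` the cost splits as `b (ρ - 1) = b (σ - 1) + b σ (u - 1)`. A third of `η` goes to
  -- `σ`, a third to `u` on finitely many leading variables and a third to `u` on the tail; `β`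
  -- normalises the last share to one.
  set β : ℕ → ℝ := fun j => 3 / η * (b j * σ j) with hβdef
  have hβ : ∀ j, 0 < β j := fun j => by have := hb j; have := hσ0 j; positivity
  have hβs : Summable fun j => 2 * Real.exp 1 * β j := (hs.mul_left _).mul_left _
  -- The bound for the multinomial series needs `∑ 2 e β` below one, with `2` from the signs and `e`
  -- from the weights. This is available only for the tail; the leading `J` variables share the
  -- fixed ratio `1 + κ` and contribute at most the constant `Sq ^ J`.
  obtain ⟨J, hJ⟩ : ∃ J, ∀ s : Finset ℕ, (∀ j ∈ s, J ≤ j) →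
      ∑ j ∈ s, 2 * Real.exp 1 * β j ≤ 1 / 2 := by
    obtain ⟨s₀, hs₀⟩ := summable_iff_vanishing_norm.1 hβs (1 / 2) (by norm_num)
    refine ⟨s₀.sup id + 1, fun s hs => ?_⟩
    refine (le_abs_self _).trans (hs₀ s ?_).le
    rw [Finset.disjoint_left]
    intro j hj hj'
    have h1 := hs j hj
    have h2 : j ≤ s₀.sup id := Finset.le_sup (f := id) hj'
    omega
  set B := ∑' j, b j * σ j with hB
  have hBn : ∀ s : Finset ℕ, ∑ j ∈ s, b j * σ j ≤ B := fun s =>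
    hs.sum_le_tsum _ fun j _ => (mul_pos (hb j) (hσ0 j)).le
  have hB0 : 0 < B := hs.tsum_pos (fun j => (mul_pos (hb j) (hσ0 j)).le) 0 (mul_pos (hb 0) (hσ0 0))
  set κ := η / 3 / B with hκ
  have hκ0 : 0 < κ := by positivity
  set q := (1 + κ)⁻¹ with hq
  have hq0 : 0 < q := by positivity
  have hq1 : q < 1 := inv_lt_one_of_one_lt₀ (by linarith)
  set Sq : ℝ≥0∞ := ∑' n : ℤ, ENNReal.ofReal q ^ n.natAbs with hSq
  have hSqt : Sq < ∞ := ENNReal.tsum_pow_natAbs_lt_top (by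
    rw [← ENNReal.ofReal_one]; exact (ENNReal.ofReal_lt_ofReal_iff (by norm_num)).2 hq1)
  have hSq1 : 1 ≤ Sq := by
    have := ENNReal.le_tsum (f := fun n : ℤ => ENNReal.ofReal q ^ n.natAbs) 0
    simpa using this
  let W₁ : ∀ d, ({i : Fin d // (i : ℕ) < J} → ℕ) → ℝ := fun d ν => ∏ i, q ^ ν i
  let W₂ : ∀ d, ({i : Fin d // ¬ (i : ℕ) < J} → ℕ) → ℝ := fun d ν =>
    Nat.multinomial Finset.univ ν * ∏ i : {i : Fin d // ¬ (i : ℕ) < J},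
      (Real.exp 1 * β ((i : Fin d) : ℕ)) ^ ν i
  refine ⟨Sq ^ J * 2, ENNReal.mul_lt_top (ENNReal.pow_lt_top hSqt) (by norm_num),
    fun d ν => W₁ d (fun i => ν i) * W₂ d (fun i => ν i), fun d => ?_, fun d ν => ?_⟩
  · have hW₁0 : ∀ ν, 0 ≤ W₁ d ν := fun ν => Finset.prod_nonneg fun i _ => pow_nonneg hq0.le _
    rw [← (Equiv.piEquivPiSubtypeProd (fun i : Fin d => (i : ℕ) < J) fun _ => ℤ).symm.tsum_eq,
      ENNReal.tsum_prod']
    have h1 : ∀ (x : {i : Fin d // (i : ℕ) < J} → ℤ) (y : {i : Fin d // ¬ (i : ℕ) < J} → ℤ),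
        ENNReal.ofReal (W₁ d (fun i => ((Equiv.piEquivPiSubtypeProd (fun i : Fin d => (i : ℕ) < J)
          fun _ => ℤ).symm (x, y) i).natAbs) * W₂ d (fun i =>
          ((Equiv.piEquivPiSubtypeProd (fun i : Fin d => (i : ℕ) < J)
          fun _ => ℤ).symm (x, y) i).natAbs))
        = ENNReal.ofReal (W₁ d fun i => (x i).natAbs) * ENNReal.ofReal (W₂ d fun i => (y i).natAbs) := by
      intro x y
      have e1 : (fun i : {i : Fin d // (i : ℕ) < J} => ((Equiv.piEquivPiSubtypeProd
          (fun i : Fin d => (i : ℕ) < J) fun _ => ℤ).symm (x, y) i).natAbs)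
          = fun i => (x i).natAbs := by
        ext i
        simp [Equiv.piEquivPiSubtypeProd, i.2]
      have e2 : (fun i : {i : Fin d // ¬ (i : ℕ) < J} => ((Equiv.piEquivPiSubtypeProd
          (fun i : Fin d => (i : ℕ) < J) fun _ => ℤ).symm (x, y) i).natAbs)
          = fun i => (y i).natAbs := by
        ext i
        have := i.2
        simp [Equiv.piEquivPiSubtypeProd, i.2]
      rw [e1, e2, ENNReal.ofReal_mul (hW₁0 _)]
    simp only [h1, ENNReal.tsum_mul_left, ENNReal.tsum_mul_right]
    refine mul_le_mul' ?_ ?_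
    · have : ∀ x : {i : Fin d // (i : ℕ) < J} → ℤ, ENNReal.ofReal (W₁ d fun i => (x i).natAbs)
          = ∏ i, ENNReal.ofReal q ^ (x i).natAbs := fun x => by
        simp only [W₁]
        rw [ENNReal.ofReal_prod_of_nonneg fun i _ => pow_nonneg hq0.le _]
        exact Finset.prod_congr rfl fun i _ => ENNReal.ofReal_pow hq0.le _
      simp only [this]
      rw [ENNReal.tsum_pi_prod (fun (_ : {i : Fin d // (i : ℕ) < J}) (n : ℤ) =>
        ENNReal.ofReal q ^ n.natAbs), Finset.prod_const]
      refine pow_le_pow_right₀ hSq1 ?_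
      rw [Finset.card_univ]
      have := Fintype.card_le_of_injective
        (fun i : {i : Fin d // (i : ℕ) < J} => (⟨(i : Fin d), i.2⟩ : Fin J)) fun a b hab => by
          ext
          simpa using hab
      simpa using this
    · refine (ENNReal.tsum_comp_natAbs_le fun ν => ENNReal.ofReal (W₂ d ν)).trans ?_
      have h2 : ∀ ν : {i : Fin d // ¬ (i : ℕ) < J} → ℕ, (∏ i, 2 ^ ν i) * ENNReal.ofReal (W₂ d ν)
          = (Nat.multinomial Finset.univ ν : ℝ≥0∞)
            * ∏ i : {i : Fin d // ¬ (i : ℕ) < J},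
              ENNReal.ofReal (2 * Real.exp 1 * β ((i : Fin d) : ℕ)) ^ ν i := by
        intro ν
        simp only [W₂]
        have hpos : ∀ i : {i : Fin d // ¬ (i : ℕ) < J}, 0 ≤ Real.exp 1 * β (i : Fin d) := fun i => by
          have := hβ (i : Fin d); positivity
        rw [ENNReal.ofReal_mul (by positivity), ENNReal.ofReal_natCast,
          ENNReal.ofReal_prod_of_nonneg fun i _ => pow_nonneg (hpos i) _, mul_left_comm,
          ← Finset.prod_mul_distrib]
        congr 1
        refine Finset.prod_congr rfl fun i _ => ?_
        rw [ENNReal.ofReal_pow (hpos i), ← mul_pow, mul_assoc 2,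
          ENNReal.ofReal_mul (p := 2) (by norm_num), ENNReal.ofReal_ofNat]
      simp only [h2]
      rw [ENNReal.tsum_multinomial_mul_prod]
      have h3 : ∑ i : {i : Fin d // ¬ (i : ℕ) < J}, ENNReal.ofReal (2 * Real.exp 1 * β (i : Fin d))
          ≤ 2⁻¹ := by
        rw [← ENNReal.ofReal_sum_of_nonneg fun i _ => by have := hβ (i : Fin d); positivity]
        have h4 : ∑ i : {i : Fin d // ¬ (i : ℕ) < J}, 2 * Real.exp 1 * β (i : Fin d) ≤ 1 / 2 := by
          have h5 := hJ (Finset.univ.map ⟨fun i : {i : Fin d // ¬ (i : ℕ) < J} => ((i : Fin d) : ℕ),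
            fun a b hab => by ext; simpa using hab⟩) ?_
          · rwa [Finset.sum_map] at h5
          · intro j hj
            obtain ⟨i, _, rfl⟩ := Finset.mem_map.1 hj
            exact not_lt.1 i.2
        refine (ENNReal.ofReal_le_ofReal h4).trans (le_of_eq ?_)
        rw [one_div, ENNReal.ofReal_inv_of_pos (by norm_num)]
        simp
      rw [ENNReal.inv_le_iff_inv_le]
      calc (2 : ℝ≥0∞)⁻¹ = 1 - 2⁻¹ := ENNReal.one_sub_inv_two.symm
        _ ≤ _ := tsub_le_tsub_left h3 1
  · obtain ⟨t, ht1, htsum, htprod⟩ := exists_weights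
      (β := fun i : {i : Fin d // ¬ (i : ℕ) < J} => β (i : Fin d)) (fun i => hβ _) (fun i => ν i)
    set u : Fin d → ℝ := fun j => if h : (j : ℕ) < J then 1 + κ else t ⟨j, h⟩ with hu
    have hu1 : ∀ j, 1 ≤ u j := by
      intro j
      simp only [hu]
      split_ifs with h
      · linarith
      · exact ht1 _
    refine ⟨fun j => σ j * u j, fun j => one_le_mul_of_one_le_of_one_le (hσ j) (hu1 j), ?_, ?_⟩
    · have e1 : ∀ j : Fin d, b j * (σ j * u j - 1) = b j * (σ j - 1) + b j * σ j * (u j - 1) :=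
        fun j => by ring
      rw [Finset.sum_congr rfl fun j _ => e1 j, Finset.sum_add_distrib]
      have h1 : ∑ j : Fin d, b j * (σ j - 1) ≤ η / 3 := by
        rw [Fin.sum_univ_eq_sum_range (fun j => b j * (σ j - 1))]
        exact hsum d
      have h2 : ∑ j : Fin d, b j * σ j * (u j - 1)
          = ∑ i : {i : Fin d // (i : ℕ) < J}, b (i : Fin d) * σ (i : Fin d) * κ
            + ∑ i : {i : Fin d // ¬ (i : ℕ) < J}, b (i : Fin d) * σ (i : Fin d) * (t i - 1) := by
        rw [← Fintype.sum_subtype_add_sum_subtype (fun i : Fin d => (i : ℕ) < J)]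
        congr 1
        · refine Finset.sum_congr rfl fun i _ => ?_
          simp [hu, i.2]
        · refine Finset.sum_congr rfl fun i _ => ?_
          have := i.2
          simp [hu, i.2]
      have h3 : ∑ i : {i : Fin d // (i : ℕ) < J}, b (i : Fin d) * σ (i : Fin d) * κ ≤ η / 3 := by
        rw [← Finset.sum_mul]
        have h5 := hBn (Finset.univ.map ⟨fun i : {i : Fin d // (i : ℕ) < J} => ((i : Fin d) : ℕ),
            fun a b hab => by ext; simpa using hab⟩)
        rw [Finset.sum_map] at h5
        calc (∑ i : {i : Fin d // (i : ℕ) < J}, b (i : Fin d) * σ (i : Fin d)) * κ ≤ B * κ :=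
              mul_le_mul_of_nonneg_right h5 hκ0.le
          _ = η / 3 := by rw [hκ]; field_simp
      have h4 : ∑ i : {i : Fin d // ¬ (i : ℕ) < J}, b (i : Fin d) * σ (i : Fin d) * (t i - 1)
          ≤ η / 3 := by
        have : ∀ i : {i : Fin d // ¬ (i : ℕ) < J}, b (i : Fin d) * σ (i : Fin d) * (t i - 1)
            = η / 3 * (β (i : Fin d) * (t i - 1)) := fun i => by
          simp only [hβdef]; field_simp
        rw [Finset.sum_congr rfl fun i _ => this i, ← Finset.mul_sum]
        nlinarith
      linarith
    · have e1 : ∀ j : Fin d, (σ j / (σ j * u j)) ^ ν j = (u j ^ ν j)⁻¹ := fun j => by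
        rw [← inv_pow]
        congr 1
        have := (hσ0 j).ne'
        have : u j ≠ 0 := by linarith [hu1 j]
        field_simp
      rw [Finset.prod_congr rfl fun j _ => e1 j,
        ← Fintype.prod_subtype_mul_prod_subtype (fun i : Fin d => (i : ℕ) < J)]
      have h1 : ∏ i : {i : Fin d // (i : ℕ) < J}, (u i ^ ν i)⁻¹ = W₁ d fun i => ν i := by
        refine Finset.prod_congr rfl fun i _ => ?_
        simp [hu, i.2, hq]
      have h2 : ∏ i : {i : Fin d // ¬ (i : ℕ) < J}, (u i ^ ν i)⁻¹
          = ∏ i : {i : Fin d // ¬ (i : ℕ) < J}, (t i ^ ν i)⁻¹ := by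
        refine Finset.prod_congr rfl fun i _ => ?_
        have := i.2
        simp [hu, i.2]
      rw [h1, h2]
      exact mul_le_mul_of_nonneg_left htprod (Finset.prod_nonneg fun i _ => pow_nonneg hq0.le _)

end Sums

/-! ### Counting indices and weighted summability of coefficients. -/

section Weights

theorem summable_of_summable_rpow {b : ℕ → ℝ} {p : ℝ} (hb : ∀ j, 0 < b j) (hp0 : 0 < p)
    (hp1 : p < 1) (hs : Summable fun j => b j ^ p) : Summable b := by
  have hB : ∀ j, b j ^ p ≤ ∑' i, b i ^ p := fun j =>
    hs.le_tsum j fun i _ => Real.rpow_nonneg (hb i).le _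
  refine Summable.of_nonneg_of_le (fun j => (hb j).le) (fun j => ?_)
    (hs.mul_right ((∑' i, b i ^ p) ^ (1 / p - 1)))
  have h0 : 0 < b j ^ p := Real.rpow_pos_of_pos (hb j) _
  have h1 : b j = b j ^ p * (b j ^ p) ^ (1 / p - 1) := by
    rw [← Real.rpow_mul (hb j).le, ← Real.rpow_add (hb j)]
    have : p + p * (1 / p - 1) = 1 := by field_simp; ring
    rw [this, Real.rpow_one]
  calc b j = b j ^ p * (b j ^ p) ^ (1 / p - 1) := h1
    _ ≤ _ := by
      refine mul_le_mul_of_nonneg_left (Real.rpow_le_rpow h0.le (hB j) ?_) h0.le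
      have := one_lt_one_div hp0 hp1
      linarith

theorem gammaWeight_pos {ξ : ℕ → ℝ} (hξ : ∀ j, 0 < ξ j) (k : ℕ) (ν : Fin (k + 1) →₀ ℕ) :
    0 < gammaWeight ξ k ν :=
  mul_pos (inv_pos.2 (pow_pos (hξ k) _)) (Finset.prod_pos fun _ _ => inv_pos.2 (pow_pos (hξ _) _))

theorem gammaWeight_rpow {ξ : ℕ → ℝ} (hξ : ∀ j, 0 < ξ j) (k : ℕ) (ν : Fin (k + 1) →₀ ℕ) (s : ℝ) :
    gammaWeight ξ k ν ^ s
      = (ξ k ^ (-s)) ^ max 1 (ν (Fin.last k)) * ∏ j : Fin k, (ξ j ^ (-s)) ^ ν j.castSucc := by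
  have h : ∀ (x : ℝ) (n : ℕ), 0 < x → ((x ^ n)⁻¹) ^ s = (x ^ (-s)) ^ n := by
    intro x n hx
    rw [← Real.rpow_natCast (x ^ (-s)), ← Real.rpow_natCast x, ← Real.rpow_neg hx.le,
      ← Real.rpow_mul hx.le, ← Real.rpow_mul hx.le]
    congr 1
    ring
  rw [gammaWeight, Real.mul_rpow (inv_pos.2 (pow_pos (hξ k) _)).le
    (Finset.prod_nonneg fun j _ => (inv_pos.2 (pow_pos (hξ _) _)).le), h _ _ (hξ k),
    ← Real.finsetProd_rpow _ _ fun j _ => (inv_pos.2 (pow_pos (hξ _) _)).le]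
  congr 1
  exact Finset.prod_congr rfl fun j _ => h _ _ (hξ _)

/-- Each factor is at most `exp (x j / (1 - θ))`, so the product is bounded by the exponential of a
convergent series, whatever the number of factors. -/
theorem ENNReal.exists_prod_one_sub_inv_le {x : ℕ → ℝ} {θ : ℝ} (h0 : ∀ j, 0 ≤ x j)
    (hθ : ∀ j, x j ≤ θ) (hθ1 : θ < 1) (hs : Summable x) :
    ∃ P : ℝ≥0∞, P < ∞ ∧ ∀ k, ∏ j : Fin k, (1 - ENNReal.ofReal (x j))⁻¹ ≤ P := by
  refine ⟨ENNReal.ofReal (Real.exp (∑' j, x j / (1 - θ))), ENNReal.ofReal_lt_top, fun k => ?_⟩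
  have h1 : ∀ j, (1 - ENNReal.ofReal (x j))⁻¹ ≤ ENNReal.ofReal (Real.exp (x j / (1 - θ))) := by
    intro j
    have hx1 : 0 < 1 - x j := by linarith [hθ j]
    rw [← ENNReal.ofReal_one, ← ENNReal.ofReal_sub _ (h0 j), ← ENNReal.ofReal_inv_of_pos hx1]
    refine ENNReal.ofReal_le_ofReal ?_
    calc (1 - x j)⁻¹ = x j / (1 - x j) + 1 := by field_simp; ring
      _ ≤ x j / (1 - θ) + 1 := by
        have := div_le_div_of_nonneg_left (h0 j) (by linarith) (by linarith [hθ j] :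
          1 - θ ≤ 1 - x j)
        linarith
      _ ≤ _ := Real.add_one_le_exp _
  refine (Finset.prod_le_prod' fun (j : Fin k) _ => h1 j).trans ?_
  rw [← ENNReal.ofReal_prod_of_nonneg fun j _ => (Real.exp_pos _).le, ← Real.exp_sum]
  refine ENNReal.ofReal_le_ofReal (Real.exp_le_exp.2 ?_)
  rw [Fin.sum_univ_eq_sum_range (fun j => x j / (1 - θ))]
  exact (hs.div_const _).sum_le_tsum _ fun j _ => div_nonneg (h0 j) (by linarith)

/-- The number of indices above the threshold `ε` is `O(ε^(-p))`. -/
theorem exists_totalCard_mul_rpow_le {b ξ : ℕ → ℝ} {p α : ℝ} (hb : ∀ j, 0 < b j) (hp0 : 0 < p)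
    (hp1 : p < 1) (hs : Summable fun j => b j ^ p) (hα : 0 < α) (hξ : ∀ j, ξ j = 1 + α / b j) :
    ∃ S : ℝ≥0∞, S < ∞ ∧ ∀ ε, 0 < ε → totalCard ξ ε * ENNReal.ofReal (ε ^ p) ≤ S := by
  have hbs := summable_of_summable_rpow hb hp0 hp1 hs
  set D := ∑' j, b j with hD
  have hbD : ∀ j, b j ≤ D := fun j => hbs.le_tsum j fun i _ => (hb i).le
  have hD0 : 0 < D := (hb 0).trans_le (hbD 0)
  have hξ0 : ∀ j, 0 < ξ j := fun j => by have := hb j; rw [hξ]; positivity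
  set x : ℕ → ℝ := fun j => ξ j ^ (-p) with hx
  have hx0 : ∀ j, 0 ≤ x j := fun j => Real.rpow_nonneg (hξ0 j).le _
  set θ := (1 + α / D) ^ (-p) with hθ
  have hxθ : ∀ j, x j ≤ θ := fun j => by
    have := hb j
    refine Real.rpow_le_rpow_of_nonpos (by positivity) ?_ (by linarith)
    rw [hξ]
    have := div_le_div_of_nonneg_left hα.le (hb j) (hbD j)
    linarith
  have hθ1 : θ < 1 := Real.rpow_lt_one_of_one_lt_of_neg
    (by have : 0 < α / D := by positivity
        linarith) (by linarith)
  -- From `ξ j ≥ α / b j` the terms are at most `α ^ (-p) * b j ^ p`.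
  have hxs : Summable x := by
    refine Summable.of_nonneg_of_le hx0 (fun j => ?_) (hs.mul_left (α ^ (-p)))
    have hbj := hb j
    have h1 : x j ≤ (α / b j) ^ (-p) := by
      refine Real.rpow_le_rpow_of_nonpos (by positivity) ?_ (by linarith)
      rw [hξ]
      linarith
    refine h1.trans (le_of_eq ?_)
    rw [Real.div_rpow hα.le hbj.le, Real.rpow_neg hbj.le, div_inv_eq_mul]
  obtain ⟨P, hP, hPle⟩ := ENNReal.exists_prod_one_sub_inv_le hx0 hxθ hθ1 hxs
  set X : ℕ → ℝ≥0∞ := fun j => ENNReal.ofReal (x j) with hX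
  set Q : ℝ≥0∞ := 1 + (1 - ENNReal.ofReal θ)⁻¹ with hQ
  have hQt : Q < ∞ := by
    refine ENNReal.add_lt_top.2 ⟨by simp, ENNReal.inv_lt_top.2 (tsub_pos_of_lt ?_)⟩
    rw [← ENNReal.ofReal_one]
    exact (ENNReal.ofReal_lt_ofReal_iff (by norm_num)).2 hθ1
  have hXs : ∑' j, X j < ∞ := by
    rw [← ENNReal.ofReal_tsum_of_nonneg hx0 hxs]
    exact ENNReal.ofReal_lt_top
  -- The exponent `max 1 m` never vanishes, so the last variable always contributes a factor `X k`.
  -- Without it the sum over `k` would diverge.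
  have hlast : ∀ k, ∑' m : ℕ, X k ^ max 1 m ≤ X k * Q := by
    intro k
    have h1 : ∑' m : ℕ, X k ^ max 1 m = X k + X k * (1 - X k)⁻¹ := by
      rw [tsum_eq_zero_add' ENNReal.summable, ← ENNReal.tsum_geometric, ← ENNReal.tsum_mul_left]
      congr 1
      · simp
      · refine tsum_congr fun m => ?_
        rw [max_eq_right (by omega), pow_succ']
    rw [h1, hQ, mul_add, mul_one]
    gcongr
    exact ENNReal.ofReal_le_ofReal (hxθ k)
  have hsum : ∀ k, ∑' ν : Fin (k + 1) →₀ ℕ, ENNReal.ofReal (gammaWeight ξ k ν ^ p)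
      ≤ X k * Q * P := by
    intro k
    let F : Fin (k + 1) → ℕ → ℝ≥0∞ :=
      Fin.snoc (α := fun _ => ℕ → ℝ≥0∞) (fun (j : Fin k) m => X j ^ m) fun m => X k ^ max 1 m
    have hF : ∀ ν : Fin (k + 1) →₀ ℕ, ENNReal.ofReal (gammaWeight ξ k ν ^ p) = ∏ i, F i (ν i) := by
      intro ν
      rw [gammaWeight_rpow hξ0, ENNReal.ofReal_mul (pow_nonneg (hx0 k) _),
        ENNReal.ofReal_prod_of_nonneg fun j _ => pow_nonneg (hx0 _) _,
        ENNReal.ofReal_pow (hx0 k), Fin.prod_univ_castSucc, mul_comm]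
      simp only [F, Fin.snoc_castSucc, Fin.snoc_last]
      congr 1
      exact Finset.prod_congr rfl fun j _ => ENNReal.ofReal_pow (hx0 _) _
    rw [tsum_congr hF, ← Finsupp.equivFunOnFinite.symm.tsum_eq]
    simp only [Finsupp.equivFunOnFinite_symm_apply_apply]
    rw [ENNReal.tsum_pi_prod, Fin.prod_univ_castSucc, mul_comm]
    simp only [F, Fin.snoc_castSucc, Fin.snoc_last, ENNReal.tsum_geometric]
    exact mul_le_mul' (hlast k) (hPle k)
  -- Markov's inequality: every index that is counted has `γ ^ p ≥ ε ^ p`.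
  refine ⟨∑' k, X k * Q * P, ?_, fun ε hε => ?_⟩
  · rw [ENNReal.tsum_mul_right, ENNReal.tsum_mul_right]
    exact ENNReal.mul_lt_top (ENNReal.mul_lt_top hXs hQt) hP
  · rw [totalCard, ← ENNReal.tsum_mul_right]
    refine ENNReal.tsum_le_tsum fun k => le_trans ?_ (hsum k)
    rw [← ENNReal.tsum_set_const]
    refine le_trans (ENNReal.tsum_le_tsum fun ν => ?_) (ENNReal.tsum_comp_le_tsum_of_injective
      Subtype.val_injective fun ν => ENNReal.ofReal (gammaWeight ξ k ν ^ p))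
    exact ENNReal.ofReal_le_ofReal (Real.rpow_le_rpow hε.le ν.2 hp0.le)

/-- Shrinking the last entry of a multiindex towards zero is at most three to one. -/
theorem ENNReal.tsum_update_last_le {k : ℕ} (F : (Fin (k + 1) → ℕ) → ℝ≥0∞) :
    ∑' n : Fin (k + 1) → ℤ,
        F (Function.update (fun i => (n i).natAbs) (Fin.last k) ((n (Fin.last k)).natAbs - 1))
      ≤ 3 * ∑' n : Fin (k + 1) → ℤ, F fun i => (n i).natAbs := by
  -- `t` moves an integer one step towards zero and `s` records its sign; the pair determines the
  -- integer, whence the factor three.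
  let s : ℤ → Fin 3 := fun a => if 0 < a then 1 else if a < 0 then 2 else 0
  let t : ℤ → ℤ := fun a => if 0 < a then a - 1 else if a < 0 then a + 1 else 0
  let φ : (Fin (k + 1) → ℤ) → Fin 3 × (Fin (k + 1) → ℤ) := fun n =>
    (s (n (Fin.last k)), Function.update n (Fin.last k) (t (n (Fin.last k))))
  have hst : ∀ a b, s a = s b → t a = t b → a = b := by
    intro a b h1 h2
    simp only [s, t] at h1 h2
    split_ifs at h1 h2 <;> omega
  have hφ : Function.Injective φ := by
    intro n n' h
    have h1 : s (n (Fin.last k)) = s (n' (Fin.last k)) := congrArg Prod.fst h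
    have h2 := congrArg Prod.snd h
    ext i
    by_cases hi : i = Fin.last k
    · subst hi
      refine hst _ _ h1 ?_
      simpa [φ] using congrFun h2 (Fin.last k)
    · simpa [φ, hi] using congrFun h2 i
  have ht : ∀ a : ℤ, a.natAbs - 1 = (t a).natAbs := by
    intro a
    simp only [t]
    split_ifs <;> omega
  have := ENNReal.tsum_comp_le_tsum_of_injective hφ fun y => F fun i => (y.2 i).natAbs
  rw [ENNReal.tsum_prod'] at this
  simp only [tsum_fintype, Finset.sum_const, Finset.card_univ, Fintype.card_fin,
    nsmul_eq_mul] at this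
  refine le_trans (le_of_eq (tsum_congr fun n => ?_)) (by simpa using this)
  congr 1
  ext i
  by_cases hi : i = Fin.last k
  · subst hi
    simp [φ, ht]
  · simp [φ, hi]

/-- Coefficients which satisfy Cauchy bounds for all radii in a weighted `ℓ¹` ball are summable
against a negative power of the weights `gammaWeight`. -/
theorem exists_tsum_mul_gammaWeight_rpow_lt_top {b : ℕ → ℝ} {p η : ℝ} (hb : ∀ j, 0 < b j)
    (hp0 : 0 < p) (hp1 : p < 1) (hs : Summable fun j => b j ^ p) (hη : 0 < η) :
    ∃ α : ℝ, 0 < α ∧ ∀ ξ : ℕ → ℝ, (∀ j, ξ j = 1 + α / b j) →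
      ∀ C : ℝ, 0 ≤ C → ∀ c : ∀ k, (Fin (k + 1) → ℤ) → ℂ,
      (∀ (k) (n : Fin (k + 1) → ℤ) (ρ : Fin (k + 1) → ℝ), (∀ j, 1 ≤ ρ j) →
        ∑ j : Fin (k + 1), b j * (ρ j - 1) ≤ η →
        ‖c k n‖ ≤ C * (b k * ρ (Fin.last k)) * ∏ j, (ρ j ^ (n j).natAbs)⁻¹) →
      ∑' k, ∑' n : Fin (k + 1) → ℤ, ENNReal.ofReal (‖c k n‖ *
        gammaWeight ξ k (Finsupp.equivFunOnFinite.symm fun i => (n i).natAbs) ^ (-(1 - p))) < ∞ := by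
  have hq : 0 < 1 - p := by linarith
  have hbs := summable_of_summable_rpow hb hp0 hp1 hs
  set B := ∑' j, b j ^ p with hB
  have hB0 : 0 < B := hs.tsum_pos (fun j => Real.rpow_nonneg (hb j).le _) 0
    (Real.rpow_pos_of_pos (hb 0) _)
  -- With this value `b j * (α / b j) ^ (1 - p) = η / 3 / B * b j ^ p`, so the radii `ξ j ^ (1 - p)`
  -- spend at most `η / 3`.
  set α := (η / 3 / B) ^ (1 / (1 - p)) with hα
  have hα0 : 0 < α := Real.rpow_pos_of_pos (by positivity) _
  have hαp : α ^ (1 - p) = η / 3 / B := by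
    rw [hα, ← Real.rpow_mul (by positivity), one_div_mul_cancel hq.ne', Real.rpow_one]
  refine ⟨α, hα0, fun ξ hξ C hC c hc => ?_⟩
  have hξ1 : ∀ j, 1 ≤ ξ j := fun j => by
    have := hb j
    have : 0 < α / b j := by positivity
    rw [hξ]
    linarith
  have hξ0 : ∀ j, 0 < ξ j := fun j => by linarith [hξ1 j]
  set σ : ℕ → ℝ := fun j => ξ j ^ (1 - p) with hσdef
  have hσ : ∀ j, 1 ≤ σ j := fun j => Real.one_le_rpow (hξ1 j) hq.le
  have hσ0 : ∀ j, 0 < σ j := fun j => by linarith [hσ j]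
  have hbσ : ∀ j, b j * (σ j - 1) ≤ η / 3 / B * b j ^ p := by
    intro j
    have hbj := hb j
    have h1 : σ j ≤ 1 + (α / b j) ^ (1 - p) := by
      have := Real.rpow_add_le_add_rpow (p := 1 - p) (by norm_num : (0 : ℝ) ≤ 1)
        (by positivity : 0 ≤ α / b j) hq.le (by linarith)
      rw [Real.one_rpow] at this
      simpa [hσdef, hξ] using this
    have h2 : b j * (α / b j) ^ (1 - p) = η / 3 / B * b j ^ p := by
      rw [Real.div_rpow hα0.le hbj.le, hαp, Real.rpow_sub hbj, Real.rpow_one]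
      have := (Real.rpow_pos_of_pos hbj p).ne'
      field_simp
    rw [← h2]
    exact mul_le_mul_of_nonneg_left (by linarith) hbj.le
  have hσs : Summable fun j => b j * σ j := by
    refine Summable.of_nonneg_of_le (fun j => (mul_pos (hb j) (hσ0 j)).le) (fun j => ?_)
      (hbs.add (hs.mul_left (η / 3 / B)))
    have := hbσ j
    linarith
  have hσsum : ∀ d, ∑ j ∈ Finset.range d, b j * (σ j - 1) ≤ η / 3 := by
    intro d
    refine (Finset.sum_le_sum fun j _ => hbσ j).trans ?_
    rw [← Finset.mul_sum]
    calc η / 3 / B * ∑ j ∈ Finset.range d, b j ^ p ≤ η / 3 / B * B :=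
          mul_le_mul_of_nonneg_left
            (hs.sum_le_tsum _ fun j _ => Real.rpow_nonneg (hb j).le _) (by positivity)
      _ = η / 3 := by field_simp
  obtain ⟨A, hA, W, hWsum, hW⟩ := exists_summable_radii hb hσ hσs hη hσsum
  -- The coefficient bound carries an extra `ρ` in the last variable, which lowers the usable
  -- exponent there to `|n_k| - 1`. One factor `σ k` from the weight is set aside; with `b k` it is
  -- summable over `k`.
  have hterm : ∀ k (n : Fin (k + 1) → ℤ), ‖c k n‖ *
      gammaWeight ξ k (Finsupp.equivFunOnFinite.symm fun i => (n i).natAbs) ^ (-(1 - p))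
      ≤ C * (b k * σ k) * W (k + 1) (Function.update (fun i => (n i).natAbs) (Fin.last k)
        ((n (Fin.last k)).natAbs - 1)) := by
    intro k n
    set ν' : Fin (k + 1) → ℕ := Function.update (fun i => (n i).natAbs) (Fin.last k)
        ((n (Fin.last k)).natAbs - 1) with hν'
    obtain ⟨ρ, hρ1, hρη, hρW⟩ := hW (k + 1) ν'
    have hρ0 : ∀ j, 0 < ρ j := fun j => by linarith [hρ1 j]
    have hbk := hb k
    have hσk := hσ0 k
    rw [gammaWeight_rpow hξ0]
    simp only [neg_neg, Finsupp.coe_equivFunOnFinite_symm]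
    refine le_trans ?_ (mul_le_mul_of_nonneg_left hρW (by positivity))
    have hg0 : 0 ≤ (ξ k ^ (1 - p)) ^ max 1 (n (Fin.last k)).natAbs
        * ∏ j : Fin k, (ξ j ^ (1 - p)) ^ (n j.castSucc).natAbs :=
      mul_nonneg (pow_nonneg (hσ0 k).le _) (Finset.prod_nonneg fun j _ => pow_nonneg (hσ0 _).le _)
    have hprod : ∏ j : Fin (k + 1), (σ j / ρ j) ^ ν' j
        = (∏ j : Fin k, (ρ j.castSucc ^ (n j.castSucc).natAbs)⁻¹)
          * (∏ j : Fin k, (ξ j ^ (1 - p)) ^ (n j.castSucc).natAbs)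
          * (σ k / ρ (Fin.last k)) ^ ((n (Fin.last k)).natAbs - 1) := by
      rw [Fin.prod_univ_castSucc, ← Finset.prod_mul_distrib]
      congr 1
      · refine Finset.prod_congr rfl fun j _ => ?_
        have : ν' j.castSucc = (n j.castSucc).natAbs := by
          simp [hν', (Fin.castSucc_lt_last j).ne]
        rw [this, div_pow, div_eq_inv_mul]
        rfl
      · simp [hν']
    rw [hprod]
    set R := ∏ j : Fin k, (ρ j.castSucc ^ (n j.castSucc).natAbs)⁻¹ with hR
    set E := ∏ j : Fin k, (ξ j ^ (1 - p)) ^ (n j.castSucc).natAbs with hE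
    -- If the last exponent is zero, no decay is available to cancel the extra `ρ`, so the last
    -- radius is reset to `1`, which only lowers the cost. Otherwise one of the powers cancels it.
    by_cases h0 : n (Fin.last k) = 0
    · have h1 := hc k n (Function.update ρ (Fin.last k) 1) (fun j => ?_) ?_
      · have h2 : ∏ j, (Function.update ρ (Fin.last k) 1 j ^ (n j).natAbs)⁻¹ = R := by
          rw [Fin.prod_univ_castSucc]
          simp [hR, h0, (Fin.castSucc_lt_last _).ne]
        rw [h2, Function.update_self, mul_one] at h1
        refine (mul_le_mul_of_nonneg_right h1 hg0).trans (le_of_eq ?_)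
        simp only [h0, Int.natAbs_zero, zero_le, sup_of_le_left, zero_tsub, pow_zero, pow_one]
        change C * b k * R * (σ k * E) = _
        ring
      · by_cases hj : j = Fin.last k
        · subst hj; simp
        · simpa [hj] using hρ1 j
      · refine le_trans (Finset.sum_le_sum fun j _ => ?_) hρη
        refine mul_le_mul_of_nonneg_left ?_ (hb j).le
        by_cases hj : j = Fin.last k
        · subst hj
          simp [hρ1]
        · simp [hj]
    · obtain ⟨m, hm⟩ : ∃ m, (n (Fin.last k)).natAbs = m + 1 :=
        ⟨(n (Fin.last k)).natAbs - 1, by omega⟩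
      have h1 := hc k n ρ hρ1 hρη
      rw [Fin.prod_univ_castSucc] at h1
      refine (mul_le_mul_of_nonneg_right h1 hg0).trans (le_of_eq ?_)
      rw [hm, max_eq_right (by omega), Nat.add_sub_cancel]
      change C * (b k * ρ (Fin.last k)) * (R * (ρ (Fin.last k) ^ (m + 1))⁻¹)
        * (σ k ^ (m + 1) * E) = _
      have := (hρ0 (Fin.last k)).ne'
      rw [div_pow]
      field_simp
      ring
  have hk : ∀ k, ∑' n : Fin (k + 1) → ℤ, ENNReal.ofReal (‖c k n‖ *
      gammaWeight ξ k (Finsupp.equivFunOnFinite.symm fun i => (n i).natAbs) ^ (-(1 - p)))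
      ≤ ENNReal.ofReal (b k * σ k) * (ENNReal.ofReal C * (3 * A)) := by
    intro k
    refine (ENNReal.tsum_le_tsum fun n => ENNReal.ofReal_le_ofReal (hterm k n)).trans ?_
    have hbk := hb k
    have hσk := hσ0 k
    simp only [ENNReal.ofReal_mul (show 0 ≤ C * (b k * σ k) by positivity), ENNReal.ofReal_mul hC]
    rw [ENNReal.tsum_mul_left, mul_comm (ENNReal.ofReal C), mul_assoc]
    gcongr
    refine (ENNReal.tsum_update_last_le fun ν => ENNReal.ofReal (W (k + 1) ν)).trans ?_
    gcongr
    exact hWsum _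
  refine (ENNReal.tsum_le_tsum hk).trans_lt ?_
  rw [ENNReal.tsum_mul_right, ← ENNReal.ofReal_tsum_of_nonneg
    (fun j => (mul_pos (hb j) (hσ0 j)).le) hσs]
  exact ENNReal.mul_lt_top ENNReal.ofReal_lt_top
    (ENNReal.mul_lt_top ENNReal.ofReal_lt_top (ENNReal.mul_lt_top (by norm_num) hA))

end Weights

/-! ### Truncated Chebyshev expansions. -/

section Polynomials

theorem MvPolynomial.degreeOf_aeval_X_le {ι : Type*} [DecidableEq ι] (P : Polynomial ℝ) (i j : ι) :
    MvPolynomial.degreeOf i (Polynomial.aeval (MvPolynomial.X j : MvPolynomial ι ℝ) P)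
      ≤ if i = j then P.natDegree else 0 := by
  rw [Polynomial.aeval_eq_sum_range]
  refine (MvPolynomial.degreeOf_sum_le _ _ _).trans (Finset.sup_le fun m hm => ?_)
  rw [MvPolynomial.smul_eq_C_mul]
  refine (MvPolynomial.degreeOf_C_mul_le _ _ _).trans ?_
  refine (MvPolynomial.degreeOf_pow_le _ _ _).trans ?_
  rw [MvPolynomial.degreeOf_X]
  split_ifs with h
  · rw [Finset.mem_range] at hm
    omega
  · simp

/-- The tensor product of Chebyshev polynomials. -/
noncomputable def chebyshevProd {ι : Type*} [Fintype ι] (n : ι → ℤ) : MvPolynomial ι ℝ :=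
  ∏ j, Polynomial.aeval (MvPolynomial.X j) (Polynomial.Chebyshev.T ℝ (n j))

theorem degreeOf_chebyshevProd_le {ι : Type*} [Fintype ι] (n : ι → ℤ) (i : ι) :
    MvPolynomial.degreeOf i (chebyshevProd n) ≤ (n i).natAbs := by
  classical
  refine (MvPolynomial.degreeOf_prod_le _ _ _).trans ?_
  refine (Finset.sum_le_sum fun j _ => MvPolynomial.degreeOf_aeval_X_le _ i j).trans ?_
  simp

theorem eval_chebyshevProd {ι : Type*} [Fintype ι] (n : ι → ℤ) (φ : ι → ℝ) :
    MvPolynomial.eval (fun j => Real.cos (φ j)) (chebyshevProd n)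
      = ∏ j, Real.cos (n j * φ j) := by
  rw [chebyshevProd, map_prod]
  refine Finset.prod_congr rfl fun j _ => ?_
  rw [← MvPolynomial.coe_aeval_eq_eval, RingHom.coe_coe, ← Polynomial.aeval_algHom_apply, MvPolynomial.aeval_X,
    Polynomial.coe_aeval_eq_eval, Polynomial.Chebyshev.T_real_cos]

theorem gammaWeight_anti {ξ : ℕ → ℝ} (hξ : ∀ j, 1 ≤ ξ j) {k : ℕ} {ν ν' : Fin (k + 1) →₀ ℕ}
    (h : ν ≤ ν') : gammaWeight ξ k ν' ≤ gammaWeight ξ k ν := by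
  have h0 : ∀ j, 0 < ξ j := fun j => by linarith [hξ j]
  refine mul_le_mul ?_ (Finset.prod_le_prod (fun j _ => (inv_pos.2 (pow_pos (h0 _) _)).le)
    fun j _ => ?_) (Finset.prod_nonneg fun j _ => (inv_pos.2 (pow_pos (h0 _) _)).le)
    (inv_pos.2 (pow_pos (h0 _) _)).le
  · exact inv_anti₀ (pow_pos (h0 _) _) (pow_le_pow_right₀ (hξ _) (max_le_max le_rfl (h _)))
  · exact inv_anti₀ (pow_pos (h0 _) _) (pow_le_pow_right₀ (hξ _) (h _))

theorem gammaWeight_le_one {ξ : ℕ → ℝ} (hξ : ∀ j, 1 ≤ ξ j) (k : ℕ) (ν : Fin (k + 1) →₀ ℕ) :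
    gammaWeight ξ k ν ≤ 1 :=
  mul_le_one₀ (inv_le_one_of_one_le₀ (one_le_pow₀ (hξ _)))
    (Finset.prod_nonneg fun j _ => inv_nonneg.2 (pow_nonneg (by linarith [hξ j]) _))
    (Finset.prod_le_one (fun j _ => inv_nonneg.2 (pow_nonneg (by linarith [hξ j]) _))
      fun j _ => inv_le_one_of_one_le₀ (one_le_pow₀ (hξ _)))

/-- As `ξ ≥ 1`, the index set is downward closed, and the monomials of a tensor Chebyshev polynomial
have exponents at most `|n|`. Truncating in the Chebyshev basis thus stays in the prescribed span of
monomials. -/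
theorem chebyshevProd_mem_restrictSupport {ξ : ℕ → ℝ} (hξ : ∀ j, 1 ≤ ξ j) {ε : ℝ} {k : ℕ}
    {n : Fin (k + 1) → ℤ}
    (hn : (Finsupp.equivFunOnFinite.symm fun i => (n i).natAbs) ∈ indexSet ξ ε k) :
    chebyshevProd n ∈ MvPolynomial.restrictSupport ℝ (indexSet ξ ε k) := by
  rw [MvPolynomial.mem_restrictSupport_iff]
  intro ν hν
  refine le_trans (show ε ≤ _ from hn) (gammaWeight_anti hξ fun i => ?_)
  exact (MvPolynomial.monomial_le_degreeOf i hν).trans (degreeOf_chebyshevProd_le n i)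

theorem norm_coeff_le_mul_rpow {x γ s : ℝ} (hx : 0 ≤ x) (h0 : 0 < γ) (h1 : γ ≤ 1) (hs : 0 ≤ s) :
    x ≤ x * γ ^ (-s) :=
  le_mul_of_one_le_right hx (Real.one_le_rpow_of_pos_of_le_one_of_nonpos h0 h1 (by linarith))

/-- Truncating the Chebyshev expansion of a function whose coefficients are summable against a
negative power of the weights. -/
theorem exists_polynomial_approx {ξ : ℕ → ℝ} (hξ : ∀ j, 1 ≤ ξ j) {k : ℕ} {ε s : ℝ} (hε : 0 < ε)
    (hs : 0 ≤ s) (hfin : (indexSet ξ ε k).Finite) {g : (Fin (k + 1) → ℂ) → ℂ}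
    (hc : Continuous fun θ : UnitAddTorus (Fin (k + 1)) => g (torusCos θ))
    (hw : ∑' n : Fin (k + 1) → ℤ, ENNReal.ofReal
      (‖mFourierCoeff (fun θ : UnitAddTorus (Fin (k + 1)) => g (torusCos θ)) n‖ *
        gammaWeight ξ k (Finsupp.equivFunOnFinite.symm fun i => (n i).natAbs) ^ (-s)) < ∞) :
    ∃ q ∈ MvPolynomial.restrictSupport ℝ (indexSet ξ ε k),
      ∀ x : Fin (k + 1) → ℝ, (∀ j, x j ∈ Icc (-1 : ℝ) 1) →
        |(g fun j => (x j : ℂ)).re - MvPolynomial.eval x q| ≤ ε ^ s *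
          (∑' n : Fin (k + 1) → ℤ, ENNReal.ofReal
            (‖mFourierCoeff (fun θ : UnitAddTorus (Fin (k + 1)) => g (torusCos θ)) n‖ *
              gammaWeight ξ k (Finsupp.equivFunOnFinite.symm fun i => (n i).natAbs) ^ (-s))).toReal := by
  classical
  set c := mFourierCoeff (fun θ : UnitAddTorus (Fin (k + 1)) => g (torusCos θ)) with hcdef
  set γ : (Fin (k + 1) → ℤ) → ℝ := fun n =>
    gammaWeight ξ k (Finsupp.equivFunOnFinite.symm fun i => (n i).natAbs) with hγ
  have hξ0 : ∀ j, 0 < ξ j := fun j => by linarith [hξ j]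
  have hγ0 : ∀ n, 0 < γ n := fun n => gammaWeight_pos hξ0 k _
  have hγ1 : ∀ n, γ n ≤ 1 := fun n => gammaWeight_le_one hξ k _
  have hw0 : ∀ n, 0 ≤ ‖c n‖ * γ n ^ (-s) := fun n =>
    mul_nonneg (norm_nonneg _) (Real.rpow_nonneg (hγ0 n).le _)
  have hws : Summable fun n => ‖c n‖ * γ n ^ (-s) := by
    have := ENNReal.summable_toReal hw.ne
    refine this.congr fun n => ENNReal.toReal_ofReal (hw0 n)
  have hwt : (∑' n : Fin (k + 1) → ℤ, ENNReal.ofReal (‖c n‖ * γ n ^ (-s))).toReal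
      = ∑' n, ‖c n‖ * γ n ^ (-s) := by
    rw [← ENNReal.ofReal_tsum_of_nonneg hw0 hws, ENNReal.toReal_ofReal (tsum_nonneg hw0)]
  have hcs : Summable c := Summable.of_norm_bounded hws fun n =>
    norm_coeff_le_mul_rpow (norm_nonneg _) (hγ0 n) (hγ1 n) hs
  have hsf : {n : Fin (k + 1) → ℤ | ε ≤ γ n}.Finite := by
    refine Set.Finite.preimage' (f := fun n : Fin (k + 1) → ℤ =>
      Finsupp.equivFunOnFinite.symm fun i => (n i).natAbs) hfin fun ν _ => ?_
    refine (Set.finite_Icc (fun i => -(ν i : ℤ)) (fun i => (ν i : ℤ))).subset fun n hn => ?_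
    have h : ∀ i, (n i).natAbs = ν i := fun i => by
      have : (Finsupp.equivFunOnFinite.symm fun i => (n i).natAbs) = ν := hn
      rw [← this]
      rfl
    exact ⟨fun i => by have := h i; simp only; omega, fun i => by have := h i; simp only; omega⟩
  set t := hsf.toFinset with ht
  have htm : ∀ n, n ∈ t ↔ ε ≤ γ n := fun n => hsf.mem_toFinset
  rw [hwt]
  refine ⟨∑ n ∈ t, (c n).re • chebyshevProd n, ?_, fun x hx => ?_⟩
  · exact Submodule.sum_mem _ fun n hn => Submodule.smul_mem _ _
      (chebyshevProd_mem_restrictSupport hξ ((htm n).1 hn))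
  · set φ : Fin (k + 1) → ℝ := fun j => Real.arccos (x j) with hφ
    have hφx : ∀ j, Real.cos (φ j) = x j := fun j => Real.cos_arccos (hx j).1 (hx j).2
    set a : (Fin (k + 1) → ℤ) → ℝ := fun n => (c n).re * ∏ j, Real.cos (n j * φ j) with ha
    have h1 : HasSum a (g fun j => (x j : ℂ)).re := by
      have := Complex.hasSum_re (hasSum_mFourierCoeff_mul_prod_cos hc hcs φ)
      simp only [hφx] at this
      refine this.congr_fun fun n => ?_
      rw [ha, ← Complex.ofReal_prod, Complex.re_mul_ofReal]
    have h2 : HasSum (fun n => if n ∈ t then a n else 0)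
        (MvPolynomial.eval x (∑ n ∈ t, (c n).re • chebyshevProd n)) := by
      have e : MvPolynomial.eval x (∑ n ∈ t, (c n).re • chebyshevProd n) = ∑ n ∈ t, a n := by
        rw [map_sum]
        refine Finset.sum_congr rfl fun n _ => ?_
        rw [MvPolynomial.smul_eval, ha]
        have := eval_chebyshevProd n φ
        simp only [hφx] at this
        rw [this]
      rw [e, ← Finset.sum_congr rfl fun n (hn : n ∈ t) => if_pos hn]
      exact hasSum_sum_of_ne_finset_zero fun n hn => if_neg hn
    have h3 := (h1.sub h2).norm_le_of_bounded (hws.hasSum.mul_left (ε ^ s)) fun n => ?_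
    · exact h3
    · have h4 : 0 ≤ ε ^ s * (‖c n‖ * γ n ^ (-s)) :=
        mul_nonneg (Real.rpow_nonneg hε.le _) (hw0 n)
      split_ifs with hn
      · simpa using h4
      · rw [sub_zero, ha]
        rw [htm, not_le] at hn
        have h5 : ‖(c n).re * ∏ j, Real.cos (n j * φ j)‖ ≤ ‖c n‖ := by
          rw [norm_mul, norm_prod]
          refine (mul_le_of_le_one_right (norm_nonneg _) (Finset.prod_le_one
            (fun _ _ => norm_nonneg _) fun j _ => Real.abs_cos_le_one _)).trans ?_
          exact Complex.abs_re_le_norm _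
        refine h5.trans ?_
        -- For an omitted index `ε / γ > 1`. Inserting the factor `(ε / γ) ^ s` bounds the tail by
        -- `ε ^ s` times the weighted sum.
        have h6 : 1 ≤ ε ^ s * γ n ^ (-s) := by
          rw [Real.rpow_neg (hγ0 n).le, ← div_eq_mul_inv,
            one_le_div (Real.rpow_pos_of_pos (hγ0 n) _)]
          exact Real.rpow_le_rpow (hγ0 n).le hn.le hs
        calc ‖c n‖ ≤ ‖c n‖ * (ε ^ s * γ n ^ (-s)) := le_mul_of_one_le_right (norm_nonneg _) h6
          _ = _ := by ring

/-- The extension of a finite sequence by zero. -/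
def extendZero {d : ℕ} (z : Fin d → ℂ) : ℕ → ℂ := fun j => if h : j < d then z ⟨j, h⟩ else 0

theorem extendZero_coe {d : ℕ} (z : Fin d → ℂ) (j : Fin d) : extendZero z j = z j := by
  simp [extendZero]

theorem exists_cube_near {b : ℕ → ℝ} {η : ℝ} {d : ℕ} (hb : ∀ j, 0 ≤ b j) {ρ : Fin d → ℝ}
    (hρ : ∑ j : Fin d, b j * (ρ j - 1) ≤ η) {z : Fin d → ℂ} (hz : z ∈ polyNbhd ρ) :
    ∃ x ∈ cube, ∑ j ∈ Finset.range d, b j * ‖extendZero z j - (x j : ℂ)‖ ≤ η ∧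
      ∀ j : Fin d, ‖z j - x j‖ ≤ ρ j - 1 := by
  choose x hx hxz using hz
  have hxe : ∀ j : Fin d, (fun j => if h : j < d then x ⟨j, h⟩ else 0 : ℕ → ℝ) j = x j := fun j => by
    simp
  refine ⟨fun j => if h : j < d then x ⟨j, h⟩ else 0, fun j _ => ?_, ?_, fun j => ?_⟩
  · simp only
    split_ifs with h
    · exact hx _
    · norm_num
  · rw [← Fin.sum_univ_eq_sum_range (fun j => b j * ‖extendZero z j
      - (((fun j => if h : j < d then x ⟨j, h⟩ else 0 : ℕ → ℝ) j : ℝ) : ℂ)‖)]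
    refine le_trans (Finset.sum_le_sum fun j _ => ?_) hρ
    rw [hxe, extendZero_coe]
    exact mul_le_mul_of_nonneg_left (hxz j) (hb _)
  · rw [hxe]
    exact hxz j

theorem continuous_extendZero (d : ℕ) : Continuous (extendZero : (Fin d → ℂ) → ℕ → ℂ) := by
  refine continuous_pi fun j => ?_
  by_cases h : j < d
  · simpa [extendZero, h] using continuous_apply (⟨j, h⟩ : Fin d)
  · simpa [extendZero, h] using continuous_const

variable {fρ fπ : (ℕ → ℝ) → ℝ} {b : ℕ → ℝ} {η C c₀ : ℝ} {G : ℕ → (ℕ → ℂ) → ℂ}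

/-- The product neighbourhood of radii `ρ j - 1` lies in the domain of `G k` by the constraint on
`ρ`. There `1 + |z_k - x_k| ≤ ρ_k`, which is where the extra factor of the last radius comes from.
-/
theorem IsRootExtension.norm_coeff_le (hG : IsRootExtension fρ fπ b η C c₀ G) (hb : ∀ j, 0 < b j)
    (hC : 0 < C) (k : ℕ) (n : Fin (k + 1) → ℤ) {ρ : Fin (k + 1) → ℝ} (hρ : ∀ j, 1 ≤ ρ j)
    (hρη : ∑ j : Fin (k + 1), b j * (ρ j - 1) ≤ η) :
    ‖mFourierCoeff (fun θ : UnitAddTorus (Fin (k + 1)) => G k (extendZero (torusCos θ))) n‖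
      ≤ C * (b k * ρ (Fin.last k)) * ∏ j, (ρ j ^ (n j).natAbs)⁻¹ := by
  have hmem : ∀ z ∈ polyNbhd ρ, extendZero z ∈ nearCube b η (k + 1) := fun z hz => by
    obtain ⟨x, hx, hxz, _⟩ := exists_cube_near (fun j => (hb j).le) hρη hz
    exact ⟨x, hx, hxz⟩
  refine norm_mFourierCoeff_le (g := fun z => G k (extendZero z)) hρ ?_ ?_ ?_ n
  · exact (hG.continuousOn k).comp (continuous_extendZero _).continuousOn hmem
  · intro Ω hΩ z hz hzm
    refine hG.holomorphic k Ω hΩ (fun τ => extendZero (z τ)) (fun j hj => ?_) fun τ hτ =>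
      hmem _ (hzm τ hτ)
    refine (hz ⟨j, by omega⟩).congr fun τ _ => ?_
    simp [extendZero, show j < k + 1 by omega]
  · intro z hz
    obtain ⟨x, hx, hxz, hxρ⟩ := exists_cube_near (fun j => (hb j).le) hρη hz
    refine (hG.bound k _ x hx hxz).trans ?_
    have h1 := hxρ (Fin.last k)
    have h2 : extendZero z k = z (Fin.last k) := extendZero_coe z (Fin.last k)
    rw [h2]
    have h3 : ((Fin.last k : Fin (k + 1)) : ℕ) = k := Fin.val_last k
    rw [h3] at h1
    exact mul_le_mul_of_nonneg_left (mul_le_mul_of_nonneg_left (by linarith) (hb k).le) hC.le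

theorem IsRootExtension.continuous_torusCos (hG : IsRootExtension fρ fπ b η C c₀ G)
    (hb : ∀ j, 0 < b j) (hη : 0 < η) (k : ℕ) :
    Continuous fun θ : UnitAddTorus (Fin (k + 1)) => G k (extendZero (torusCos θ)) := by
  refine (hG.continuousOn k).comp_continuous ((continuous_extendZero _).comp ?_) fun θ => ?_
  · simpa only [torusCurve_zero] using continuous_torusCurve (ι := Fin (k + 1)) (fun _ => 0) 0
  · have h : torusCos θ ∈ polyNbhd fun _ : Fin (k + 1) => (1 : ℝ) := by
      rw [← torusCurve_zero fun _ => 0]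
      exact torusCurve_mem_polyNbhd (fun _ => le_rfl) (by simp) θ (by simp)
    obtain ⟨x, hx, hxz, _⟩ := exists_cube_near (η := η) (fun j => (hb j).le) (by simpa using hη.le) h
    exact ⟨x, hx, hxz⟩

end Polynomials

/-! ### Rational triangular maps and their stability. -/

section Triangular

/-- A triangular map which, in its last variable, increases continuously from `-1` to `1` is a
bijection of the cube. -/
theorem isMonotoneTriangularBijection_of_continuousOn {T : ℕ → (ℕ → ℝ) → ℝ}
    (htri : ∀ k, ∀ x ∈ cube, ∀ y ∈ cube, (∀ j ≤ k, x j = y j) → T k x = T k y)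
    (hmono : ∀ k, ∀ x ∈ cube,
      StrictMonoOn (fun t => T k (Function.update x k t)) (Icc (-1 : ℝ) 1))
    (hcont : ∀ k, ∀ x ∈ cube,
      ContinuousOn (fun t => T k (Function.update x k t)) (Icc (-1 : ℝ) 1))
    (hneg : ∀ k, ∀ x ∈ cube, T k (Function.update x k (-1)) = -1)
    (hone : ∀ k, ∀ x ∈ cube, T k (Function.update x k 1) = 1) :
    IsMonotoneTriangularBijection T := by
  have hm1 : (-1 : ℝ) ∈ Icc (-1 : ℝ) 1 := by norm_num
  have h1 : (1 : ℝ) ∈ Icc (-1 : ℝ) 1 := by norm_num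
  refine ⟨htri, hmono, fun x hx k _ => ?_, fun x hx y hy hxy => ?_, fun y hy => ?_⟩
  · have hxk := hx k (mem_univ k)
    have hm := (hmono k x hx).monotoneOn
    have a := hm hm1 hxk hxk.1
    have c := hm hxk h1 hxk.2
    simp only [hneg k x hx, hone k x hx, Function.update_eq_self] at a c
    exact ⟨a, c⟩
  · ext k
    induction k using Nat.strong_induction_on with
    | _ k ih =>
      refine (hmono k x hx).injOn (hx k (mem_univ k)) (hy k (mem_univ k)) ?_
      have h := congrFun hxy k
      simp only [Function.update_eq_self] at h ⊢
      rw [h]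
      refine htri k y hy _ (update_mem_cube hx k (hy k (mem_univ k))) fun j hj => ?_
      rcases hj.lt_or_eq with hj | rfl
      · rw [Function.update_of_ne hj.ne, ih j hj]
      · rw [Function.update_self]
  · have hex : ∀ k, ∀ z ∈ cube, ∃ t ∈ Icc (-1 : ℝ) 1, T k (Function.update z k t) = y k := by
      intro k z hz
      have := intermediate_value_Icc (by norm_num : (-1 : ℝ) ≤ 1) (hcont k z hz)
      simp only [hneg k z hz, hone k z hz] at this
      obtain ⟨t, ht, hty⟩ := this (hy k (mem_univ k))
      exact ⟨t, ht, hty⟩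
    choose! τ hτ hτy using hex
    -- The preimage is built entry by entry. Step `m` changes only entry `m`, so the sequences
    -- stabilise and their diagonal is the preimage.
    let z : ℕ → ℕ → ℝ := fun m => Nat.rec (fun _ => 0) (fun k w => Function.update w k (τ k w)) m
    have hz : ∀ m, z (m + 1) = Function.update (z m) m (τ m (z m)) := fun m => rfl
    have hzc : ∀ m, z m ∈ cube := by
      intro m
      induction m with
      | zero => exact fun j _ => by norm_num [z]
      | succ m ih => rw [hz]; exact update_mem_cube ih m (hτ m _ ih)
    have hzj : ∀ j m, j + 1 ≤ m → z m j = z (j + 1) j := by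
      intro j m hm
      induction m, hm using Nat.le_induction with
      | base => rfl
      | succ m hm ih => rw [hz m, Function.update_of_ne (by omega), ih]
    have hxc : (fun j => z (j + 1) j) ∈ cube := fun j _ => hzc (j + 1) j (mem_univ j)
    refine ⟨fun j => z (j + 1) j, hxc, funext fun k => ?_⟩
    simp only
    rw [htri k _ hxc (z (k + 1)) (hzc (k + 1)) fun j hj => (hzj j (k + 1) (by omega)).symm, hz]
    exact hτy k _ (hzc k)

theorem continuous_evalAt {k : ℕ} (q : MvPolynomial (Fin (k + 1)) ℝ) (x : ℕ → ℝ) :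
    Continuous fun t => evalAt q x t := by
  refine (MvPolynomial.continuous_eval q).comp (continuous_pi fun i => ?_)
  exact (continuous_apply (i : ℕ)).comp
    ((continuous_const (y := x)).update k (continuous_id (X := ℝ)))

theorem evalAt_congr {k : ℕ} (q : MvPolynomial (Fin (k + 1)) ℝ) {x y : ℕ → ℝ}
    (h : ∀ j < k, x j = y j) (t : ℝ) : evalAt q x t = evalAt q y t := by
  unfold evalAt
  congr 2
  ext i
  by_cases hi : (i : ℕ) = k
  · simp [hi]
  · rw [Function.update_of_ne hi, Function.update_of_ne hi]
    exact h i (by omega)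

theorem evalAt_update {k : ℕ} (q : MvPolynomial (Fin (k + 1)) ℝ) (x : ℕ → ℝ) (s t : ℝ) :
    evalAt q (Function.update x k s) t = evalAt q x t :=
  evalAt_congr q (fun _ hj => Function.update_of_ne hj.ne _ _) t

theorem rationalComponent_update {k : ℕ} (q : MvPolynomial (Fin (k + 1)) ℝ) (x : ℕ → ℝ) (s : ℝ) :
    rationalComponent q (Function.update x k s)
      = -1 + 2 / (∫ t in (-1 : ℝ)..1, (1 + evalAt q x t) ^ 2) *
        ∫ t in (-1 : ℝ)..s, (1 + evalAt q x t) ^ 2 := by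
  simp only [rationalComponent, evalAt_update, Function.update_self]

theorem hasDerivAt_rationalComponent {k : ℕ} (q : MvPolynomial (Fin (k + 1)) ℝ) (x : ℕ → ℝ)
    (s : ℝ) :
    HasDerivAt (fun t => rationalComponent q (Function.update x k t))
      (2 / (∫ t in (-1 : ℝ)..1, (1 + evalAt q x t) ^ 2) * (1 + evalAt q x s) ^ 2) s := by
  have hc : Continuous fun t => (1 + evalAt q x t) ^ 2 :=
    (continuous_const.add (continuous_evalAt q x)).pow 2
  simp only [rationalComponent_update]
  exact ((intervalIntegral.integral_hasDerivAt_right (hc.intervalIntegrable _ _)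
    (hc.stronglyMeasurableAtFilter _ _) hc.continuousAt).const_mul _).const_add _

theorem integral_one_add_evalAt_sq_ge {k : ℕ} {q : MvPolynomial (Fin (k + 1)) ℝ} {x : ℕ → ℝ}
    {c : ℝ} (hc : 0 ≤ c) (hq : ∀ t ∈ Icc (-1 : ℝ) 1, c ≤ 1 + evalAt q x t) :
    2 * c ^ 2 ≤ ∫ t in (-1 : ℝ)..1, (1 + evalAt q x t) ^ 2 := by
  have hcont : Continuous fun t => (1 + evalAt q x t) ^ 2 :=
    (continuous_const.add (continuous_evalAt q x)).pow 2
  have h := intervalIntegral.integral_mono_on (by norm_num : (-1 : ℝ) ≤ 1)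
    (f := fun _ => c ^ 2) (μ := volume) (continuous_const.intervalIntegrable _ _) (hcont.intervalIntegrable _ _)
    fun t ht => pow_le_pow_left₀ hc (hq t ht) 2
  rw [intervalIntegral.integral_const, smul_eq_mul] at h
  linarith

theorem isMonotoneTriangularBijection_rationalComponent
    {q : (k : ℕ) → MvPolynomial (Fin (k + 1)) ℝ} {c : ℝ} (hc : 0 < c)
    (hq : ∀ k, ∀ x ∈ cube, ∀ t ∈ Icc (-1 : ℝ) 1, c ≤ 1 + evalAt (q k) x t) :
    IsMonotoneTriangularBijection fun k => rationalComponent (q k) := by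
  have hI : ∀ k, ∀ x ∈ cube, 0 < ∫ t in (-1 : ℝ)..1, (1 + evalAt (q k) x t) ^ 2 := fun k x hx =>
    lt_of_lt_of_le (by positivity) (integral_one_add_evalAt_sq_ge hc.le (hq k x hx))
  refine isMonotoneTriangularBijection_of_continuousOn (fun k x _ y _ hxy => ?_)
    (fun k x hx => ?_) (fun k x _ t _ => ?_) (fun k x _ => ?_) fun k x hx => ?_
  · simp only [rationalComponent, evalAt_congr (q k) fun j hj => hxy j hj.le, hxy k le_rfl]
  · refine strictMonoOn_of_deriv_pos (convex_Icc _ _)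
      (fun t _ => (hasDerivAt_rationalComponent (q k) x t).continuousAt.continuousWithinAt)
      fun t ht => ?_
    rw [interior_Icc] at ht
    rw [(hasDerivAt_rationalComponent (q k) x t).deriv]
    have := hI k x hx
    have := hc.trans_le (hq k x hx t (Ioo_subset_Icc_self ht))
    positivity
  · exact (hasDerivAt_rationalComponent (q k) x t).continuousAt.continuousWithinAt
  · rw [rationalComponent_update]
    simp
  · rw [rationalComponent_update, div_mul_cancel₀ _ (hI k x hx).ne']
    norm_num

theorem hasPartial_rationalComponent {k : ℕ} (q : MvPolynomial (Fin (k + 1)) ℝ) :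
    HasPartial k (rationalComponent q) := fun x _ =>
  (hasDerivAt_rationalComponent q x (x k)).differentiableAt.differentiableWithinAt

/-- Comparison of an increasing map of `[-1,1]` whose derivative is `u ^ 2` with its
approximation obtained from `1 + q ≈ u`. -/
theorem abs_sub_rationalComponent_le {k : ℕ} {q : MvPolynomial (Fin (k + 1)) ℝ} {x : ℕ → ℝ}
    {T u : ℝ → ℝ} {c D e : ℝ} (hc : 0 < c) (hD : 0 < D) (he : e ≤ D + 1)
    (hq : ∀ t ∈ Icc (-1 : ℝ) 1, c ≤ 1 + evalAt q x t)
    (hT : ∀ t ∈ Icc (-1 : ℝ) 1, HasDerivWithinAt T (u t ^ 2) (Icc (-1) 1) t)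
    (hu : ∀ t ∈ Icc (-1 : ℝ) 1, |u t| ≤ D)
    (hue : ∀ t ∈ Icc (-1 : ℝ) 1, |u t - (1 + evalAt q x t)| ≤ e)
    (hneg : T (-1) = -1) (hone : T 1 = 1) {t : ℝ} (ht : t ∈ Icc (-1 : ℝ) 1) :
    |u t ^ 2 - 2 / (∫ t in (-1 : ℝ)..1, (1 + evalAt q x t) ^ 2) * (1 + evalAt q x t) ^ 2|
        ≤ (3 * D + 1) * (1 + (2 * D + 1) ^ 2 / c ^ 2) * e ∧
      |T t - rationalComponent q (Function.update x k t)|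
        ≤ 2 * ((3 * D + 1) * (1 + (2 * D + 1) ^ 2 / c ^ 2) * e) := by
  have hm1 : (-1 : ℝ) ∈ Icc (-1 : ℝ) 1 := by norm_num
  have h1 : (1 : ℝ) ∈ Icc (-1 : ℝ) 1 := by norm_num
  have he0 : 0 ≤ e := (abs_nonneg _).trans (hue _ h1)
  set v : ℝ → ℝ := fun t => 1 + evalAt q x t with hv
  have hvc : Continuous fun t => v t ^ 2 := (continuous_const.add (continuous_evalAt q x)).pow 2
  set I := ∫ t in (-1 : ℝ)..1, v t ^ 2 with hI
  have hIc : 2 * c ^ 2 ≤ I := integral_one_add_evalAt_sq_ge hc.le hq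
  have hI0 : 0 < I := lt_of_lt_of_le (by positivity) hIc
  have hvD : ∀ t ∈ Icc (-1 : ℝ) 1, |v t| ≤ 2 * D + 1 := by
    intro t ht
    have := abs_sub_abs_le_abs_sub (v t) (u t)
    rw [abs_sub_comm] at this
    linarith [hu t ht, hue t ht]
  have hsq : ∀ t ∈ Icc (-1 : ℝ) 1, |u t ^ 2 - v t ^ 2| ≤ (3 * D + 1) * e := by
    intro t ht
    rw [sq_sub_sq, abs_mul]
    refine mul_le_mul ?_ (hue t ht) (abs_nonneg _) (by positivity)
    linarith [abs_add_le (u t) (v t), hu t ht, hvD t ht]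
  have hmvt : ∀ (f f' : ℝ → ℝ) (K : ℝ), (∀ t ∈ Icc (-1 : ℝ) 1, HasDerivWithinAt f (f' t) (Icc (-1) 1) t) →
      (∀ t ∈ Icc (-1 : ℝ) 1, |f' t| ≤ K) → ∀ t ∈ Icc (-1 : ℝ) 1, |f t - f (-1)| ≤ 2 * K := by
    intro f f' K hf hK t ht
    have := (convex_Icc (-1 : ℝ) 1).norm_image_sub_le_of_norm_hasDerivWithin_le hf hK hm1 ht
    have hK0 : 0 ≤ K := (abs_nonneg _).trans (hK t ht)
    rw [Real.norm_eq_abs, Real.norm_eq_abs] at this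
    have h2 : |t - -1| ≤ 2 := abs_le.2 ⟨by linarith [ht.1], by linarith [ht.2]⟩
    nlinarith
  -- `2 = T 1 - T (-1)`, so `I` deviates from `2` only by the error of the squares. The mean value
  -- inequality for `T - ∫ v ^ 2` gives this without integrability of `u ^ 2`.
  have hI2 : |2 - I| ≤ 2 * ((3 * D + 1) * e) := by
    have := hmvt (fun t => T t - ∫ s in (-1 : ℝ)..t, v s ^ 2) (fun t => u t ^ 2 - v t ^ 2)
      ((3 * D + 1) * e) (fun t ht => (hT t ht).sub
        (intervalIntegral.integral_hasDerivAt_right (hvc.intervalIntegrable _ _)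
          (hvc.stronglyMeasurableAtFilter _ _) hvc.continuousAt).hasDerivWithinAt) hsq 1 h1
    simp only [hneg, hone, intervalIntegral.integral_same] at this
    rw [← hI] at this
    refine le_trans (le_of_eq ?_) this
    congr 1
    ring
  have hder : ∀ t ∈ Icc (-1 : ℝ) 1, |u t ^ 2 - 2 / I * v t ^ 2|
      ≤ (3 * D + 1) * (1 + (2 * D + 1) ^ 2 / c ^ 2) * e := by
    intro t ht
    have e1 : u t ^ 2 - 2 / I * v t ^ 2 = (u t ^ 2 - v t ^ 2) - v t ^ 2 * ((2 - I) / I) := by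
      field_simp
      ring
    have h3 : |(2 - I) / I| ≤ (3 * D + 1) * e / c ^ 2 := by
      rw [abs_div, abs_of_pos hI0, div_le_div_iff₀ hI0 (by positivity)]
      calc |2 - I| * c ^ 2 ≤ 2 * ((3 * D + 1) * e) * c ^ 2 :=
            mul_le_mul_of_nonneg_right hI2 (by positivity)
        _ = (3 * D + 1) * e * (2 * c ^ 2) := by ring
        _ ≤ _ := mul_le_mul_of_nonneg_left hIc (by positivity)
    have h4 : |v t ^ 2| ≤ (2 * D + 1) ^ 2 := by
      rw [abs_pow]
      exact pow_le_pow_left₀ (abs_nonneg _) (hvD t ht) 2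
    rw [e1]
    refine (abs_sub _ _).trans ?_
    rw [abs_mul]
    have h5 := mul_le_mul h4 h3 (abs_nonneg _) (by positivity)
    calc |u t ^ 2 - v t ^ 2| + |v t ^ 2| * |(2 - I) / I|
        ≤ (3 * D + 1) * e + (2 * D + 1) ^ 2 * ((3 * D + 1) * e / c ^ 2) := add_le_add (hsq t ht) h5
      _ = _ := by ring
  refine ⟨hder t ht, ?_⟩
  have h6 := hmvt (fun t => T t - rationalComponent q (Function.update x k t))
    (fun t => u t ^ 2 - 2 / I * v t ^ 2) _ (fun t ht => (hT t ht).sub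
      (hasDerivAt_rationalComponent q x t).hasDerivWithinAt) hder t ht
  have h7 : rationalComponent q (Function.update x k (-1)) = -1 := by
    rw [rationalComponent_update]
    simp
  simp only [hneg, h7] at h6
  simpa using h6

end Triangular

/-! ### Approximation of the components. -/

section Approximation

theorem exists_isRootExtension_of_isHolomorphicDensity {Zρ Zπ : Type*}
    [NormedAddCommGroup Zρ] [NormedSpace ℂ Zρ] [CompleteSpace Zρ]
    [NormedAddCommGroup Zπ] [NormedSpace ℂ Zπ] [CompleteSpace Zπ]
    {p M L : ℝ} (hM : 0 < M) (hML : M ≤ L)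
    {Oρ : Set Zρ} {gρ : Zρ → ℂ} {ψρ : ℕ → Zρ} {fρ : (ℕ → ℝ) → ℝ}
    {Oπ : Set Zπ} {gπ : Zπ → ℂ} {ψπ : ℕ → Zπ} {fπ : (ℕ → ℝ) → ℝ}
    (hρ : IsHolomorphicDensity Oρ gρ ψρ p M L fρ)
    (hπ : IsHolomorphicDensity Oπ gπ ψπ p M L fπ)
    {b : ℕ → ℝ} (hb : ∀ j, 0 < b j) (hbρ : ∀ j, ‖ψρ j‖ ≤ b j) (hbπ : ∀ j, ‖ψπ j‖ ≤ b j)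
    (hbs : Summable b) :
    ∃ η C c₀ : ℝ, 0 < η ∧ 0 < C ∧ 0 < c₀ ∧ ∃ G, IsRootExtension fρ fπ b η C c₀ G := by
  have hL : 0 < L := hM.trans_le hML
  have hb0 : ∀ j, 0 ≤ b j := fun j => (hb j).le
  obtain ⟨r₁, Λ₁, hr₁, hΛ₁, H₁, hH₁⟩ := hρ.exists_isMarginalExtension hbρ hbs
  obtain ⟨r₂, Λ₂, hr₂, hΛ₂, H₂, hH₂⟩ := hπ.exists_isMarginalExtension hbπ hbs
  set Λ := max Λ₁ Λ₂ with hΛ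
  have hΛ0 : 0 < Λ := hΛ₁.trans_le (le_max_left _ _)
  set K := 2 / M + 8 * L / M ^ 2 with hK
  have hK0 : 0 < K := by positivity
  -- A common radius for both densities; the last two terms are the smallness conditions under which
  -- the marginals yield conditional extensions.
  set r := min (min r₁ r₂) (min (M / 2 / Λ) (M / L / 2 / (K * Λ))) with hr
  have hr0 : 0 < r := by
    refine lt_min (lt_min hr₁ hr₂) (lt_min ?_ ?_) <;> positivity
  have h1 : Λ * r ≤ M / 2 := by
    have : r ≤ M / 2 / Λ := (min_le_right _ _).trans (min_le_left _ _)
    rw [le_div_iff₀ hΛ0] at this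
    linarith
  have h2 : K * Λ * r ≤ M / L / 2 := by
    have : r ≤ M / L / 2 / (K * Λ) := (min_le_right _ _).trans (min_le_right _ _)
    rw [le_div_iff₀ (by positivity)] at this
    linarith
  have c₁ := (hH₁.mono hb0 ((min_le_left _ _).trans (min_le_left _ _) : r ≤ r₁)
    (le_max_left Λ₁ Λ₂)).isCondExtension hb0 hr0.le hM hML hΛ0.le h1 h2
  have c₂ := (hH₂.mono hb0 ((min_le_left _ _).trans (min_le_right _ _) : r ≤ r₂)
    (le_max_right Λ₁ Λ₂)).isCondExtension hb0 hr0.le hM hML hΛ0.le h1 h2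
  refine exists_isRootExtension c₁ c₂ hb hbs hr0 (by positivity) ?_ (by positivity)
  have h3 : M / L ≤ 1 := (div_le_one hL).2 hML
  have h4 : 1 ≤ L / M := (one_le_div hM).2 hML
  linarith

variable {fρ fπ : (ℕ → ℝ) → ℝ} {b : ℕ → ℝ} {η C c₀ : ℝ} {G : ℕ → (ℕ → ℂ) → ℂ}

theorem IsRootExtension.hasPartial (hG : IsRootExtension fρ fπ b η C c₀ G) (k : ℕ) :
    HasPartial k (knothe fρ fπ k) := fun x hx => by
  obtain ⟨u, _, _, hu⟩ := hG.ofReal k x hx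
  exact hu.differentiableWithinAt

/-- The square root of the derivative of the transport. -/
theorem IsRootExtension.exists_sqrt_deriv (hG : IsRootExtension fρ fπ b η C c₀ G)
    (hη : 0 < η) (hC : 0 < C) {B : ℝ} (hB : ∀ j, b j ≤ B) (k : ℕ) :
    ∃ u : (ℕ → ℝ) → ℝ, ∀ x ∈ cube, c₀ ≤ u x ∧ |u x| ≤ 1 + C * B ∧
      (G k (extendZero fun i : Fin (k + 1) => (x i : ℂ))).re = u x - 1 ∧
      HasDerivWithinAt (fun t => knothe fρ fπ k (Function.update x k t)) (u x ^ 2) (Icc (-1) 1)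
        (x k) := by
  have h := hG.ofReal k
  choose! u hu0 hu1 hu2 using h
  refine ⟨u, fun x hx => ⟨hu0 x hx, ?_, ?_, hu2 x hx⟩⟩
  · have h1 := hG.bound k (fun j => (x j : ℂ)) x hx (by simpa using hη.le)
    rw [hu1 x hx, Complex.norm_real, Real.norm_eq_abs, sub_self, norm_zero, add_zero, mul_one] at h1
    have h2 := mul_le_mul_of_nonneg_left (hB k) hC.le
    have h3 := abs_sub_abs_le_abs_sub (u x) 1
    rw [abs_one] at h3
    linarith
  · have hx' := ofReal_mem_nearCube (b := b) hη.le (k + 1) hx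
    have hmem : extendZero (fun i : Fin (k + 1) => (x i : ℂ)) ∈ nearCube b η (k + 1) := by
      refine ⟨x, hx, ?_⟩
      rw [Finset.sum_eq_zero fun j hj => ?_]
      · exact hη.le
      · simp [extendZero, Finset.mem_range.1 hj]
    rw [hG.congr k _ hmem _ hx' fun j hj => ?_, hu1 x hx, Complex.ofReal_re]
    simp [extendZero, show j < k + 1 by omega]

theorem partialDeriv_eq {k : ℕ} {T : (ℕ → ℝ) → ℝ} {x : ℕ → ℝ} {d : ℝ} (hx : x ∈ cube)
    (h : HasDerivWithinAt (fun t => T (Function.update x k t)) d (Icc (-1) 1) (x k)) :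
    partialDeriv k T x = d :=
  h.derivWithin (uniqueDiffOn_Icc (by norm_num) _ (hx k (mem_univ k)))

theorem supNorm_le {T : (ℕ → ℝ) → ℝ} {K : ℝ} (h : ∀ x ∈ cube, |T x| ≤ K) :
    supNorm T ≤ ENNReal.ofReal K :=
  iSup₂_le fun x hx => by
    rw [Real.enorm_eq_ofReal_abs]
    exact ENNReal.ofReal_le_ofReal (h x hx)

/-- Approximation of one component of the transport. -/
theorem IsRootExtension.exists_rationalComponent (hG : IsRootExtension fρ fπ b η C c₀ G)
    (hb : ∀ j, 0 < b j) (hη : 0 < η) (hC : 0 < C) (hc₀ : 0 < c₀) {B : ℝ} (hB : ∀ j, b j ≤ B) :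
    ∃ c K : ℝ, 0 < c ∧ 0 < K ∧ ∀ (ξ : ℕ → ℝ), (∀ j, 1 ≤ ξ j) → ∀ (k : ℕ) (ε s : ℝ), 0 < ε → 0 ≤ s →
      (indexSet ξ ε k).Finite →
      ∑' n : Fin (k + 1) → ℤ, ENNReal.ofReal (‖mFourierCoeff
        (fun θ : UnitAddTorus (Fin (k + 1)) => G k (extendZero (torusCos θ))) n‖ *
        gammaWeight ξ k (Finsupp.equivFunOnFinite.symm fun i => (n i).natAbs) ^ (-s)) < ∞ →
      ∃ q ∈ MvPolynomial.restrictSupport ℝ (indexSet ξ ε k),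
        (∀ x ∈ cube, ∀ t ∈ Icc (-1 : ℝ) 1, c ≤ 1 + evalAt q x t) ∧
        supNorm (fun x => knothe fρ fπ k x - rationalComponent q x)
          ≤ ENNReal.ofReal K * (ENNReal.ofReal (ε ^ s) * ∑' n : Fin (k + 1) → ℤ,
            ENNReal.ofReal (‖mFourierCoeff
              (fun θ : UnitAddTorus (Fin (k + 1)) => G k (extendZero (torusCos θ))) n‖ *
              gammaWeight ξ k (Finsupp.equivFunOnFinite.symm fun i => (n i).natAbs) ^ (-s))) ∧
        supNorm (fun x => partialDeriv k (knothe fρ fπ k) x - partialDeriv k (rationalComponent q) x)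
          ≤ ENNReal.ofReal K * (ENNReal.ofReal (ε ^ s) * ∑' n : Fin (k + 1) → ℤ,
            ENNReal.ofReal (‖mFourierCoeff
              (fun θ : UnitAddTorus (Fin (k + 1)) => G k (extendZero (torusCos θ))) n‖ *
              gammaWeight ξ k (Finsupp.equivFunOnFinite.symm fun i => (n i).natAbs) ^ (-s))) := by
  have hB0 : 0 < B := (hb 0).trans_le (hB 0)
  set D := 1 + C * B with hD
  have hD0 : 0 < D := by positivity
  have hcD : c₀ ≤ D := by
    obtain ⟨u, hu⟩ := hG.exists_sqrt_deriv hη hC hB 0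
    have hz : (fun _ => 0 : ℕ → ℝ) ∈ cube := fun j _ => by norm_num
    exact (hu _ hz).1.trans ((le_abs_self _).trans (hu _ hz).2.1)
  -- `c₀ / 2` serves the truncated expansion and `1` the fallback `q = 0`.
  set c := min (c₀ / 2) 1 with hc
  have hc0 : 0 < c := lt_min (half_pos hc₀) one_pos
  set κ := (D + 1) * (2 / c₀) with hκ
  have hκ0 : 0 < κ := by positivity
  set K := 2 * ((3 * D + 1) * (1 + (2 * D + 1) ^ 2 / c ^ 2)) * κ with hK
  have hK0 : 0 < K := by positivity
  refine ⟨c, K, hc0, hK0, fun ξ hξ k ε s hε hs hfin hw => ?_⟩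
  set W := ∑' n : Fin (k + 1) → ℤ, ENNReal.ofReal (‖mFourierCoeff
        (fun θ : UnitAddTorus (Fin (k + 1)) => G k (extendZero (torusCos θ))) n‖ *
        gammaWeight ξ k (Finsupp.equivFunOnFinite.symm fun i => (n i).natAbs) ^ (-s)) with hW
  obtain ⟨u, hu⟩ := hG.exists_sqrt_deriv hη hC hB k
  set e := ε ^ s * W.toReal with he
  have he0 : 0 ≤ e := mul_nonneg (Real.rpow_nonneg hε.le _) ENNReal.toReal_nonneg
  have heW : ENNReal.ofReal e = ENNReal.ofReal (ε ^ s) * W := by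
    rw [he, ENNReal.ofReal_mul (Real.rpow_nonneg hε.le _), ENNReal.ofReal_toReal hw.ne]
  obtain ⟨q, hq, hqc, e', he'D, he'κ, hqe⟩ : ∃ q ∈ MvPolynomial.restrictSupport ℝ (indexSet ξ ε k),
      (∀ x ∈ cube, ∀ t ∈ Icc (-1 : ℝ) 1, c ≤ 1 + evalAt q x t) ∧ ∃ e' : ℝ, e' ≤ D + 1 ∧
      e' ≤ κ * e ∧ ∀ x ∈ cube, ∀ t ∈ Icc (-1 : ℝ) 1,
        |u (Function.update x k t) - (1 + evalAt q x t)| ≤ e' := by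
    -- A small error keeps `1 + q` above `c₀ / 2`. For a large one the truncation might destroy
    -- positivity, so `q = 0` is taken: its error is at most `D + 1`, which is at most `κ * e`
    -- because `e > c₀ / 2`.
    rcases le_or_gt e (c₀ / 2) with hle | hgt
    · obtain ⟨q, hq, hqx⟩ := exists_polynomial_approx hξ hε hs hfin
        (g := fun z => G k (extendZero z)) (hG.continuous_torusCos hb hη k) hw
      have hqe : ∀ x ∈ cube, ∀ t ∈ Icc (-1 : ℝ) 1,
          |u (Function.update x k t) - (1 + evalAt q x t)| ≤ e := by
        intro x hx t ht
        have hxt := update_mem_cube hx k ht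
        have h1 := hqx (fun i => Function.update x k t i) fun j => hxt j (mem_univ _)
        rw [(hu _ hxt).2.2.1] at h1
        refine le_trans (le_of_eq ?_) h1
        congr 1
        simp only [evalAt]
        ring
      refine ⟨q, hq, fun x hx t ht => ?_, e, by linarith, ?_, hqe⟩
      · have h1 := (abs_le.1 (hqe x hx t ht)).2
        have h2 := (hu _ (update_mem_cube hx k ht)).1
        have h3 : c ≤ c₀ / 2 := min_le_left _ _
        linarith
      · refine le_mul_of_one_le_left he0 ?_
        rw [hκ, ← mul_div_assoc, one_le_div hc₀]
        linarith
    · refine ⟨0, Submodule.zero_mem _, fun x hx t ht => ?_, D + 1, le_rfl, ?_, fun x hx t ht => ?_⟩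
      · simp [evalAt, hc]
      · rw [hκ, mul_assoc]
        refine le_mul_of_one_le_right (by positivity) ?_
        rw [div_mul_eq_mul_div, one_le_div hc₀]
        linarith
      · have h1 := (hu _ (update_mem_cube hx k ht)).2.1
        have h2 := abs_sub (u (Function.update x k t)) 1
        rw [abs_one] at h2
        simp only [evalAt, map_zero, add_zero]
        linarith
  have hK' : 2 * ((3 * D + 1) * (1 + (2 * D + 1) ^ 2 / c ^ 2) * e') ≤ K * e := by
    have h1 : 0 ≤ 2 * ((3 * D + 1) * (1 + (2 * D + 1) ^ 2 / c ^ 2)) := by positivity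
    calc _ = 2 * ((3 * D + 1) * (1 + (2 * D + 1) ^ 2 / c ^ 2)) * e' := by ring
      _ ≤ 2 * ((3 * D + 1) * (1 + (2 * D + 1) ^ 2 / c ^ 2)) * (κ * e) :=
        mul_le_mul_of_nonneg_left he'κ h1
      _ = K * e := by rw [hK]; ring
  have hcmp : ∀ x ∈ cube,
      |u x ^ 2 - 2 / (∫ t in (-1 : ℝ)..1, (1 + evalAt q x t) ^ 2) * (1 + evalAt q x (x k)) ^ 2|
        ≤ (3 * D + 1) * (1 + (2 * D + 1) ^ 2 / c ^ 2) * e' ∧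
      |knothe fρ fπ k x - rationalComponent q x|
        ≤ 2 * ((3 * D + 1) * (1 + (2 * D + 1) ^ 2 / c ^ 2) * e') := by
    intro x hx
    have := abs_sub_rationalComponent_le (T := fun t => knothe fρ fπ k (Function.update x k t))
      (u := fun t => u (Function.update x k t)) hc0 hD0 he'D (hqc x hx) (fun t ht => ?_)
      (fun t ht => (hu _ (update_mem_cube hx k ht)).2.1) (hqe x hx) (hG.knothe_neg_one k x hx)
      (hG.knothe_one k x hx) (hx k (mem_univ k))
    · simpa only [Function.update_eq_self] using this
    · have h1 := (hu _ (update_mem_cube hx k ht)).2.2.2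
      simpa only [Function.update_idem, Function.update_self] using h1
  refine ⟨q, hq, hqc, ?_, ?_⟩
  · rw [← heW, ← ENNReal.ofReal_mul hK0.le]
    exact supNorm_le fun x hx => (hcmp x hx).2.trans hK'
  · rw [← heW, ← ENNReal.ofReal_mul hK0.le]
    refine supNorm_le fun x hx => le_trans ?_ hK'
    rw [partialDeriv_eq hx (hu x hx).2.2.2,
      partialDeriv_eq hx (hasDerivAt_rationalComponent q x (x k)).hasDerivWithinAt]
    have h1 := (hcmp x hx).1
    have h2 := (abs_nonneg _).trans h1
    linarith

theorem finite_indexSet {ξ : ℕ → ℝ} {ε : ℝ} (h : totalCard ξ ε < ∞) (k : ℕ) :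
    (indexSet ξ ε k).Finite := by
  have h1 : ((indexSet ξ ε k).encard : ℝ≥0∞) < ∞ :=
    (ENNReal.le_tsum (f := fun k => ((indexSet ξ ε k).encard : ℝ≥0∞)) k).trans_lt h
  rw [ENat.toENNReal_lt_top] at h1
  exact Set.encard_lt_top_iff.1 h1

/-- Raise `ε ^ p ≤ S / N` to the power `1 / p - 1` and use `p * (1 / p - 1) = 1 - p`. This converts
the threshold into the cardinality. -/
theorem ofReal_rpow_le_of_mul_le {N S : ℝ≥0∞} {ε p : ℝ} (hp0 : 0 < p) (hp1 : p < 1) (hε : 0 < ε)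
    (hN : N ≠ ∞) (hN0 : N ≠ 0) (h : N * ENNReal.ofReal (ε ^ p) ≤ S) :
    ENNReal.ofReal (ε ^ (1 - p)) ≤ S ^ (1 / p - 1) * N ^ (-(1 / p) + 1) := by
  have hs : 0 < 1 / p - 1 := by linarith [one_lt_one_div hp0 hp1]
  have h1 : ENNReal.ofReal (ε ^ p) ≤ S / N := by
    rw [ENNReal.le_div_iff_mul_le (Or.inl hN0) (Or.inl hN), mul_comm]
    exact h
  have h2 := ENNReal.rpow_le_rpow h1 hs.le
  rw [ENNReal.ofReal_rpow_of_nonneg (Real.rpow_nonneg hε.le _) hs.le, ← Real.rpow_mul hε.le,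
    ENNReal.div_rpow_of_nonneg _ _ hs.le] at h2
  have e1 : p * (1 / p - 1) = 1 - p := by field_simp
  have e2 : -(1 / p) + 1 = -(1 / p - 1) := by ring
  rw [e1] at h2
  rwa [e2, ENNReal.rpow_neg, ← div_eq_mul_inv]

end Approximation

/-! ### The convergence rate. -/

/-- Powers are taken in `[0,∞]`, so the two bounds are void exactly when `N_ε = 0`, where
`0 ^ (-1/p + 1) = ∞`. -/
theorem mainTheorem3 {Zρ Zπ : Type*}
    [NormedAddCommGroup Zρ] [NormedSpace ℂ Zρ] [CompleteSpace Zρ]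
    [NormedAddCommGroup Zπ] [NormedSpace ℂ Zπ] [CompleteSpace Zπ]
    (p M L : ℝ) (hp0 : 0 < p) (hp1 : p < 1) (hM : 0 < M) (hML : M ≤ L)
    (Oρ : Set Zρ) (gρ : Zρ → ℂ) (ψρ : ℕ → Zρ) (fρ : (ℕ → ℝ) → ℝ)
    (Oπ : Set Zπ) (gπ : Zπ → ℂ) (ψπ : ℕ → Zπ) (fπ : (ℕ → ℝ) → ℝ)
    (hρ : IsHolomorphicDensity Oρ gρ ψρ p M L fρ)
    (hπ : IsHolomorphicDensity Oπ gπ ψπ p M L fπ)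
    (b : ℕ → ℝ) (hb : ∀ j, b j = max ‖ψρ j‖ ‖ψπ j‖) :
    (∀ k, HasPartial k (knothe fρ fπ k)) ∧
    ∃ α : ℝ, 0 < α ∧ ∃ C : ℝ, 0 < C ∧ ∀ ξ : ℕ → ℝ, (∀ j, ξ j = 1 + α / b j) →
      ∀ ε : ℝ, 0 < ε →
        totalCard ξ ε < ∞ ∧
        ∃ q : (k : ℕ) → MvPolynomial (Fin (k + 1)) ℝ,
          (∀ k, q k ∈ MvPolynomial.restrictSupport ℝ (indexSet ξ ε k)) ∧
          IsMonotoneTriangularBijection (fun k => rationalComponent (q k)) ∧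
          (∀ k, HasPartial k (rationalComponent (q k))) ∧
          ∑' k, supNorm (fun x => knothe fρ fπ k x - rationalComponent (q k) x)
            ≤ ENNReal.ofReal C * totalCard ξ ε ^ (-(1 / p) + 1) ∧
          ∑' k, supNorm (fun x =>
              partialDeriv k (knothe fρ fπ k) x - partialDeriv k (rationalComponent (q k)) x)
            ≤ ENNReal.ofReal C * totalCard ξ ε ^ (-(1 / p) + 1) := by
  have hbρ : ∀ j, ‖ψρ j‖ ≤ b j := fun j => by rw [hb]; exact le_max_left _ _
  have hbπ : ∀ j, ‖ψπ j‖ ≤ b j := fun j => by rw [hb]; exact le_max_right _ _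
  have hb0 : ∀ j, 0 < b j := fun j => (norm_pos_iff.2 (hρ.ne_zero j)).trans_le (hbρ j)
  have hs : Summable fun j => b j ^ p := by
    refine Summable.of_nonneg_of_le (fun j => Real.rpow_nonneg (hb0 j).le _) (fun j => ?_)
      (hρ.summable.add hπ.summable)
    have h1 := Real.rpow_nonneg (norm_nonneg (ψρ j)) p
    have h2 := Real.rpow_nonneg (norm_nonneg (ψπ j)) p
    rw [hb]
    rcases max_choice ‖ψρ j‖ ‖ψπ j‖ with h | h <;> rw [h] <;> linarith
  have hbs := summable_of_summable_rpow hb0 hp0 hp1 hs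
  obtain ⟨η, C₁, c₀, hη, hC₁, hc₀, G, hG⟩ :=
    exists_isRootExtension_of_isHolomorphicDensity hM hML hρ hπ hb0 hbρ hbπ hbs
  refine ⟨hG.hasPartial, ?_⟩
  obtain ⟨α, hα, hsum⟩ := exists_tsum_mul_gammaWeight_rpow_lt_top hb0 hp0 hp1 hs hη
  obtain ⟨S, hS, hcard⟩ := exists_totalCard_mul_rpow_le hb0 hp0 hp1 hs hα
    (ξ := fun j => 1 + α / b j) fun _ => rfl
  obtain ⟨c, K, hc, hK, happrox⟩ := hG.exists_rationalComponent hb0 hη hC₁ hc₀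
    (B := ∑' j, b j) fun j => hbs.le_tsum j fun i _ => (hb0 i).le
  have hA := hsum (fun j => 1 + α / b j) (fun _ => rfl) C₁ hC₁.le
    (fun k => mFourierCoeff fun θ : UnitAddTorus (Fin (k + 1)) => G k (extendZero (torusCos θ)))
    fun k n ρ hρ1 hρη => hG.norm_coeff_le hb0 hC₁ k n hρ1 hρη
  set W : ℕ → ℝ≥0∞ := fun k => ∑' n : Fin (k + 1) → ℤ, ENNReal.ofReal (‖mFourierCoeff
    (fun θ : UnitAddTorus (Fin (k + 1)) => G k (extendZero (torusCos θ))) n‖ *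
    gammaWeight (fun j => 1 + α / b j) k (Finsupp.equivFunOnFinite.symm fun i => (n i).natAbs)
      ^ (-(1 - p))) with hW
  set A := ∑' k, W k with hAdef
  set Q : ℝ≥0∞ := ENNReal.ofReal K * A * S ^ (1 / p - 1) with hQ
  have hQt : Q ≠ ∞ := ENNReal.mul_ne_top (ENNReal.mul_ne_top ENNReal.ofReal_ne_top hA.ne)
    (ENNReal.rpow_ne_top_of_nonneg (by linarith [one_lt_one_div hp0 hp1]) hS.ne)
  -- `Q` collects the stability constant, the weighted coefficient sum and the counting constant,
  -- none of which depends on `ε`; the summand `1` secures positivity.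
  refine ⟨α, hα, Q.toReal + 1, by positivity, fun ξ hξ ε hε => ?_⟩
  obtain rfl : ξ = fun j => 1 + α / b j := funext hξ
  have hξ1 : ∀ j, 1 ≤ 1 + α / b j := fun j => by
    have := hb0 j
    have : 0 < α / b j := by positivity
    linarith
  have hNS := hcard ε hε
  have hN : totalCard (fun j => 1 + α / b j) ε < ∞ := by
    refine lt_top_iff_ne_top.2 fun h => ?_
    rw [h, ENNReal.top_mul (ENNReal.ofReal_pos.2 (Real.rpow_pos_of_pos hε _)).ne'] at hNS
    exact hS.ne (top_le_iff.1 hNS)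
  refine ⟨hN, ?_⟩
  choose q hq hqc hqT hqd using fun k => happrox _ hξ1 k ε (1 - p) hε (by linarith)
    (finite_indexSet hN k) ((ENNReal.le_tsum k).trans_lt hA)
  have hfinal : ∑' k, ENNReal.ofReal K * (ENNReal.ofReal (ε ^ (1 - p)) * W k)
      ≤ ENNReal.ofReal (Q.toReal + 1)
        * totalCard (fun j => 1 + α / b j) ε ^ (-(1 / p) + 1) := by
    rcases eq_or_ne (totalCard (fun j => 1 + α / b j) ε) 0 with h0 | h0
    · rw [h0, ENNReal.zero_rpow_of_neg (by linarith [one_lt_one_div hp0 hp1]),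
        ENNReal.mul_top (ENNReal.ofReal_pos.2 (by positivity)).ne']
      exact le_top
    · rw [ENNReal.tsum_mul_left, ENNReal.tsum_mul_left]
      have h1 := ofReal_rpow_le_of_mul_le hp0 hp1 hε hN.ne h0 hNS
      calc ENNReal.ofReal K * (ENNReal.ofReal (ε ^ (1 - p)) * A)
          ≤ ENNReal.ofReal K * (S ^ (1 / p - 1)
            * totalCard (fun j => 1 + α / b j) ε ^ (-(1 / p) + 1) * A) := by gcongr
        _ = Q * totalCard (fun j => 1 + α / b j) ε ^ (-(1 / p) + 1) := by rw [hQ]; ring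
        _ ≤ _ := by
          gcongr
          rw [← ENNReal.ofReal_toReal hQt]
          exact ENNReal.ofReal_le_ofReal (by rw [ENNReal.toReal_ofReal ENNReal.toReal_nonneg]; linarith)
  exact ⟨q, hq, isMonotoneTriangularBijection_rationalComponent hc hqc,
    fun k => hasPartial_rationalComponent (q k),
    (ENNReal.tsum_le_tsum hqT).trans hfinal, (ENNReal.tsum_le_tsum hqd).trans hfinal⟩
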